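/- **Setting.** For $\theta=(H,\lambda,\sigma)$ with $H\in(0,1)$, $\lambda>0$, $\sigma\neq0$, the stationary fractional Ornstein–Uhlenbeck process with parameter $\theta$ is $X_t=\sigma\int_{-\infty}^t e^{-\lambda(t-u)}\,dB^H_u$, $t\in\mathbb R$ (pathwise improper Riemann–Stieltjes integral), where $B^H$ is a two-sided fractional Brownian motion with Hurst parameter $H$. Put $$\rho_\theta(t)=2\sigma^2c_H\int_0^\infty\cos(tx)\frac{x^{1-2H}}{\lambda^2+x^2}\,dx,\qquad c_H=\frac{\Gamma(2H+1)\sin(\pi H)}{2\pi}.$$ A filter of order $l\ge1$ and length $L+1$ is a vector $\mathbf a=(a_0,\dots,a_L)\in\mathbb R^{L+1}$ with $\sum_q a_qq^r=0$ for $0\le r<l$ and $\sum_q a_qq^l\ne0$; its vector $\mathbf b=(b_0,\dots,b_L)$ is $b_0=\sum_q a_q^2$, $b_k=2\sum_{j=0}^{L-k}a_{k+j}a_j$ for $k>0$. Given $L$ filters $\mathbf a_1,\dots,\mathbf a_L$ of length $L+1$, a step size $\alpha>0$ and a symmetric positive-definite $L\times L$ matrix $A$, let $B$ be the $L\times(L+1)$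 matrix with rows $\mathbf b_1,\dots,\mathbf b_L$ and let, for $1\le\ell\le L$, $$V_\ell(\theta)=\sum_{k=0}^L b_{\ell,k}\,\rho_\theta(\alpha k),\quad \varphi_\ell(t)=\sum_{q=0}^L a_{\ell,q}X_{t-\alpha q},\quad g_\ell(t,\theta)=\varphi_\ell(t)^2-V_\ell(\theta).$$ With $t_i=i\alpha$ put, for $N\ge L$, $$\hat{\mathbf g}_N(\theta)=\frac1{N-L+1}\sum_{i=L}^N\mathbf g(t_i,\theta),\qquad \hat Q_N(\theta)=\hat{\mathbf g}_N(\theta)'A\,\hat{\mathbf g}_N(\theta).$$ Given a compact parameter set $\Theta\subset\mathbb R^3$, a GMM estimator is a sequence of random vectors $\hat\theta_N$ such that almost surely $\hat\theta_N\in\operatorname{argmin}_{\theta\in\Theta}\hat Q_N(\theta)$ for all $N\ge L$. Finally let $G(\theta)=E[\nabla_\theta\mathbf g(t,\theta)]=-\nabla_\theta\mathbf V(\theta)$ (an $L\times3$ matrix), $\mathcal C(\theta)=[G(\theta)'AG(\theta)]^{-1}G(\theta)'A$, and $$\Omega(\theta)_{ij}=2\sum_{k\in\mathbb Z}\Big[\sum_{q,q'=0}^L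 a_{i,q}\,a_{j,q'}\,\rho_\theta\big(\alpha(k-q+q')\big)\Big]^2 .$$ **Proposition 3.2.** Let $\Theta\subset\mathbb R^3$ be a closed rectangle, given by $H_1\le H\le H_2$, $\lambda_1\le\lambda\le\lambda_2$, $\sigma_1\le\sigma\le\sigma_2$, with $0<H_1$, $H_2<1$, $0<\lambda_1$, $\lambda_2<\exp(\Psi(3))$ (where $\Psi=(\log\Gamma)'$), and $\sigma$ of known sign on $\Theta$ ($\sigma_1>0$ or $\sigma_2<0$). There is $\alpha_0>0$, depending only on $\Theta$, such that the following holds for every $\alpha\in(0,\alpha_0)$, every $L\ge3$, all filters $\mathbf a_1,\dots,\mathbf a_L$ of length $L+1$ and orders $\ge1$ for which $B$ has full rank $L$, every symmetric positive-definite $L\times L$ matrix $A$ and every $\theta$ in the interior of $\Theta$. If $X$ is a stationary fractional Ornstein–Uhlenbeck process with parameter $\theta$ and $\hat\theta_N$ is a GMM estimator built from $X$, $\Theta$, $\alpha$, $A$ and these filters, then $\hat\theta_N$ is (strongly) consistent, $\hat\theta_N\to\theta$ almost surely; the $V_\ell$ are differentiable at $\theta$, $G(\theta)'AG(\theta)$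 is invertible, the series defining $\Omega=\Omega(\theta)$ converge and $\Omega$ is positive semidefinite; and $$\sqrt N(\hat\theta_N-\theta)\xrightarrow{d}\mathcal N\big(0,\ \mathcal C(\theta)\,\Omega\,\mathcal C(\theta)'\big).$$ -/

import Mathlib

open MeasureTheory ProbabilityTheory Filter Topology

noncomputable section

namespace FOU

/-! ### The stationary fractional Ornstein-Uhlenbeck process -/

/-- Two-sided fractional Brownian motion with Hurst parameter `H`: a centered Gaussian process
indexed by `ℝ`, with covariance `(|s|^{2H} + |t|^{2H} - |t - s|^{2H}) / 2` and almost surely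
continuous paths. -/
structure IsFractionalBrownianMotion {Ω : Type*} [MeasurableSpace Ω] (H : ℝ) (B : ℝ → Ω → ℝ)
    (μ : Measure Ω) : Prop where
  isGaussianProcess : IsGaussianProcess B μ
  centered : ∀ t, ∫ ω, B t ω ∂μ = 0
  covariance_eq : ∀ s t, cov[B s, B t; μ] =
    (|s| ^ (2 * H) + |t| ^ (2 * H) - |t - s| ^ (2 * H)) / 2
  continuous_paths : ∀ᵐ ω ∂μ, Continuous fun t => B t ω

/-- `I` is the Riemann-Stieltjes integral `∫_a^b f dg` (for `a ≤ b`): the tagged Riemann-Stieltjes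
sums over partitions `a = s 0 ≤ s 1 ≤ ⋯ ≤ s n = b` with tags `τ i ∈ [s i, s (i+1)]` tend to `I`
as the mesh tends to `0`. -/
def HasRSIntegral (f g : ℝ → ℝ) (a b I : ℝ) : Prop :=
  ∀ ε > 0, ∃ δ > 0, ∀ (n : ℕ) (s τ : ℕ → ℝ), s 0 = a → s n = b →
    (∀ i < n, s i ≤ τ i ∧ τ i ≤ s (i + 1) ∧ s (i + 1) - s i < δ) →
    |∑ i ∈ Finset.range n, f (τ i) * (g (s (i + 1)) - g (s i)) - I| < ε

/-- `I` is the improper Riemann-Stieltjes integral `∫_{-∞}^b f dg`. -/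
def HasRSIntegralIic (f g : ℝ → ℝ) (b I : ℝ) : Prop :=
  ∃ J : ℝ → ℝ, (∀ a ≤ b, HasRSIntegral f g a b (J a)) ∧ Tendsto J atBot (𝓝 I)

/-- `X` is the stationary fractional Ornstein-Uhlenbeck process with parameter
`θ = (H, λ, σ) = (θ 0, θ 1, θ 2)`:
`X t = σ ∫_{-∞}^t exp (-λ (t - u)) dB_u` for all real `t`, almost surely, where `B` is a fractional
Brownian motion with Hurst parameter `H` and the integral is a pathwise Riemann-Stieltjes one. -/
def IsStationaryFOU {Ω : Type*} [MeasurableSpace Ω] (θ : EuclideanSpace ℝ (Fin 3))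
    (X : ℝ → Ω → ℝ) (μ : Measure Ω) : Prop :=
  ∃ B : ℝ → Ω → ℝ, IsFractionalBrownianMotion (θ 0) B μ ∧
    ∀ᵐ ω ∂μ, ∀ t : ℝ, ∃ I : ℝ,
      HasRSIntegralIic (fun u => Real.exp (-(θ 1) * (t - u))) (fun u => B u ω) t I ∧
      X t ω = θ 2 * I

/-- The constant `c_H = Γ(2H + 1) sin(π H) / (2π)`. -/
def cH (H : ℝ) : ℝ := Real.Gamma (2 * H + 1) * Real.sin (Real.pi * H) / (2 * Real.pi)

/-- The autocovariance function
`ρ_θ(t) = 2 σ² c_H ∫_0^∞ cos (t x) x^{1 - 2H} / (λ² + x²) dx`, with `θ = (H, λ, σ)`. -/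
def rho (θ : EuclideanSpace ℝ (Fin 3)) (t : ℝ) : ℝ :=
  2 * (θ 2) ^ 2 * cH (θ 0) *
    ∫ x in Set.Ioi (0 : ℝ), Real.cos (t * x) * (x ^ (1 - 2 * θ 0) / ((θ 1) ^ 2 + x ^ 2))

/-- The digamma function on the real line, `Ψ(x) = d/dx log Γ(x)`. -/
def digamma (x : ℝ) : ℝ := deriv (fun y => Real.log (Real.Gamma y)) x

/-- The closed rectangle of the parameter vectors lying coordinatewise between `lo` and `hi`. -/
def rectangle (lo hi : EuclideanSpace ℝ (Fin 3)) : Set (EuclideanSpace ℝ (Fin 3)) :=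
  {θ | ∀ i, lo i ≤ θ i ∧ θ i ≤ hi i}

/-! ### Filters -/

/-- `a = (a 0, …, a L)` is a filter of length `L + 1` and order `l`. -/
def IsFilter {L : ℕ} (a : Fin (L + 1) → ℝ) (l : ℕ) : Prop :=
  if l = 0 then a = Pi.single 0 1
  else (∀ r < l, ∑ q, a q * ((q : ℕ) : ℝ) ^ r = 0) ∧ ∑ q, a q * ((q : ℕ) : ℝ) ^ l ≠ 0

/-- The vector `b = (b 0, …, b L)` of a filter `a`: `b 0 = ∑ q, a_q ^ 2` and
`b k = 2 ∑_{j = 0}^{L - k} a_{k + j} a_j` for `k > 0`. -/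
def bVec {L : ℕ} (a : Fin (L + 1) → ℝ) (k : Fin (L + 1)) : ℝ :=
  if k = 0 then ∑ q, a q ^ 2
  else 2 * ∑ m : Fin (L + 1), ∑ j : Fin (L + 1), if (m : ℕ) = k + j then a m * a j else 0

/-- The `L × (L + 1)` matrix `B` whose rows are the `b`-vectors of the filters `a 1, …, a L`. -/
def bMatrix {L : ℕ} (a : Fin L → Fin (L + 1) → ℝ) : Matrix (Fin L) (Fin (L + 1)) ℝ :=
  Matrix.of fun i k => bVec (a i) k

/-- `V(θ) = ∑ k, b_k ρ_θ(α k)` for a filter `a` and step size `α`. -/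
def V {L : ℕ} (a : Fin (L + 1) → ℝ) (α : ℝ) (θ : EuclideanSpace ℝ (Fin 3)) : ℝ :=
  ∑ k : Fin (L + 1), bVec a k * rho θ (α * ((k : ℕ) : ℝ))

/-- The filtered path `φ(t) = ∑ q, a_q x_{t - α q}`. -/
def filtered {L : ℕ} (a : Fin (L + 1) → ℝ) (α : ℝ) (x : ℝ → ℝ) (t : ℝ) : ℝ :=
  ∑ q : Fin (L + 1), a q * x (t - α * ((q : ℕ) : ℝ))

/-! ### The GMM estimator -/

/-- The vector `g(t, θ)` with components `φ_ℓ(t)² - V_ℓ(θ)`, along a path `x`. -/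
def g {L : ℕ} (a : Fin L → Fin (L + 1) → ℝ) (α : ℝ) (x : ℝ → ℝ) (t : ℝ)
    (θ : EuclideanSpace ℝ (Fin 3)) : Fin L → ℝ :=
  fun ℓ => filtered (a ℓ) α x t ^ 2 - V (a ℓ) α θ

/-- The vector of sampled differences
`ĝ_N(θ) = (N - L + 1)⁻¹ ∑_{i = L}^N g(t_i, θ)`, with observation times `t_i = i α`. -/
def gHat {L : ℕ} (a : Fin L → Fin (L + 1) → ℝ) (α : ℝ) (x : ℝ → ℝ) (N : ℕ)
    (θ : EuclideanSpace ℝ (Fin 3)) : Fin L → ℝ :=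
  ((N : ℝ) - (L : ℝ) + 1)⁻¹ • ∑ i ∈ Finset.Icc L N, g a α x ((i : ℝ) * α) θ

/-- `Q̂_N(θ) = ĝ_N(θ)' A ĝ_N(θ)`. -/
def QHat {L : ℕ} (a : Fin L → Fin (L + 1) → ℝ) (α : ℝ) (A : Matrix (Fin L) (Fin L) ℝ)
    (x : ℝ → ℝ) (N : ℕ) (θ : EuclideanSpace ℝ (Fin 3)) : ℝ :=
  gHat a α x N θ ⬝ᵥ A.mulVec (gHat a α x N θ)

/-- `θHat` is a GMM estimator over the parameter set `Θ`: a sequence of random vectors such that,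
almost surely, `θHat N` minimizes `Q̂_N` over `Θ` as soon as `N ≥ L`. -/
structure IsGMMEstimator {Ω : Type*} [MeasurableSpace Ω] {L : ℕ} (a : Fin L → Fin (L + 1) → ℝ)
    (α : ℝ) (A : Matrix (Fin L) (Fin L) ℝ) (Θ : Set (EuclideanSpace ℝ (Fin 3)))
    (X : ℝ → Ω → ℝ) (μ : Measure Ω) (θHat : ℕ → Ω → EuclideanSpace ℝ (Fin 3)) : Prop where
  aemeasurable : ∀ N, AEMeasurable (θHat N) μ
  isMinOn : ∀ᵐ ω ∂μ, ∀ N, L ≤ N →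
    θHat N ω ∈ Θ ∧ IsMinOn (QHat a α A (fun t => X t ω) N) Θ (θHat N ω)

/-! ### The asymptotic covariance -/

/-- The `L × 3` matrix `G(θ) = E[∇_θ g(t, θ)]`. As `φ_ℓ(t)²` does not depend on `θ`, the gradient
`∇_θ g(t, θ)` is deterministic, and its `(ℓ, j)` entry is `-∂V_ℓ/∂θ_j`. -/
def G {L : ℕ} (a : Fin L → Fin (L + 1) → ℝ) (α : ℝ) (θ : EuclideanSpace ℝ (Fin 3)) :
    Matrix (Fin L) (Fin 3) ℝ :=
  Matrix.of fun ℓ j => -(fderiv ℝ (V (a ℓ) α) θ (EuclideanSpace.single j 1))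

/-- `C(θ) = [G(θ)' A G(θ)]⁻¹ G(θ)' A`. -/
def C {L : ℕ} (a : Fin L → Fin (L + 1) → ℝ) (α : ℝ) (A : Matrix (Fin L) (Fin L) ℝ)
    (θ : EuclideanSpace ℝ (Fin 3)) : Matrix (Fin 3) (Fin L) ℝ :=
  ((G a α θ).transpose * A * G a α θ)⁻¹ * (G a α θ).transpose * A

/-- `E[φ_i(t_{n+k}) φ_j(t_n)] = ∑_{q, q'} a^i_q a^j_{q'} ρ_θ(α (k - q + q'))`. -/
def crossCov {L : ℕ} (a : Fin L → Fin (L + 1) → ℝ) (α : ℝ) (θ : EuclideanSpace ℝ (Fin 3))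
    (i j : Fin L) (k : ℤ) : ℝ :=
  ∑ q : Fin (L + 1), ∑ q' : Fin (L + 1),
    a i q * a j q' * rho θ (α * ((k : ℝ) - ((q : ℕ) : ℝ) + ((q' : ℕ) : ℝ)))

/-- The `L × L` matrix `Ω_{ij} = 2 ∑_{k ∈ ℤ} E[φ_i(t_{n+k}) φ_j(t_n)]²`. -/
def OmegaMatrix {L : ℕ} (a : Fin L → Fin (L + 1) → ℝ) (α : ℝ) (θ : EuclideanSpace ℝ (Fin 3)) :
    Matrix (Fin L) (Fin L) ℝ :=
  Matrix.of fun i j => 2 * ∑' k : ℤ, crossCov a α θ i j k ^ 2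

end FOU

end

open MeasureTheory ProbabilityTheory Filter Topology

noncomputable section

namespace FOU

/-! ### The spectral integral of fractional Brownian motion -/

section

/-! The estimator matches empirical variances of the filtered process with `V`. Two facts suffice:
`V` can be inverted on the rectangle with a Lipschitz bound, and the empirical variances satisfy a
strong law and a central limit theorem.

Inversion. A filter of order at least 1 annihilates constants, so `V` only sees the variogram ρ(0) -
ρ(αk), and full rank of the matrix B recovers the variogram at the lags α, ..., Lα from `V`
(`exists_norm_le_of_bMatrix`). Since x²/(λ²+x²) = 1 - λ²/(λ²+x²), the variogram at lag t equals
(σ²/2) t^(2H) (1 - t^(2-2H) κ(t,H,λ)) (`rho_zero_sub_rho`), and the slope of κ in λ stays away from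
0 as t → 0 (`exists_isRegularRemainder`). Taking logarithms at the lags α, 2α, 3α gives three nearly
linear equations for log(σ²/2), H and λ. The combination with weights log(3/2), -log 3, log 2
annihilates both constants and log n, and leaves a multiple of the λ-term which is nonzero by strict
convexity of exp (`log_mul_rpow_combination_pos`). For small α the remaining interaction between H
and λ is absorbed (`exists_identification_of_le`).

Fluctuations. The spectral function of a Riemann-Stieltjes sum is a geometric sum, and passing to
the limit in characteristic functions shows that X is Gaussian with covariance ρ
(`IsStationaryFOU.isCenteredGaussian`). Because the filter coefficients sum to 0, the filtered
covariances are O(1/|k|) for every H in (0,1) (`exists_abs_sum_rho_le`), hence square summable. A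
quadratic form in a Gaussian vector has the law of Σ m_k ξ_k² with independent standard normal ξ_k.
After normalization Σ m_k² converges, while max |m_k| is bounded by row sums and tends to 0, so the
limit is normal (`tendsto_integral_cexp_sum_filtered_sq`). The linear growth of the variance gives
the strong law.

Conclusion. The estimator is a nonlinear least squares solution with data m = ĝ_N(θ₀). The Lipschitz
bound gives ‖θ̂_N - θ₀‖ = O(‖m‖), hence consistency. Pythagoras shows that θ̂_N - θ₀ equals the
linearized solution -C m up to o(‖m‖) (`exists_norm_leastSquares_sub_le`), and Slutsky's lemma
transfers the limit law. -/

theorem one_sub_cos_le_two_mul_min (z : ℝ) : 1 - Real.cos z ≤ 2 * min 1 (z ^ 2) := by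
  have h1 := Real.neg_one_le_cos z
  have h2 := Real.one_sub_sq_div_two_le_cos (x := z)
  rcases min_cases (1 : ℝ) (z ^ 2) with h | h <;> rw [h.1] <;> nlinarith [sq_nonneg z]

theorem min_one_mul_le (t x : ℝ) : min 1 ((t * x) ^ 2) ≤ (1 + t ^ 2) * min 1 (x ^ 2) := by
  rcases min_cases (1 : ℝ) (x ^ 2) with h | h <;> rw [h.1]
  · exact (min_le_left _ _).trans (by nlinarith [sq_nonneg t])
  · exact (min_le_right _ _).trans (by nlinarith [sq_nonneg t, sq_nonneg x])

/-- Near 0 the integrand is x^(1-2H), integrable because H < 1; near infinity it is x^(-1-2H),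
integrable because H > 0. Multiples of this function dominate the spectral integrals below. -/
theorem integrableOn_min_mul_rpow {H : ℝ} (h0 : 0 < H) (h1 : H < 1) :
    IntegrableOn (fun x : ℝ => min 1 (x ^ 2) * x ^ (-1 - 2 * H)) (Set.Ioi 0) := by
  rw [← Set.Ioo_union_Ici_eq_Ioi zero_lt_one]
  have hm : Measurable (fun x : ℝ => min 1 (x ^ 2) * x ^ (-1 - 2 * H)) := by fun_prop
  refine IntegrableOn.union ?_ ?_
  · have := (intervalIntegral.integrableOn_Ioo_rpow_iff (s := 1 - 2 * H) zero_lt_one).2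
      (by linarith)
    refine Integrable.mono' this hm.aestronglyMeasurable ?_
    refine (ae_restrict_iff' measurableSet_Ioo).2 (ae_of_all _ fun x hx => ?_)
    rw [Real.norm_of_nonneg (mul_nonneg (le_min zero_le_one (sq_nonneg _))
      (Real.rpow_nonneg hx.1.le _))]
    have : x ^ (1 - 2 * H) = x ^ 2 * x ^ (-1 - 2 * H) := by
      rw [← Real.rpow_natCast, ← Real.rpow_add hx.1]; congr 1; push_cast; ring
    rw [this]
    exact mul_le_mul_of_nonneg_right (min_le_right _ _) (Real.rpow_nonneg hx.1.le _)
  · rw [integrableOn_Ici_iff_integrableOn_Ioi]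
    have := integrableOn_Ioi_rpow_of_lt (a := -1 - 2 * H) (by linarith) (zero_lt_one)
    refine Integrable.mono' this hm.aestronglyMeasurable ?_
    refine (ae_restrict_iff' measurableSet_Ioi).2 (ae_of_all _ fun x hx => ?_)
    have hx0 : (0 : ℝ) < x := zero_lt_one.trans hx
    rw [Real.norm_of_nonneg (mul_nonneg (le_min zero_le_one (sq_nonneg _))
      (Real.rpow_nonneg hx0.le _))]
    exact mul_le_of_le_one_left (Real.rpow_nonneg hx0.le _) (min_le_left _ _)

/-- Integrability with respect to the spectral measure of fractional Brownian motion. -/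
theorem integrableOn_mul_rpow_of_le {H : ℝ} (h0 : 0 < H) (h1 : H < 1) {f : ℝ → ℝ}
    (hf : Measurable f) {K : ℝ} (hK : ∀ x, 0 < x → |f x| ≤ K * min 1 (x ^ 2)) :
    IntegrableOn (fun x : ℝ => f x * x ^ (-1 - 2 * H)) (Set.Ioi 0) := by
  refine Integrable.mono' ((integrableOn_min_mul_rpow h0 h1).const_mul K)
    (by fun_prop) ?_
  refine (ae_restrict_iff' measurableSet_Ioi).2 (ae_of_all _ fun x hx => ?_)
  rw [norm_mul, Real.norm_eq_abs, Real.norm_of_nonneg (Real.rpow_nonneg (le_of_lt hx) _),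
    ← mul_assoc]
  exact mul_le_mul_of_nonneg_right (hK x hx) (Real.rpow_nonneg (le_of_lt hx) _)

theorem abs_one_sub_cos_le (t x : ℝ) :
    |1 - Real.cos (t * x)| ≤ 2 * (1 + t ^ 2) * min 1 (x ^ 2) := by
  rw [abs_of_nonneg (by linarith [Real.cos_le_one (t * x)]), mul_assoc]
  exact (one_sub_cos_le_two_mul_min _).trans
    (mul_le_mul_of_nonneg_left (min_one_mul_le t x) zero_le_two)

theorem integrableOn_one_sub_cos_mul_rpow {H : ℝ} (h0 : 0 < H) (h1 : H < 1) (t : ℝ) :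
    IntegrableOn (fun x : ℝ => (1 - Real.cos (t * x)) * x ^ (-1 - 2 * H)) (Set.Ioi 0) :=
  integrableOn_mul_rpow_of_le h0 h1 (by fun_prop) fun x _ => abs_one_sub_cos_le t x

/-- Tonelli's theorem for real-valued functions on the positive quadrant. -/
theorem integral_Ioi_swap {f : ℝ → ℝ → ℝ} (hf : Measurable (Function.uncurry f))
    (h0 : ∀ x > 0, ∀ u > 0, 0 ≤ f x u) (h1 : ∀ x > 0, IntegrableOn (f x) (Set.Ioi 0))
    (h2 : IntegrableOn (fun x => ∫ u in Set.Ioi 0, f x u) (Set.Ioi 0)) :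
    ∫ x in Set.Ioi 0, ∫ u in Set.Ioi 0, f x u = ∫ u in Set.Ioi 0, ∫ x in Set.Ioi 0, f x u := by
  refine integral_integral_swap ?_
  rw [integrable_prod_iff hf.aestronglyMeasurable]
  refine ⟨(ae_restrict_iff' measurableSet_Ioi).2 (ae_of_all _ h1), ?_⟩
  refine (integrable_congr ?_).1 h2
  refine (ae_restrict_iff' measurableSet_Ioi).2 (ae_of_all _ fun x hx => ?_)
  refine setIntegral_congr_fun measurableSet_Ioi fun u hu => ?_
  exact (Real.norm_of_nonneg (h0 x hx u hu)).symm

/-- Writing 1/(1+u²) as the integral of exp(-w(1+u²)) over w and integrating in u first gives Γ(H)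
Γ(1-H) / 2; Euler's reflection formula finishes. -/
theorem integral_rpow_div_one_add_sq {H : ℝ} (h0 : 0 < H) (h1 : H < 1) :
    ∫ u in Set.Ioi (0 : ℝ), u ^ (2 * H - 1) / (1 + u ^ 2) =
      Real.pi / (2 * Real.sin (Real.pi * H)) := by
  set f : ℝ → ℝ → ℝ := fun w u => u ^ (2 * H - 1) * Real.exp (-(w * (1 + u ^ 2))) with hf
  have hval : ∀ w > 0, ∫ u in Set.Ioi 0, f w u =
      w ^ (-H) * Real.exp (-w) * (1 / 2 * Real.Gamma H) := by
    intro w hw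
    have := integral_rpow_mul_exp_neg_mul_rpow (p := 2) (q := 2 * H - 1) (b := w) two_pos
      (by linarith) hw
    have e : ∀ u : ℝ, f w u = (u ^ (2 * H - 1) * Real.exp (-w * u ^ (2 : ℝ))) * Real.exp (-w) := by
      intro u
      simp only [hf]
      rw [mul_assoc, ← Real.exp_add, Real.rpow_two]
      ring_nf
    simp_rw [e]
    rw [integral_mul_const, this]
    have e1 : -(2 * H - 1 + 1) / 2 = -H := by ring
    have e2 : (2 * H - 1 + 1) / 2 = H := by ring
    rw [e1, e2]; ring
  have hswap := integral_Ioi_swap (f := f) (by fun_prop)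
    (fun w hw u hu => mul_nonneg (Real.rpow_nonneg (le_of_lt hu) _) (Real.exp_pos _).le) ?_ ?_
  · have hR : ∀ u ∈ Set.Ioi (0 : ℝ), ∫ w in Set.Ioi 0, f w u = u ^ (2 * H - 1) / (1 + u ^ 2) := by
      intro u hu
      have hu2 : 0 < 1 + u ^ 2 := by positivity
      simp only [hf]
      rw [integral_const_mul]
      have := Real.integral_rpow_mul_exp_neg_mul_Ioi (a := 1) one_pos hu2
      simp only [sub_self, Real.rpow_zero, one_mul, Real.rpow_one, Real.Gamma_one, mul_one] at this
      have e : ∀ w : ℝ, w * (1 + u ^ 2) = (1 + u ^ 2) * w := fun w => mul_comm _ _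
      simp_rw [e, this]
      ring
    rw [setIntegral_congr_fun measurableSet_Ioi hR] at hswap
    rw [← hswap, setIntegral_congr_fun measurableSet_Ioi hval, integral_mul_const]
    have := Real.integral_rpow_mul_exp_neg_mul_Ioi (a := 1 - H) (r := 1) (by linarith) one_pos
    have e : 1 - H - 1 = -H := by ring
    simp only [e, one_mul, div_one, Real.one_rpow] at this
    rw [this]
    have hG := Real.Gamma_mul_Gamma_one_sub H
    calc Real.Gamma (1 - H) * (1 / 2 * Real.Gamma H)
        = (Real.Gamma H * Real.Gamma (1 - H)) / 2 := by ring
      _ = _ := by rw [hG, div_div, mul_comm 2]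
  · intro w hw
    -- A non-integrable function has Bochner integral 0, so the positive closed form of the integral
    -- forces integrability.
    by_contra hcon
    have h3 := hval w hw
    rw [integral_undef hcon] at h3
    have : 0 < w ^ (-H) * Real.exp (-w) * (1 / 2 * Real.Gamma H) :=
      mul_pos (mul_pos (Real.rpow_pos_of_pos hw _) (Real.exp_pos _))
        (mul_pos (by norm_num) (Real.Gamma_pos_of_pos h0))
    linarith
  · refine IntegrableOn.congr_fun ?_ (fun w hw => (hval w hw).symm) measurableSet_Ioi
    have hG := Real.GammaIntegral_convergent (s := 1 - H) (by linarith)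
    refine (hG.mul_const (1 / 2 * Real.Gamma H)).congr (ae_of_all _ fun w => ?_)
    simp only
    rw [show 1 - H - 1 = -H by ring]; ring

/-- This is the real part of the Laplace transform of 1 - e^{ix}, namely 1/u - u/(1+u²). -/
theorem integral_one_sub_cos_mul_exp {u : ℝ} (hu : 0 < u) :
    IntegrableOn (fun x => (1 - Real.cos x) * Real.exp (-(x * u))) (Set.Ioi 0) ∧
    ∫ x in Set.Ioi (0 : ℝ), (1 - Real.cos x) * Real.exp (-(x * u)) = 1 / (u * (1 + u ^ 2)) := by
  have hre1 : (-(u : ℂ)).re < 0 := by simpa using hu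
  have hre2 : (-(u : ℂ) + Complex.I).re < 0 := by simpa using hu
  have i1 := integrableOn_exp_mul_complex_Ioi hre1 0
  have i2 := integrableOn_exp_mul_complex_Ioi hre2 0
  have v1 := integral_exp_mul_complex_Ioi hre1 0
  have v2 := integral_exp_mul_complex_Ioi hre2 0
  have i3 := i1.sub i2
  have e : ∀ x : ℝ, (1 - Real.cos x) * Real.exp (-(x * u)) =
      RCLike.re (Complex.exp (-(u : ℂ) * x) - Complex.exp ((-(u : ℂ) + Complex.I) * x)) := by
    intro x
    simp [Complex.exp_re]
    ring_nf
  have v3 := integral_sub i1 i2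
  rw [v1, v2] at v3
  refine ⟨?_, ?_⟩
  · simp_rw [e]
    exact i3.re
  · simp_rw [e]
    have := integral_re (𝕜 := ℂ) i3
    simp only [Pi.sub_apply] at this
    rw [this, v3]
    simp [Complex.div_re, Complex.normSq_apply]
    field_simp
    ring

/-- The Mellin transform of `1 - cos`. -/
theorem integral_one_sub_cos_mul_rpow {H : ℝ} (h0 : 0 < H) (h1 : H < 1) :
    ∫ x in Set.Ioi (0 : ℝ), (1 - Real.cos x) * x ^ (-1 - 2 * H) =
      Real.pi / (2 * Real.Gamma (2 * H + 1) * Real.sin (Real.pi * H)) := by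
  have hG : 0 < Real.Gamma (2 * H + 1) := Real.Gamma_pos_of_pos (by linarith)
  -- Integrating u^(2H) e^(-xu) in u gives Γ(2H+1) x^(-1-2H). Exchanging the integrals leaves the
  -- Laplace transform of 1 - cos, and so the integral of u^(2H-1)/(1+u²).
  set f : ℝ → ℝ → ℝ := fun x u => (1 - Real.cos x) * (u ^ (2 * H) * Real.exp (-(x * u))) with hf
  have hval : ∀ x > 0, ∫ u in Set.Ioi 0, f x u =
      (1 - Real.cos x) * x ^ (-1 - 2 * H) * Real.Gamma (2 * H + 1) := by
    intro x hx
    simp only [hf]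
    rw [integral_const_mul]
    have := Real.integral_rpow_mul_exp_neg_mul_Ioi (a := 2 * H + 1) (by linarith) hx
    simp only [add_sub_cancel_right] at this
    rw [this, one_div, Real.inv_rpow hx.le, ← Real.rpow_neg hx.le, mul_assoc]
    congr 3; ring
  have hval2 : ∀ u ∈ Set.Ioi (0 : ℝ), ∫ x in Set.Ioi 0, f x u = u ^ (2 * H - 1) / (1 + u ^ 2) := by
    intro u hu
    have hu0 : (0 : ℝ) < u := hu
    have e : ∀ x : ℝ, f x u = u ^ (2 * H) * ((1 - Real.cos x) * Real.exp (-(x * u))) := by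
      intro x; simp only [hf]; ring
    simp_rw [e]
    rw [integral_const_mul, (integral_one_sub_cos_mul_exp hu).2, Real.rpow_sub_one hu0.ne']
    field_simp
  have hswap := integral_Ioi_swap (f := f) (by fun_prop)
    (fun x hx u hu => mul_nonneg (by linarith [Real.cos_le_one x])
      (mul_nonneg (Real.rpow_nonneg (le_of_lt hu) _) (Real.exp_pos _).le)) ?_ ?_
  · rw [setIntegral_congr_fun measurableSet_Ioi hval, setIntegral_congr_fun measurableSet_Ioi hval2,
      integral_mul_const, integral_rpow_div_one_add_sq h0 h1] at hswap
    rw [← eq_div_iff hG.ne'] at hswap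
    rw [hswap, div_div]; ring
  · intro x hx
    -- At the zeros of 1 - cos the integral vanishes and proves nothing about integrability, but
    -- there the integrand is identically 0.
    by_cases hc : 1 - Real.cos x = 0
    · simp [hf, hc]
    · have hc' : 0 < 1 - Real.cos x := lt_of_le_of_ne (by linarith [Real.cos_le_one x]) (Ne.symm hc)
      by_contra hcon
      have h3 := hval x hx
      rw [integral_undef hcon] at h3
      have : 0 < (1 - Real.cos x) * x ^ (-1 - 2 * H) * Real.Gamma (2 * H + 1) :=
        mul_pos (mul_pos hc' (Real.rpow_pos_of_pos hx _)) hG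
      linarith
  · refine IntegrableOn.congr_fun ?_ (fun w hw => (hval w hw).symm) measurableSet_Ioi
    have := integrableOn_one_sub_cos_mul_rpow h0 h1 1
    simp only [one_mul] at this
    exact this.mul_const _

theorem cH_pos {H : ℝ} (h0 : 0 < H) (h1 : H < 1) : 0 < cH H := by
  have hs : 0 < Real.sin (Real.pi * H) :=
    Real.sin_pos_of_pos_of_lt_pi (by positivity) (by nlinarith [Real.pi_pos])
  have hG : 0 < Real.Gamma (2 * H + 1) := Real.Gamma_pos_of_pos (by linarith)
  have := Real.pi_pos
  unfold cH; positivity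

/-- The spectral representation of the variance of fractional Brownian motion. -/
theorem cH_mul_integral_one_sub_cos {H : ℝ} (h0 : 0 < H) (h1 : H < 1) (t : ℝ) :
    4 * cH H * ∫ x in Set.Ioi (0 : ℝ), (1 - Real.cos (t * x)) * x ^ (-1 - 2 * H) =
      |t| ^ (2 * H) := by
  have hs : 0 < Real.sin (Real.pi * H) :=
    Real.sin_pos_of_pos_of_lt_pi (by positivity) (by nlinarith [Real.pi_pos])
  have hG : 0 < Real.Gamma (2 * H + 1) := Real.Gamma_pos_of_pos (by linarith)
  have hpi := Real.pi_pos
  rcases eq_or_ne t 0 with rfl | ht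
  · simp [h0.ne']
  have ht' : 0 < |t| := abs_pos.2 ht
  have e : ∀ x ∈ Set.Ioi (0 : ℝ), (1 - Real.cos (t * x)) * x ^ (-1 - 2 * H) =
      |t| ^ (1 + 2 * H) * ((1 - Real.cos (|t| * x)) * (|t| * x) ^ (-1 - 2 * H)) := by
    intro x hx
    have hx0 : (0 : ℝ) < x := hx
    have h1 : Real.cos (|t| * x) = Real.cos (t * x) := by
      rw [← Real.cos_abs (t * x), abs_mul, abs_of_pos hx0]
    rw [h1, Real.mul_rpow ht'.le hx0.le]
    have h2 : |t| ^ (1 + 2 * H) * |t| ^ (-1 - 2 * H) = 1 := by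
      rw [← Real.rpow_add ht']; ring_nf; simp
    calc _ = (1 - Real.cos (t * x)) * x ^ (-1 - 2 * H) * 1 := by ring
      _ = (1 - Real.cos (t * x)) * x ^ (-1 - 2 * H) *
          (|t| ^ (1 + 2 * H) * |t| ^ (-1 - 2 * H)) := by rw [h2]
      _ = _ := by ring
  rw [setIntegral_congr_fun measurableSet_Ioi e, integral_const_mul,
    integral_comp_mul_left_Ioi (fun x => (1 - Real.cos x) * x ^ (-1 - 2 * H)) 0 ht', mul_zero,
    integral_one_sub_cos_mul_rpow h0 h1, Real.rpow_add ht', Real.rpow_one]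
  unfold cH
  simp only [smul_eq_mul]
  generalize Real.sin (Real.pi * H) = s at hs ⊢
  field_simp
  norm_num

end


/-! ### Gaussian laws of linear combinations of increments -/

section

/-- The variance attached to a spectral function `F` by the spectral measure of fractional Brownian
motion. -/
def specVar (H : ℝ) (F : ℝ → ℂ) : ℝ :=
  2 * cH H * ∫ x in Set.Ioi (0 : ℝ), ‖F x‖ ^ 2 * x ^ (-1 - 2 * H)

theorem norm_sum_mul_exp_sq {κ : Type*} [Fintype κ] (w s : κ → ℝ) (x : ℝ) :
    ‖∑ k, (w k : ℂ) * Complex.exp (s k * x * Complex.I)‖ ^ 2 =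
      ∑ k, ∑ l, w k * w l * Real.cos ((s k - s l) * x) := by
  have hre : (∑ k, (w k : ℂ) * Complex.exp (s k * x * Complex.I)).re =
      ∑ k, w k * Real.cos (s k * x) := by
    rw [Complex.re_sum]
    refine Finset.sum_congr rfl fun k _ => ?_
    rw [Complex.re_ofReal_mul, ← Complex.ofReal_mul, Complex.exp_ofReal_mul_I_re]
  have him : (∑ k, (w k : ℂ) * Complex.exp (s k * x * Complex.I)).im =
      ∑ k, w k * Real.sin (s k * x) := by
    rw [Complex.im_sum]
    refine Finset.sum_congr rfl fun k _ => ?_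
    rw [Complex.im_ofReal_mul, ← Complex.ofReal_mul, Complex.exp_ofReal_mul_I_im]
  rw [← Complex.normSq_eq_norm_sq, Complex.normSq_apply, hre, him, Finset.sum_mul_sum,
    Finset.sum_mul_sum, ← Finset.sum_add_distrib]
  refine Finset.sum_congr rfl fun k _ => ?_
  rw [← Finset.sum_add_distrib]
  refine Finset.sum_congr rfl fun l _ => ?_
  rw [sub_mul, Real.cos_sub]
  ring

/-- A sum of increments is a trigonometric sum over two copies of `κ`, with weights `w` and `-w`. -/
theorem norm_sum_mul_exp_sub_exp_sq {κ : Type*} [Fintype κ] (w u v : κ → ℝ) (x : ℝ) :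
    ‖∑ k, (w k : ℂ) * (Complex.exp (v k * x * Complex.I) - Complex.exp (u k * x * Complex.I))‖ ^ 2 =
      ∑ k, ∑ l, w k * w l * (Real.cos ((v k - v l) * x) - Real.cos ((v k - u l) * x) -
        Real.cos ((u k - v l) * x) + Real.cos ((u k - u l) * x)) := by
  have h := norm_sum_mul_exp_sq (κ := κ ⊕ κ) (Sum.elim w (-w)) (Sum.elim v u) x
  simp only [Fintype.sum_sum_type, Sum.elim_inl, Sum.elim_inr, Pi.neg_apply, Complex.ofReal_neg,
    neg_mul, mul_neg, Finset.sum_neg_distrib] at h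
  have e : (∑ k, (w k : ℂ) * (Complex.exp (v k * x * Complex.I) - Complex.exp (u k * x * Complex.I)))
      = ∑ k, (w k : ℂ) * Complex.exp (v k * x * Complex.I) +
        -∑ k, (w k : ℂ) * Complex.exp (u k * x * Complex.I) := by
    simp only [mul_sub, Finset.sum_sub_distrib]
    rw [sub_eq_add_neg]
  rw [e, h]
  simp only [← Finset.sum_neg_distrib, ← Finset.sum_add_distrib]
  refine Finset.sum_congr rfl fun k _ => Finset.sum_congr rfl fun l _ => ?_
  ring

variable {Ω : Type*} [MeasurableSpace Ω] {μ : Measure Ω}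

/-- The one-point terms of the covariance cancel, so only distances between endpoints remain; these
have a spectral representation. -/
theorem IsFractionalBrownianMotion.covariance_increments {H : ℝ} {B : ℝ → Ω → ℝ}
    [IsProbabilityMeasure μ] (hB : IsFractionalBrownianMotion H B μ) (u v u' v' : ℝ) :
    cov[fun ω => B v ω - B u ω, fun ω => B v' ω - B u' ω; μ] =
      (|v - u'| ^ (2 * H) + |u - v'| ^ (2 * H) - |v - v'| ^ (2 * H) - |u - u'| ^ (2 * H)) / 2 := by
  have hm : ∀ t, MemLp (B t) 2 μ := fun t => (hB.isGaussianProcess.hasGaussianLaw_eval t).memLp_two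
  rw [covariance_fun_sub_fun_sub (hm _) (hm _) (hm _) (hm _)]
  simp only [hB.covariance_eq]
  rw [abs_sub_comm v' v, abs_sub_comm u' v, abs_sub_comm v' u, abs_sub_comm u' u]
  ring

theorem integral_cexp_of_hasGaussianLaw {Z : Ω → ℝ} (hZ : HasGaussianLaw Z μ)
    (h0 : ∫ ω, Z ω ∂μ = 0) :
    ∫ ω, Complex.exp (Z ω * Complex.I) ∂μ = Complex.exp (-(Var[Z; μ] / 2 : ℝ)) := by
  have h := hZ.charFun_map_eq 1
  rw [charFun_apply_real, integral_map hZ.aemeasurable (by fun_prop)] at h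
  simp only [Complex.ofReal_one, one_mul] at h
  rw [h]
  simp [h0]

/-- Linear combinations of increments of fractional Brownian motion. -/
theorem IsFractionalBrownianMotion.integral_cexp_increments {H : ℝ} (h0 : 0 < H) (h1 : H < 1)
    {B : ℝ → Ω → ℝ} [IsProbabilityMeasure μ] (hB : IsFractionalBrownianMotion H B μ)
    {κ : Type*} [Fintype κ] (w u v : κ → ℝ) :
    ∫ ω, Complex.exp ((∑ k, w k * (B (v k) ω - B (u k) ω) : ℝ) * Complex.I) ∂μ =
      Complex.exp (-(specVar H (fun x => ∑ k, (w k : ℂ) * (Complex.exp (v k * x * Complex.I) -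
        Complex.exp (u k * x * Complex.I))) / 2 : ℝ)) := by
  classical
  have hm : ∀ t, MemLp (B t) 2 μ := fun t => (hB.isGaussianProcess.hasGaussianLaw_eval t).memLp_two
  have hi : ∀ t, Integrable (B t) μ :=
    fun t => (hB.isGaussianProcess.hasGaussianLaw_eval t).integrable
  have hG : HasGaussianLaw (fun ω => ∑ k, w k * (B (v k) ω - B (u k) ω)) μ := by
    set I : Finset ℝ := Finset.univ.image v ∪ Finset.univ.image u
    have hv : ∀ k, v k ∈ I := fun k => Finset.mem_union_left _ (Finset.mem_image_of_mem _ (Finset.mem_univ k))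
    have hu : ∀ k, u k ∈ I := fun k => Finset.mem_union_right _ (Finset.mem_image_of_mem _ (Finset.mem_univ k))
    have := (hB.isGaussianProcess.hasGaussianLaw I).map_fun
      (∑ k, w k • (ContinuousLinearMap.proj (R := ℝ) (φ := fun _ : I => ℝ) ⟨v k, hv k⟩ -
        ContinuousLinearMap.proj (R := ℝ) (φ := fun _ : I => ℝ) ⟨u k, hu k⟩))
    simpa [sum_apply] using this
  have hmd : ∀ k, MemLp (fun ω => w k * (B (v k) ω - B (u k) ω)) 2 μ :=
    fun k => ((hm _).sub (hm _)).const_mul _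
  have hid : ∀ k, Integrable (fun ω => w k * (B (v k) ω - B (u k) ω)) μ :=
    fun k => ((hi _).sub (hi _)).const_mul _
  have hmean : ∫ ω, ∑ k, w k * (B (v k) ω - B (u k) ω) ∂μ = 0 := by
    rw [integral_finsetSum _ fun k _ => hid k]
    refine Finset.sum_eq_zero fun k _ => ?_
    rw [integral_const_mul, integral_sub (hi _) (hi _), hB.centered, hB.centered]
    simp
  rw [integral_cexp_of_hasGaussianLaw hG hmean]
  congr 5
  rw [← covariance_self hG.aemeasurable, covariance_fun_sum_fun_sum
    hmd hmd]
  unfold specVar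
  simp_rw [norm_sum_mul_exp_sub_exp_sq, Finset.sum_mul]
  have hint : ∀ t : ℝ, IntegrableOn (fun x : ℝ => (1 - Real.cos (t * x)) * x ^ (-1 - 2 * H))
    (Set.Ioi 0) := integrableOn_one_sub_cos_mul_rpow h0 h1
  -- The four cosines have coefficients 1, -1, -1, 1 with sum 0, so each may be replaced by -(1 -
  -- cos). This matters because a single cosine is not integrable against x^(-1-2H) near 0.
  have key : ∀ k l, IntegrableOn (fun x : ℝ => w k * w l * (Real.cos ((v k - v l) * x) -
      Real.cos ((v k - u l) * x) - Real.cos ((u k - v l) * x) + Real.cos ((u k - u l) * x)) *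
        x ^ (-1 - 2 * H)) (Set.Ioi 0) ∧
      2 * cH H * ∫ x in Set.Ioi (0 : ℝ), w k * w l * (Real.cos ((v k - v l) * x) -
      Real.cos ((v k - u l) * x) - Real.cos ((u k - v l) * x) + Real.cos ((u k - u l) * x)) *
        x ^ (-1 - 2 * H) = w k * w l *
        ((|v k - u l| ^ (2 * H) + |u k - v l| ^ (2 * H) - |v k - v l| ^ (2 * H) -
          |u k - u l| ^ (2 * H)) / 2) := by
    intro k l
    have e : (fun x : ℝ => w k * w l * (Real.cos ((v k - v l) * x) -
      Real.cos ((v k - u l) * x) - Real.cos ((u k - v l) * x) + Real.cos ((u k - u l) * x)) *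
        x ^ (-1 - 2 * H)) = fun x => w k * w l * (
          (1 - Real.cos ((v k - u l) * x)) * x ^ (-1 - 2 * H) +
          (1 - Real.cos ((u k - v l) * x)) * x ^ (-1 - 2 * H) -
          (1 - Real.cos ((v k - v l) * x)) * x ^ (-1 - 2 * H) -
          (1 - Real.cos ((u k - u l) * x)) * x ^ (-1 - 2 * H)) := by
      ext x; ring
    rw [e]
    refine ⟨((((hint _).add (hint _)).sub (hint _)).sub (hint _)).const_mul _, ?_⟩
    have i2 : IntegrableOn (fun x : ℝ => (1 - Real.cos ((v k - u l) * x)) * x ^ (-1 - 2 * H) +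
      (1 - Real.cos ((u k - v l) * x)) * x ^ (-1 - 2 * H)) (Set.Ioi 0) := (hint _).add (hint _)
    have i3 : IntegrableOn (fun x : ℝ => (1 - Real.cos ((v k - u l) * x)) * x ^ (-1 - 2 * H) +
      (1 - Real.cos ((u k - v l) * x)) * x ^ (-1 - 2 * H) -
      (1 - Real.cos ((v k - v l) * x)) * x ^ (-1 - 2 * H)) (Set.Ioi 0) := i2.sub (hint _)
    rw [integral_const_mul, integral_sub i3 (hint _), integral_sub i2 (hint _),
      integral_add (hint _) (hint _)]
    rw [← cH_mul_integral_one_sub_cos h0 h1 (v k - u l),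
      ← cH_mul_integral_one_sub_cos h0 h1 (u k - v l),
      ← cH_mul_integral_one_sub_cos h0 h1 (v k - v l),
      ← cH_mul_integral_one_sub_cos h0 h1 (u k - u l)]
    ring
  rw [integral_finsetSum _ fun k _ => integrable_finsetSum _ fun l _ => (key k l).1, Finset.mul_sum]
  refine Finset.sum_congr rfl fun k _ => ?_
  rw [integral_finsetSum _ fun l _ => (key k l).1, Finset.mul_sum]
  refine Finset.sum_congr rfl fun l _ => ?_
  rw [(key k l).2, covariance_const_mul_left, covariance_const_mul_right,
    hB.covariance_increments]
  ring

/-- Almost sure limits of centered Gaussian variables with converging variances. -/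
theorem integral_cexp_of_tendsto [IsProbabilityMeasure μ] {Z : ℕ → Ω → ℝ} {Z' : Ω → ℝ}
    {v : ℕ → ℝ} {v' : ℝ} (hm : ∀ n, AEMeasurable (Z n) μ)
    (hZ : ∀ᵐ ω ∂μ, Tendsto (fun n => Z n ω) atTop (𝓝 (Z' ω)))
    (hv : Tendsto v atTop (𝓝 v'))
    (h : ∀ᶠ n in atTop,
      ∫ ω, Complex.exp (Z n ω * Complex.I) ∂μ = Complex.exp (-(v n / 2 : ℝ))) :
    ∫ ω, Complex.exp (Z' ω * Complex.I) ∂μ = Complex.exp (-(v' / 2 : ℝ)) := by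
  have h1 : Tendsto (fun n => ∫ ω, Complex.exp (Z n ω * Complex.I) ∂μ) atTop
      (𝓝 (∫ ω, Complex.exp (Z' ω * Complex.I) ∂μ)) := by
    refine tendsto_integral_of_dominated_convergence (fun _ => 1) (fun n => ?_)
      (integrable_const _) (fun n => ae_of_all _ fun ω => ?_) ?_
    · exact (Complex.measurable_exp.comp_aemeasurable
        ((Complex.measurable_ofReal.comp_aemeasurable (hm n)).mul_const _)).aestronglyMeasurable
    · rw [Complex.norm_exp_ofReal_mul_I]
    · filter_upwards [hZ] with ω hω
      have : Continuous fun z : ℝ => Complex.exp (z * Complex.I) := by fun_prop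
      exact (this.tendsto _).comp hω
  have h2 : Tendsto (fun n => Complex.exp (-(v n / 2 : ℝ))) atTop
      (𝓝 (Complex.exp (-(v' / 2 : ℝ)))) := by
    have : Continuous fun z : ℝ => Complex.exp (-(z / 2 : ℝ)) := by fun_prop
    exact (this.tendsto _).comp hv
  exact tendsto_nhds_unique h1 (h2.congr' (h.mono fun n hn => hn.symm))

theorem tendsto_specVar {H : ℝ} (h0 : 0 < H) (h1 : H < 1) {F : ℕ → ℝ → ℂ} {F' : ℝ → ℂ}
    (hF : ∀ n, Measurable (F n)) {K : ℝ}
    (hK : ∀ᶠ n in atTop, ∀ x, 0 < x → ‖F n x‖ ^ 2 ≤ K * min 1 (x ^ 2))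
    (h : ∀ x, 0 < x → Tendsto (fun n => F n x) atTop (𝓝 (F' x))) :
    Tendsto (fun n => specVar H (F n)) atTop (𝓝 (specVar H F')) := by
  refine Tendsto.const_mul _ ?_
  refine tendsto_integral_filter_of_dominated_convergence
    (fun x => K * (min 1 (x ^ 2) * x ^ (-1 - 2 * H))) (Eventually.of_forall fun n => ?_) ?_
    ((integrableOn_min_mul_rpow h0 h1).const_mul K) ?_
  · have := hF n
    exact (Measurable.aestronglyMeasurable (by fun_prop))
  · filter_upwards [hK] with n hn
    refine (ae_restrict_iff' measurableSet_Ioi).2 (ae_of_all _ fun x hx => ?_)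
    rw [norm_mul, Real.norm_of_nonneg (sq_nonneg _),
      Real.norm_of_nonneg (Real.rpow_nonneg (le_of_lt hx) _), ← mul_assoc]
    exact mul_le_mul_of_nonneg_right (hn x hx) (Real.rpow_nonneg (le_of_lt hx) _)
  · refine (ae_restrict_iff' measurableSet_Ioi).2 (ae_of_all _ fun x hx => ?_)
    exact ((h x hx).norm.pow 2).mul_const _

end


/-! ### Spectral functions of Riemann-Stieltjes sums -/

section

/-- Riemann-Stieltjes sums over the uniform partitions of `[t - T, t]`. -/
def uniformSum (f g : ℝ → ℝ) (t T : ℝ) (n : ℕ) : ℝ :=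
  ∑ i ∈ Finset.range n, f (t - T + i * (T / n)) *
    (g (t - T + (i + 1) * (T / n)) - g (t - T + i * (T / n)))

theorem HasRSIntegral.tendsto_uniformSum {f g : ℝ → ℝ} {t T J : ℝ} (hT : 0 ≤ T)
    (h : HasRSIntegral f g (t - T) t J) :
    Tendsto (uniformSum f g t T) atTop (𝓝 J) := by
  rw [Metric.tendsto_atTop]
  intro ε hε
  obtain ⟨δ, hδ, hd⟩ := h ε hε
  obtain ⟨n₀, hn₀⟩ := exists_nat_gt (T / δ)
  -- The `+ 1` excludes n = 0, where the step `T / n` has the default value 0.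
  refine ⟨n₀ + 1, fun n hn => ?_⟩
  have hn0 : (0 : ℝ) < n := by exact_mod_cast (by omega : 0 < n)
  have hstep : T / n < δ := by
    rw [div_lt_iff₀ hn0]
    rw [div_lt_iff₀ hδ] at hn₀
    have : (n₀ : ℝ) ≤ n := by exact_mod_cast (by omega : n₀ ≤ n)
    nlinarith
  have hstep0 : 0 ≤ T / n := div_nonneg hT hn0.le
  have := hd n (fun i => t - T + i * (T / n)) (fun i => t - T + i * (T / n)) (by simp)
    (by field_simp; ring) (fun i _ => ⟨le_rfl, by push_cast; linarith, by push_cast; linarith⟩)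
  simpa [uniformSum, Real.dist_eq] using this

variable {lam δ : ℝ}

theorem norm_exp_sub_one_sq (r y : ℝ) :
    ‖Complex.exp (r + y * Complex.I) - 1‖ ^ 2 =
      Real.exp r ^ 2 - 2 * Real.exp r * Real.cos y + 1 := by
  rw [← Complex.normSq_eq_norm_sq, Complex.normSq_apply]
  simp only [Complex.sub_re, Complex.sub_im, Complex.one_re, Complex.one_im, Complex.exp_re,
    Complex.exp_im, Complex.add_re, Complex.add_im, Complex.ofReal_re, Complex.ofReal_im,
    Complex.re_ofReal_mul, Complex.im_ofReal_mul, Complex.I_re, Complex.I_im]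
  simp only [mul_zero, add_zero, mul_one, zero_add]
  nlinarith [Real.sin_sq_add_cos_sq y]

/-- The difference of the squares is (e^r - 1)(e^r + 1 - 2 cos y), a product of nonnegative factors.
-/
theorem norm_exp_sub_one_le_of_nonneg {r : ℝ} (hr : 0 ≤ r) (y : ℝ) :
    ‖Complex.exp (y * Complex.I) - 1‖ ≤ ‖Complex.exp (r + y * Complex.I) - 1‖ := by
  refine (pow_le_pow_iff_left₀ (norm_nonneg _) (norm_nonneg _) two_ne_zero).1 ?_
  have h0 := norm_exp_sub_one_sq 0 y
  simp only [Complex.ofReal_zero, zero_add, Real.exp_zero] at h0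
  rw [h0, norm_exp_sub_one_sq]
  have h1 : 1 ≤ Real.exp r := Real.one_le_exp hr
  have h2 := Real.cos_le_one y
  nlinarith

theorem le_norm_exp_sub_one (r y : ℝ) : r ≤ ‖Complex.exp (r + y * Complex.I) - 1‖ := by
  have h := norm_sub_norm_le (Complex.exp (r + y * Complex.I)) 1
  rw [Complex.norm_exp] at h
  simp at h
  linarith [Real.add_one_le_exp r]

/-- The symbol of a Riemann-Stieltjes sum of `u ↦ exp (lam * u)` over a partition of mesh `δ`. -/
def rsRatio (lam δ x : ℝ) : ℂ :=
  (Complex.exp ((x * δ : ℝ) * Complex.I) - 1) /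
    (Complex.exp ((lam * δ : ℝ) + (x * δ : ℝ) * Complex.I) - 1)

theorem norm_rsRatio_le_one (h : 0 < lam * δ) (x : ℝ) : ‖rsRatio lam δ x‖ ≤ 1 := by
  rw [rsRatio, norm_div]
  exact div_le_one_of_le₀ (norm_exp_sub_one_le_of_nonneg h.le _) (norm_nonneg _)

theorem norm_rsRatio_le (hlam : 0 < lam) (hδ : 0 < δ) (x : ℝ) : ‖rsRatio lam δ x‖ ≤ |x| / lam := by
  have h := mul_pos hlam hδ
  rw [rsRatio, norm_div, div_le_div_iff₀ (h.trans_le (le_norm_exp_sub_one _ _)) hlam]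
  have h1 : ‖Complex.exp ((x * δ : ℝ) * Complex.I) - 1‖ ≤ |x| * δ := by
    have := Real.norm_exp_I_mul_ofReal_sub_one_le (x := x * δ)
    rw [mul_comm] at this
    rwa [Real.norm_eq_abs, abs_mul, abs_of_pos hδ] at this
  calc _ ≤ |x| * δ * lam := mul_le_mul_of_nonneg_right h1 hlam.le
    _ = |x| * (lam * δ) := by ring
    _ ≤ _ := mul_le_mul_of_nonneg_left (le_norm_exp_sub_one _ _) (abs_nonneg _)

/-- The bound does not depend on the mesh, so it serves for dominated convergence along refining
partitions. -/
theorem norm_rsRatio_sq_le (hlam : 0 < lam) (hδ : 0 < δ) (x : ℝ) :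
    ‖rsRatio lam δ x‖ ^ 2 ≤ (1 + (1 / lam) ^ 2) * min 1 (x ^ 2) := by
  refine le_trans ?_ (min_one_mul_le (1 / lam) x)
  refine le_min ?_ ?_
  · exact pow_le_one₀ (norm_nonneg _) (norm_rsRatio_le_one (mul_pos hlam hδ) x)
  · have := pow_le_pow_left₀ (norm_nonneg _) (norm_rsRatio_le hlam hδ x) 2
    refine this.trans_eq ?_
    rw [div_pow, sq_abs]; ring

theorem tendsto_exp_sub_one_div (z : ℂ) {d : ℕ → ℝ} (hd : Tendsto d atTop (𝓝 0))
    (hd0 : ∀ᶠ n in atTop, d n ≠ 0) :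
    Tendsto (fun n => (Complex.exp (z * d n) - 1) / d n) atTop (𝓝 z) := by
  have h1 : HasDerivAt (fun w : ℂ => Complex.exp (z * w)) z 0 := by
    have := ((hasDerivAt_id (0 : ℂ)).const_mul z).cexp
    simpa using this
  have h2 := h1.tendsto_slope
  have h3 : Tendsto (fun n => (d n : ℂ)) atTop (𝓝[≠] 0) := by
    refine tendsto_nhdsWithin_iff.2 ⟨?_, ?_⟩
    · simpa [Function.comp_def] using (Complex.continuous_ofReal.tendsto 0).comp hd
    · filter_upwards [hd0] with n hn
      simpa using hn
  refine (h2.comp h3).congr fun n => ?_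
  simp [slope_def_field]

/-- After division by the mesh, numerator and denominator are difference quotients at 0 of exp(ixw)
and exp((λ+ix)w). The limit is the transfer function of the Ornstein-Uhlenbeck filter, up to the
factor of modulus 1 carrying the time. -/
theorem tendsto_rsRatio (hlam : 0 < lam) {d : ℕ → ℝ} (hd : Tendsto d atTop (𝓝 0))
    (hd0 : ∀ᶠ n in atTop, d n ≠ 0) (x : ℝ) :
    Tendsto (fun n => rsRatio lam (d n) x) atTop
      (𝓝 (x * Complex.I / (lam + x * Complex.I))) := by
  have hne : (lam + x * Complex.I : ℂ) ≠ 0 := by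
    intro h
    have := congrArg Complex.re h
    simp at this
    linarith
  have h := (tendsto_exp_sub_one_div (x * Complex.I) hd hd0).div
    (tendsto_exp_sub_one_div (lam + x * Complex.I) hd hd0) hne
  refine h.congr' ?_
  filter_upwards [hd0] with n hn
  have hn' : (d n : ℂ) ≠ 0 := by exact_mod_cast hn
  simp only [Pi.div_apply]
  rw [div_div_div_cancel_right₀ hn', rsRatio]
  push_cast
  rw [show (x * Complex.I * d n : ℂ) = x * d n * Complex.I by ring,
    show ((lam + x * Complex.I) * d n : ℂ) = lam * d n + x * d n * Complex.I by ring]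

/-- The summands form a geometric progression with ratio `q`, the exponential of (λ+ix)δ. -/
theorem sum_exp_eq_rsRatio (hlam : 0 < lam) {T : ℝ} (hT : 0 < T) (t x : ℝ) {n : ℕ} (hn : 0 < n) :
    ∑ i ∈ Finset.range n, (Real.exp (-lam * (t - (t - T + i * (T / n)))) : ℂ) *
      (Complex.exp ((t - T + (i + 1) * (T / n) : ℝ) * x * Complex.I) -
        Complex.exp ((t - T + i * (T / n) : ℝ) * x * Complex.I)) =
    Complex.exp (t * x * Complex.I) *
      ((1 - Complex.exp (-(lam + x * Complex.I) * T)) * rsRatio lam (T / n) x) := by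
  have hn0 : (0 : ℝ) < n := by exact_mod_cast hn
  have hnC : (n : ℂ) ≠ 0 := by exact_mod_cast hn0.ne'
  set δ := T / n with hδ
  have hδ0 : 0 < δ := div_pos hT hn0
  have hT' : (T : ℂ) = n * δ := by rw [hδ]; push_cast; field_simp
  set q := Complex.exp ((lam * δ : ℝ) + (x * δ : ℝ) * Complex.I) with hq
  have hq1 : q ≠ 1 := by
    intro h
    have := le_norm_exp_sub_one (lam * δ) (x * δ)
    rw [← hq, h] at this
    simp at this
    nlinarith [mul_pos hlam hδ0]
  have hterm : ∀ i ∈ Finset.range n, (Real.exp (-lam * (t - (t - T + i * δ))) : ℂ) *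
      (Complex.exp ((t - T + (i + 1) * δ : ℝ) * x * Complex.I) -
        Complex.exp ((t - T + i * δ : ℝ) * x * Complex.I)) =
      Complex.exp (t * x * Complex.I) * Complex.exp (-(lam + x * Complex.I) * T) *
        (Complex.exp ((x * δ : ℝ) * Complex.I) - 1) * q ^ i := by
    intro i _
    rw [hq, ← Complex.exp_nat_mul, Complex.ofReal_exp, mul_sub (Complex.exp _),
      mul_sub (Complex.exp _ * Complex.exp _), sub_mul, mul_one]
    simp only [← Complex.exp_add]
    congr 2 <;> · push_cast; ring
  rw [Finset.sum_congr rfl hterm, ← Finset.mul_sum, geom_sum_eq hq1]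
  -- Since nδ = T, the power `q ^ n` exactly undoes the decay over [t-T, t]. What remains is the
  -- factor 1 - exp(-(λ+ix)T), the whole effect of truncating the integral at t-T.
  have hqn : Complex.exp (-(lam + x * Complex.I) * T) * q ^ n = 1 := by
    rw [hq, ← Complex.exp_nat_mul, ← Complex.exp_add, hT', ← Complex.exp_zero]
    congr 1; push_cast; ring
  rw [rsRatio, ← hq]
  rw [show Complex.exp (t * x * Complex.I) * Complex.exp (-(lam + x * Complex.I) * T) *
        (Complex.exp ((x * δ : ℝ) * Complex.I) - 1) * ((q ^ n - 1) / (q - 1)) =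
      Complex.exp (t * x * Complex.I) * ((Complex.exp (-(lam + x * Complex.I) * T) * q ^ n -
        Complex.exp (-(lam + x * Complex.I) * T)) *
        ((Complex.exp ((x * δ : ℝ) * Complex.I) - 1) / (q - 1))) by ring, hqn]

end


/-! ### Gaussianity and covariance of the fractional Ornstein-Uhlenbeck process -/

section

variable {Ω : Type*} [MeasurableSpace Ω] {μ : Measure Ω} {lam H : ℝ} {B : ℝ → Ω → ℝ}
  {ι : Type*} [Fintype ι]

theorem IsFractionalBrownianMotion.aemeasurable (hB : IsFractionalBrownianMotion H B μ) (t : ℝ) :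
    AEMeasurable (B t) μ := hB.isGaussianProcess.aemeasurable t

theorem IsFractionalBrownianMotion.aemeasurable_uniformSum (hB : IsFractionalBrownianMotion H B μ)
    (f : ℝ → ℝ) (t T : ℝ) (n : ℕ) :
    AEMeasurable (fun ω => uniformSum f (fun u => B u ω) t T n) μ := by
  unfold uniformSum
  exact Finset.aemeasurable_fun_sum _ fun i _ =>
    ((hB.aemeasurable _).sub (hB.aemeasurable _)).const_mul _

/-- The trigonometric polynomial with frequencies `t j` and coefficients `c j`. -/
def trigSum (c t : ι → ℝ) (x : ℝ) : ℂ := ∑ j, (c j : ℂ) * Complex.exp (t j * x * Complex.I)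

theorem measurable_trigSum (c t : ι → ℝ) : Measurable (trigSum c t) := by
  unfold trigSum; fun_prop

theorem norm_trigSum_le (c t : ι → ℝ) (x : ℝ) : ‖trigSum c t x‖ ≤ ∑ j, |c j| := by
  refine (norm_sum_le _ _).trans (Finset.sum_le_sum fun j _ => ?_)
  rw [norm_mul, ← Complex.ofReal_mul, Complex.norm_exp_ofReal_mul_I, mul_one, Complex.norm_real,
    Real.norm_eq_abs]

theorem norm_one_sub_exp_le (hlam : 0 < lam) {T : ℝ} (hT : 0 ≤ T) (x : ℝ) :
    ‖1 - Complex.exp (-(lam + x * Complex.I) * T)‖ ≤ 2 := by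
  refine (norm_sub_le _ _).trans ?_
  rw [Complex.norm_exp, norm_one]
  have : Real.exp ((-(lam + x * Complex.I) * T : ℂ)).re ≤ 1 := by
    rw [Real.exp_le_one_iff]
    simp
    positivity
  linarith

theorem norm_mul_mul_sq_le {a b r : ℂ} {A K m : ℝ} (ha : ‖a‖ ≤ A) (hb : ‖b‖ ≤ 2)
    (hr : ‖r‖ ^ 2 ≤ K * m) : ‖a * (b * r)‖ ^ 2 ≤ A ^ 2 * 4 * K * m := by
  rw [norm_mul, norm_mul, mul_pow, mul_pow]
  have h1 := pow_le_pow_left₀ (norm_nonneg _) ha 2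
  have h2 := pow_le_pow_left₀ (norm_nonneg _) hb 2
  calc _ ≤ A ^ 2 * (2 ^ 2 * (K * m)) := by gcongr
    _ = _ := by ring

/-- The kernel `u ↦ exp (-lam * (t - u))`. -/
def expKernel (lam t u : ℝ) : ℝ := Real.exp (-lam * (t - u))

/-- Indexing the increments by pairs (time, cell) makes the whole expression a single linear
combination of increments. -/
theorem IsFractionalBrownianMotion.integral_cexp_uniformSum [IsProbabilityMeasure μ]
    (hB : IsFractionalBrownianMotion H B μ) (h0 : 0 < H) (h1 : H < 1) (hlam : 0 < lam)
    (c t : ι → ℝ) {T : ℝ} (hT : 0 < T) {n : ℕ} (hn : 0 < n) :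
    ∫ ω, Complex.exp ((∑ j, c j * uniformSum (expKernel lam (t j)) (fun u => B u ω) (t j) T n : ℝ) *
      Complex.I) ∂μ =
    Complex.exp (-(specVar H (fun x => trigSum c t x *
      ((1 - Complex.exp (-(lam + x * Complex.I) * T)) * rsRatio lam (T / n) x)) / 2 : ℝ)) := by
  have h := hB.integral_cexp_increments h0 h1 (κ := ι × Fin n)
    (fun p => c p.1 * expKernel lam (t p.1) (t p.1 - T + p.2 * (T / n)))
    (fun p => t p.1 - T + p.2 * (T / n)) (fun p => t p.1 - T + (p.2 + 1) * (T / n))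
  simp only [Fintype.sum_prod_type] at h
  convert h using 4 with ω x
  · congr 2
    refine Finset.sum_congr rfl fun j _ => ?_
    rw [uniformSum, Finset.mul_sum, ← Fin.sum_univ_eq_sum_range
      (fun i => c j * (expKernel lam (t j) (t j - T + i * (T / n)) *
        (B (t j - T + (i + 1) * (T / n)) ω - B (t j - T + i * (T / n)) ω)))]
    simp only [mul_assoc]
  · congr 3
    ext x
    rw [trigSum, Finset.sum_mul]
    refine Finset.sum_congr rfl fun j _ => ?_
    rw [mul_assoc, ← sum_exp_eq_rsRatio hlam hT (t j) x hn, Finset.mul_sum,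
      ← Fin.sum_univ_eq_sum_range (fun i => (c j : ℂ) *
      ((Real.exp (-lam * (t j - (t j - T + i * (T / n)))) : ℂ) *
      (Complex.exp ((t j - T + (i + 1) * (T / n) : ℝ) * x * Complex.I) -
        Complex.exp ((t j - T + i * (T / n) : ℝ) * x * Complex.I))))]
    refine Finset.sum_congr rfl fun i _ => ?_
    rw [expKernel, Complex.ofReal_mul]
    ring

/-- This is the limit of vanishing mesh at fixed truncation length T; the limit T → ∞ is taken
afterwards, so each limit has its own dominating function. -/
theorem IsFractionalBrownianMotion.integral_cexp_truncated [IsProbabilityMeasure μ]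
    (hB : IsFractionalBrownianMotion H B μ) (h0 : 0 < H) (h1 : H < 1) (hlam : 0 < lam)
    (c t : ι → ℝ) {T : ℝ} (hT : 0 < T) {J : ι → Ω → ℝ}
    (hJ : ∀ᵐ ω ∂μ, ∀ j, Tendsto (uniformSum (expKernel lam (t j)) (fun u => B u ω) (t j) T) atTop
      (𝓝 (J j ω))) :
    ∫ ω, Complex.exp ((∑ j, c j * J j ω : ℝ) * Complex.I) ∂μ =
    Complex.exp (-(specVar H (fun x => trigSum c t x *
      ((1 - Complex.exp (-(lam + x * Complex.I) * T)) *
        (x * Complex.I / (lam + x * Complex.I)))) / 2 : ℝ)) := by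
  have hd : Tendsto (fun n : ℕ => T / n) atTop (𝓝 0) := tendsto_const_div_atTop_nhds_zero_nat T
  have hpos : ∀ᶠ n : ℕ in atTop, 0 < T / n := by
    filter_upwards [eventually_gt_atTop 0] with n hn
    exact div_pos hT (by exact_mod_cast hn)
  refine integral_cexp_of_tendsto
    (Z := fun n ω => ∑ j, c j * uniformSum (expKernel lam (t j)) (fun u => B u ω) (t j) T n)
    (fun n => Finset.aemeasurable_fun_sum _ fun j _ =>
      (hB.aemeasurable_uniformSum _ _ _ _).const_mul _) ?_
    (tendsto_specVar h0 h1 (F := fun n x => trigSum c t x *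
      ((1 - Complex.exp (-(lam + x * Complex.I) * T)) * rsRatio lam (T / n) x))
      (fun n => ?_) (K := (∑ j, |c j|) ^ 2 * 4 * (1 + (1 / lam) ^ 2)) ?_ fun x _ => ?_) ?_
  · filter_upwards [hJ] with ω hω
    exact tendsto_finsetSum _ fun j _ => (hω j).const_mul _
  · have := measurable_trigSum c t
    unfold rsRatio
    fun_prop
  · filter_upwards [hpos] with n hn x _
    exact norm_mul_mul_sq_le (norm_trigSum_le c t x) (norm_one_sub_exp_le hlam hT.le x)
      (norm_rsRatio_sq_le hlam hn x)
  · exact ((tendsto_rsRatio hlam hd (hpos.mono fun n hn => hn.ne') x).const_mul _).const_mul _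
  · filter_upwards [eventually_gt_atTop 0] with n hn
    exact hB.integral_cexp_uniformSum h0 h1 hlam c t hT hn

theorem norm_div_add_mul_I_sq (x : ℝ) :
    ‖(x * Complex.I / (lam + x * Complex.I) : ℂ)‖ ^ 2 = x ^ 2 / (lam ^ 2 + x ^ 2) := by
  rw [norm_div, div_pow, ← Complex.normSq_eq_norm_sq, ← Complex.normSq_eq_norm_sq]
  simp [Complex.normSq_apply, sq]

theorem norm_div_add_mul_I_sq_le (hlam : 0 < lam) (x : ℝ) :
    ‖(x * Complex.I / (lam + x * Complex.I) : ℂ)‖ ^ 2 ≤ (1 + (1 / lam) ^ 2) * min 1 (x ^ 2) := by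
  rw [norm_div_add_mul_I_sq]
  refine le_trans ?_ (min_one_mul_le (1 / lam) x)
  have : 0 < lam ^ 2 := by positivity
  refine le_min (div_le_one_of_le₀ (by linarith) (by positivity)) ?_
  rw [div_le_iff₀ (by positivity)]
  have : (1 / lam * x) ^ 2 * (lam ^ 2 + x ^ 2) = x ^ 2 + (1 / lam * x) ^ 2 * x ^ 2 := by
    field_simp
  rw [this]
  nlinarith [mul_nonneg (sq_nonneg (1 / lam * x)) (sq_nonneg x)]

/-- The squared modulus x²/(λ²+x²) of the transfer function turns x^(-1-2H) into the density
x^(1-2H)/(λ²+x²), which is integrable, so the cosines can now be integrated one by one. -/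
theorem specVar_limit (h0 : 0 < H) (h1 : H < 1) (hlam : 0 < lam) (c t : ι → ℝ) (s : ℝ) :
    specVar H (fun x => trigSum (fun j => s * c j) t x * (x * Complex.I / (lam + x * Complex.I))) =
      ∑ j, ∑ k, c j * c k * (2 * s ^ 2 * cH H * ∫ x in Set.Ioi (0 : ℝ),
        Real.cos ((t j - t k) * x) * (x ^ (1 - 2 * H) / (lam ^ 2 + x ^ 2))) := by
  have hint : ∀ d : ℝ, IntegrableOn (fun x => Real.cos (d * x) *
      (x ^ (1 - 2 * H) / (lam ^ 2 + x ^ 2))) (Set.Ioi 0) := by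
    intro d
    have := integrableOn_mul_rpow_of_le h0 h1 (f := fun x => Real.cos (d * x) *
      (x ^ 2 / (lam ^ 2 + x ^ 2))) (by fun_prop) (K := 1 + (1 / lam) ^ 2) fun x _ => by
        rw [abs_mul, ← norm_div_add_mul_I_sq, abs_of_nonneg (sq_nonneg ‖_‖)]
        exact (mul_le_of_le_one_left (sq_nonneg _) (Real.abs_cos_le_one _)).trans
          (norm_div_add_mul_I_sq_le hlam x)
    refine this.congr_fun (fun x hx => ?_) measurableSet_Ioi
    simp only
    rw [show (1 - 2 * H) = 2 + (-1 - 2 * H) by ring, Real.rpow_add hx, Real.rpow_two]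
    ring
  unfold specVar
  have e : ∀ x ∈ Set.Ioi (0 : ℝ), ‖trigSum (fun j => s * c j) t x *
      (x * Complex.I / (lam + x * Complex.I))‖ ^ 2 * x ^ (-1 - 2 * H) =
      ∑ j, ∑ k, (s * c j) * (s * c k) * (Real.cos ((t j - t k) * x) *
        (x ^ (1 - 2 * H) / (lam ^ 2 + x ^ 2))) := by
    intro x hx
    rw [norm_mul, mul_pow, norm_div_add_mul_I_sq, trigSum, norm_sum_mul_exp_sq, mul_assoc,
      Finset.sum_mul]
    refine Finset.sum_congr rfl fun j _ => ?_
    rw [Finset.sum_mul]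
    refine Finset.sum_congr rfl fun k _ => ?_
    rw [show (1 - 2 * H) = 2 + (-1 - 2 * H) by ring, Real.rpow_add hx, Real.rpow_two]
    ring
  rw [setIntegral_congr_fun measurableSet_Ioi e,
    integral_finsetSum _ fun j _ => integrable_finsetSum _ fun k _ => (hint _).const_mul _,
    Finset.mul_sum]
  refine Finset.sum_congr rfl fun j _ => ?_
  rw [integral_finsetSum _ fun k _ => (hint _).const_mul _, Finset.mul_sum]
  refine Finset.sum_congr rfl fun k _ => ?_
  rw [integral_const_mul]
  ring

/-- A centered Gaussian process with covariance `R`, in terms of characteristic functions. -/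
structure IsCenteredGaussian {T : Type*} (X : T → Ω → ℝ) (R : T → T → ℝ) (μ : Measure Ω) :
    Prop where
  aemeasurable : ∀ t, AEMeasurable (X t) μ
  integral_cexp : ∀ (n : ℕ) (c : Fin n → ℝ) (t : Fin n → T),
    ∫ ω, Complex.exp ((∑ j, c j * X (t j) ω : ℝ) * Complex.I) ∂μ =
      Complex.exp (-((∑ j, ∑ k, c j * c k * R (t j) (t k)) / 2 : ℝ))

/-- The stationary fractional Ornstein-Uhlenbeck process is a centered Gaussian process with
autocovariance function `rho θ`. -/
theorem IsStationaryFOU.isCenteredGaussian [IsProbabilityMeasure μ] {θ : EuclideanSpace ℝ (Fin 3)}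
    {X : ℝ → Ω → ℝ} (hX : IsStationaryFOU θ X μ) (h0 : 0 < θ 0) (h1 : θ 0 < 1) (hlam : 0 < θ 1) :
    IsCenteredGaussian X (fun s t => rho θ (s - t)) μ := by
  obtain ⟨B, hB, hX⟩ := hX
  set S : ℝ → ℕ → ℕ → Ω → ℝ := fun t m n ω =>
    uniformSum (expKernel (θ 1) t) (fun u => B u ω) t (m + 1) n with hS
  -- The truncated integrals are only known to exist pathwise. `limUnder` selects them as a function
  -- of ω, measurable up to null sets as an almost sure limit of measurable sums. The truncation
  -- length m + 1 is never 0.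
  set J : ℝ → ℕ → Ω → ℝ := fun t m ω => limUnder atTop (fun n => S t m n ω) with hJ
  have hconv : ∀ᵐ ω ∂μ, (∀ t m, Tendsto (fun n => S t m n ω) atTop (𝓝 (J t m ω))) ∧
      ∀ t, Tendsto (fun m => θ 2 * J t m ω) atTop (𝓝 (X t ω)) := by
    filter_upwards [hX] with ω hω
    have key : ∀ t, ∃ I K, (∀ m, Tendsto (fun n => S t m n ω) atTop (𝓝 (K m))) ∧
        Tendsto K atTop (𝓝 I) ∧ X t ω = θ 2 * I := by
      intro t
      obtain ⟨I, ⟨K, hK, hKI⟩, hXI⟩ := hω t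
      refine ⟨I, fun m : ℕ => K (t - (m + 1)), fun m => ?_, ?_, hXI⟩
      · have hm : (0 : ℝ) ≤ (m : ℝ) + 1 := by positivity
        exact (hK (t - (m + 1)) (by linarith)).tendsto_uniformSum hm
      · refine hKI.comp ?_
        refine tendsto_atBot_mono (fun m => ?_)
          (tendsto_neg_atTop_atBot.comp (tendsto_atTop_add_const_right _ (-t)
            (tendsto_natCast_atTop_atTop (R := ℝ))))
        simp only [Function.comp]
        linarith
    refine ⟨fun t m => ?_, fun t => ?_⟩
    · obtain ⟨I, K, hK, _⟩ := key t
      exact tendsto_nhds_limUnder ⟨_, hK m⟩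
    · obtain ⟨I, K, hK, hKI, hXI⟩ := key t
      have : ∀ m, J t m ω = K m := fun m => (hK m).limUnder_eq
      simp only [this, hXI]
      exact hKI.const_mul _
  have hJm : ∀ t m, AEMeasurable (J t m) μ := fun t m =>
    aemeasurable_of_tendsto_metrizable_ae atTop (fun n => hB.aemeasurable_uniformSum _ _ _ n)
      (hconv.mono fun ω hω => hω.1 t m)
  refine ⟨fun t => aemeasurable_of_tendsto_metrizable_ae atTop
    (fun m => (hJm t m).const_mul (θ 2)) (hconv.mono fun ω hω => hω.2 t), fun n c t => ?_⟩
  have hv : ∑ j, ∑ k, c j * c k * rho θ (t j - t k) = specVar (θ 0) (fun x =>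
      trigSum (fun j => θ 2 * c j) t x * (x * Complex.I / (θ 1 + x * Complex.I))) := by
    rw [specVar_limit h0 h1 hlam]; rfl
  rw [hv]
  refine integral_cexp_of_tendsto (Z := fun m ω => ∑ j, (θ 2 * c j) * J (t j) m ω)
    (fun m => Finset.aemeasurable_fun_sum _ fun j _ => (hJm _ _).const_mul _) ?_
    (tendsto_specVar h0 h1 (F := fun m x => trigSum (fun j => θ 2 * c j) t x *
      ((1 - Complex.exp (-(θ 1 + x * Complex.I) * (m + 1 : ℝ))) *
        (x * Complex.I / (θ 1 + x * Complex.I))))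
      (fun m => ?_) (K := (∑ j, |θ 2 * c j|) ^ 2 * 4 * (1 + (1 / θ 1) ^ 2)) ?_ fun x _ => ?_) ?_
  · filter_upwards [hconv] with ω hω
    refine tendsto_finsetSum _ fun j _ => ?_
    refine ((hω.2 (t j)).const_mul (c j)).congr fun m => ?_
    ring
  · have := measurable_trigSum (fun j => θ 2 * c j) t
    fun_prop
  · refine Eventually.of_forall fun m x _ => ?_
    exact norm_mul_mul_sq_le (norm_trigSum_le _ t x) (norm_one_sub_exp_le hlam (by positivity) x)
      (norm_div_add_mul_I_sq_le hlam x)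
  · refine Tendsto.const_mul _ ?_
    -- The truncation term in the spectral function has modulus exp(-λ(m+1)).
    have : Tendsto (fun m : ℕ => Complex.exp (-(θ 1 + x * Complex.I) * (m + 1 : ℝ))) atTop (𝓝 0) := by
      rw [tendsto_zero_iff_norm_tendsto_zero]
      simp_rw [Complex.norm_exp]
      refine Real.tendsto_exp_atBot.comp ?_
      have e : ∀ m : ℕ, (-(θ 1 + x * Complex.I) * (m + 1 : ℝ) : ℂ).re = -(θ 1 * ((m : ℝ) + 1)) := by
        intro m; simp
      simp_rw [e]
      refine tendsto_neg_atTop_atBot.comp ?_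
      exact (tendsto_atTop_add_const_right _ 1
        (tendsto_natCast_atTop_atTop (R := ℝ))).const_mul_atTop hlam
    have h2 := ((tendsto_const_nhds (x := (1 : ℂ))).sub this).mul_const
      (x * Complex.I / (θ 1 + x * Complex.I))
    simpa using h2
  · refine Eventually.of_forall fun m => ?_
    exact hB.integral_cexp_truncated h0 h1 hlam _ t (by positivity)
      (hconv.mono fun ω hω j => hω.1 (t j) m)

end


section

/-! ### Quadratic forms of Gaussian vectors -/

section

variable {Ω : Type*} [MeasurableSpace Ω] {μ : Measure Ω} {ι : Type*} [Fintype ι]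

theorem IsCenteredGaussian.integral_cexp_fintype {T : Type*} {X : T → Ω → ℝ} {R : T → T → ℝ}
    (hX : IsCenteredGaussian X R μ) (c : ι → ℝ) (t : ι → T) :
    ∫ ω, Complex.exp ((∑ j, c j * X (t j) ω : ℝ) * Complex.I) ∂μ =
      Complex.exp (-((∑ j, ∑ k, c j * c k * R (t j) (t k)) / 2 : ℝ)) := by
  have e := Fintype.equivFin ι
  have h := hX.integral_cexp _ (c ∘ e.symm) (t ∘ e.symm)
  simp only [Function.comp] at h
  rw [Equiv.sum_comp e.symm (fun j => ∑ k, c j * c (e.symm k) * R (t j) (t (e.symm k)))] at h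
  simp_rw [fun j => Equiv.sum_comp e.symm (fun k => c j * c k * R (t j) (t k)),
    fun ω => Equiv.sum_comp e.symm (fun j => c j * X (t j) ω)] at h
  exact h

/-- Finite families of linear combinations of a centered Gaussian process. -/
theorem IsCenteredGaussian.linear_combination {T S : Type*} {X : T → Ω → ℝ} {R : T → T → ℝ}
    (hX : IsCenteredGaussian X R μ) (c : S → ι → ℝ) (t : S → ι → T) :
    IsCenteredGaussian (fun s ω => ∑ j, c s j * X (t s j) ω)
      (fun s s' => ∑ j, ∑ k, c s j * c s' k * R (t s j) (t s' k)) μ := by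
  refine ⟨fun s => Finset.aemeasurable_fun_sum _ fun j _ => (hX.aemeasurable _).const_mul _,
    fun n w s => ?_⟩
  have h := hX.integral_cexp_fintype (ι := Fin n × ι) (fun p => w p.1 * c (s p.1) p.2)
    (fun p => t (s p.1) p.2)
  simp only [Fintype.sum_prod_type] at h
  have e : ∑ i, ∑ k, w i * w k * (∑ j, ∑ l, c (s i) j * c (s k) l * R (t (s i) j) (t (s k) l)) =
      ∑ i, ∑ j, ∑ k, ∑ l, w i * c (s i) j * (w k * c (s k) l) * R (t (s i) j) (t (s k) l) := by
    refine Finset.sum_congr rfl fun i _ => ?_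
    rw [Finset.sum_comm]
    refine Finset.sum_congr rfl fun k _ => ?_
    simp only [Finset.mul_sum]
    refine Finset.sum_congr rfl fun j _ => Finset.sum_congr rfl fun l _ => ?_
    ring
  rw [e, ← h]
  simp only [Finset.mul_sum, mul_assoc]

/-- The characteristic function at `c` is exp(-c'Rc/2); having modulus at most 1, it forces c'Rc ≥
0. -/
theorem IsCenteredGaussian.posSemidef [IsProbabilityMeasure μ] {Y : ι → Ω → ℝ}
    {R : Matrix ι ι ℝ} (hY : IsCenteredGaussian Y R μ) (hR : R.IsSymm) : R.PosSemidef := by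
  refine Matrix.PosSemidef.of_dotProduct_mulVec_nonneg (by rw [Matrix.IsHermitian, Matrix.conjTranspose_eq_transpose_of_trivial]; exact hR)
    fun c => ?_
  have h := congrArg norm (hY.integral_cexp_fintype c id)
  have hle : ‖∫ ω, Complex.exp ((∑ j, c j * Y (id j) ω : ℝ) * Complex.I) ∂μ‖ ≤ 1 := by
    refine (norm_integral_le_of_norm_le_const (C := 1) (ae_of_all _ fun ω => ?_)).trans ?_
    · rw [Complex.norm_exp_ofReal_mul_I]
    · simp
  rw [h, Complex.norm_exp] at hle
  simp only [Complex.neg_re, Complex.ofReal_re, Real.exp_le_one_iff, id] at hle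
  have : star c ⬝ᵥ R.mulVec c = ∑ j, ∑ k, c j * c k * R j k := by
    simp only [dotProduct, Matrix.mulVec, Finset.mul_sum]
    refine Finset.sum_congr rfl fun j _ => Finset.sum_congr rfl fun k _ => ?_
    simp; ring
  rw [this]; linarith

/-- Read the eigenvector equation at a coordinate where the eigenvector is largest in absolute
value. -/
theorem abs_eigenvalue_le_of_sum_abs_le {M : Matrix ι ι ℝ} {K m : ℝ} {y : ι → ℝ}
    (hK : ∀ p, ∑ q, |M p q| ≤ K) (hy : y ≠ 0) (h : M.mulVec y = m • y) : |m| ≤ K := by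
  obtain ⟨p₀, hp₀⟩ := Function.ne_iff.1 hy
  obtain ⟨p, _, hp⟩ := Finset.exists_max_image Finset.univ (fun p => |y p|) ⟨p₀, Finset.mem_univ _⟩
  have hpos : 0 < |y p| := (abs_pos.2 hp₀).trans_le (hp p₀ (Finset.mem_univ _))
  have h1 := congrFun h p
  simp only [Matrix.mulVec, dotProduct, Pi.smul_apply, smul_eq_mul] at h1
  refine le_of_mul_le_mul_right ?_ hpos
  rw [← abs_mul, ← h1]
  calc |∑ q, M p q * y q| ≤ ∑ q, |M p q * y q| := Finset.abs_sum_le_sum_abs _ _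
    _ ≤ ∑ q, |M p q| * |y p| := Finset.sum_le_sum fun q _ => by
        rw [abs_mul]; exact mul_le_mul_of_nonneg_left (hp q (Finset.mem_univ _)) (abs_nonneg _)
    _ = (∑ q, |M p q|) * |y p| := by rw [Finset.sum_mul]
    _ ≤ K * |y p| := mul_le_mul_of_nonneg_right (hK p) hpos.le

variable [DecidableEq ι]

theorem IsCenteredGaussian.map_eq_multivariateGaussian [IsProbabilityMeasure μ] {Y : ι → Ω → ℝ}
    {R : Matrix ι ι ℝ} (hY : IsCenteredGaussian Y R μ) (hR : R.IsSymm) :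
    AEMeasurable (fun ω => WithLp.toLp 2 fun p => Y p ω) μ ∧
    μ.map (fun ω => WithLp.toLp 2 fun p => Y p ω) = multivariateGaussian 0 R := by
  have hm : AEMeasurable (fun ω => WithLp.toLp 2 fun p => Y p ω) μ :=
    (PiLp.continuous_toLp 2 (fun _ : ι => ℝ)).measurable.comp_aemeasurable
      (aemeasurable_pi_lambda _ hY.aemeasurable)
  refine ⟨hm, ?_⟩
  have := Measure.isProbabilityMeasure_map hm
  refine Measure.ext_of_charFun (funext fun c => ?_)
  rw [charFun_multivariateGaussian (hY.posSemidef hR), charFun_apply,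
    integral_map hm (by fun_prop)]
  have h := hY.integral_cexp_fintype c id
  simp only [id] at h
  simp only [PiLp.inner_apply, RCLike.inner_apply, conj_trivial]
  rw [h]
  congr 1
  simp only [dotProduct, Matrix.mulVec, Finset.mul_sum]
  simp only [PiLp.zero_apply, zero_mul, Finset.sum_const_zero, Complex.ofReal_zero, zero_sub]
  push_cast
  congr 2
  refine Finset.sum_congr rfl fun j _ => Finset.sum_congr rfl fun k _ => ?_
  ring

theorem sum_eigenvalues_sq {M : Matrix ι ι ℝ} (hM : M.IsHermitian) :
    ∑ i, hM.eigenvalues i ^ 2 = (M * M).trace := by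
  conv_rhs => rw [hM.spectral_theorem]
  rw [← map_mul, Unitary.conjStarAlgAut_apply, Matrix.trace_mul_comm, ← mul_assoc]
  simp [sq, Matrix.trace]

/-- A diagonal quadratic form of a centered Gaussian vector is distributed as a linear combination
of squares of independent standard Gaussian variables. -/
theorem IsCenteredGaussian.exists_map_sum_sq_eq [IsProbabilityMeasure μ] {Y : ι → Ω → ℝ}
    {R : Matrix ι ι ℝ} (hY : IsCenteredGaussian Y R μ) (hR : R.IsSymm) (d : ι → ℝ) {K : ℝ}
    (hK : ∀ p, ∑ q, |d p * R p q| ≤ K) (hK0 : 0 ≤ K) :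
    ∃ m : ι → ℝ, ∑ k, m k = ∑ p, d p * R p p ∧
      ∑ k, m k ^ 2 = ∑ p, ∑ q, d p * d q * R p q ^ 2 ∧ (∀ k, |m k| ≤ K) ∧
      AEMeasurable (fun ω => ∑ p, d p * Y p ω ^ 2) μ ∧
      μ.map (fun ω => ∑ p, d p * Y p ω ^ 2) =
        (Measure.pi fun _ : ι => gaussianReal 0 1).map (fun ξ => ∑ k, m k * ξ k ^ 2) := by
  open scoped MatrixOrder in
  have hpsd := hY.posSemidef hR
  obtain ⟨hm, hmap⟩ := hY.map_eq_multivariateGaussian hR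
  set S := CFC.sqrt R with hS
  have hSS : S * S = R := CFC.sqrt_mul_sqrt_self _ hpsd.nonneg
  have hSsymm : S.transpose = S := by
    have : S.IsHermitian := (CFC.sqrt_nonneg R).isSelfAdjoint
    simpa [Matrix.IsHermitian] using this
  -- Y has the law of S ξ with ξ standard Gaussian, so the form is ξ' M ξ; in an eigenbasis of M it
  -- becomes a sum of squares weighted by the eigenvalues.
  set M := S * Matrix.diagonal d * S with hMdef
  have hM : M.IsHermitian := by
    simp only [Matrix.IsHermitian, hMdef, Matrix.conjTranspose_eq_transpose_of_trivial,
      Matrix.transpose_mul, hSsymm, Matrix.diagonal_transpose, Matrix.mul_assoc]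
  refine ⟨hM.eigenvalues, ?_, ?_, fun k => ?_,
    Finset.aemeasurable_fun_sum _ fun p _ => ((hY.aemeasurable p).pow_const 2).const_mul _, ?_⟩
  · have h := hM.trace_eq_sum_eigenvalues
    simp only [RCLike.ofReal_real_eq_id, id] at h
    rw [← h, hMdef, Matrix.trace_mul_comm, ← mul_assoc, hSS, Matrix.trace]
    exact Finset.sum_congr rfl fun p _ => by simp [mul_comm]
  · rw [sum_eigenvalues_sq, hMdef]
    rw [show S * Matrix.diagonal d * S * (S * Matrix.diagonal d * S) =
      S * Matrix.diagonal d * (S * S) * Matrix.diagonal d * S by simp only [mul_assoc],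
      Matrix.trace_mul_comm, hSS,
      show S * (S * Matrix.diagonal d * R * Matrix.diagonal d) =
      (S * S) * Matrix.diagonal d * (R * Matrix.diagonal d) by simp only [mul_assoc], hSS]
    rw [Matrix.trace]
    refine Finset.sum_congr rfl fun p _ => ?_
    rw [Matrix.diag_apply, Matrix.mul_apply]
    refine Finset.sum_congr rfl fun q _ => ?_
    rw [Matrix.mul_diagonal, Matrix.mul_diagonal, hR.apply p q]
    ring
  · set b := (hM.eigenvectorBasis k).ofLp with hb
    have hMb : M.mulVec b = hM.eigenvalues k • b := hM.mulVec_eigenvectorBasis k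
    have hb0 : b ≠ 0 := by
      intro h
      have h1 := hM.eigenvectorBasis.orthonormal.1 k
      have h2 : hM.eigenvectorBasis k = 0 := by ext i; exact congrFun h i
      rw [h2] at h1; simp at h1
    by_cases h0 : hM.eigenvalues k = 0
    · rw [h0]; simpa using hK0
    -- M = S D S and D R = D S S have the same nonzero eigenvalues: if b is an eigenvector of M,
    -- then D S b is one of D R. Only the latter matrix has entries that the hypothesis controls.
    refine abs_eigenvalue_le_of_sum_abs_le (M := Matrix.diagonal d * R)
      (y := (Matrix.diagonal d * S).mulVec b) (fun p => ?_) ?_ ?_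
    · simpa [Matrix.diagonal_mul] using hK p
    · intro h
      have h1 : M.mulVec b = 0 := by
        rw [hMdef, mul_assoc, ← Matrix.mulVec_mulVec, h, Matrix.mulVec_zero]
      rw [h1] at hMb
      exact (smul_ne_zero h0 hb0) hMb.symm
    · rw [← Matrix.mulVec_smul, ← hMb, Matrix.mulVec_mulVec, Matrix.mulVec_mulVec, hMdef, ← hSS]
      simp only [mul_assoc]
  · have hcomp : (fun ω => ∑ p, d p * Y p ω ^ 2) =
        (fun y : EuclideanSpace ℝ ι => ∑ p, d p * y p ^ 2) ∘
          (fun ω => WithLp.toLp 2 fun p => Y p ω) := rfl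
    rw [hcomp, ← AEMeasurable.map_map_of_aemeasurable
      (Measurable.aemeasurable (by fun_prop)) hm, hmap, multivariateGaussian,
      -- By rotation invariance the independent coordinates may be taken along the eigenvectors of
      -- M.
      stdGaussian_eq_map_pi_orthonormalBasis hM.eigenvectorBasis,
      Measure.map_map (by fun_prop) (by fun_prop), Measure.map_map (by fun_prop) (by fun_prop)]
    congr 1
    ext ξ
    simp only [Function.comp, zero_add, Matrix.ofLp_toEuclideanCLM]
    rw [← hS]
    set b := hM.eigenvectorBasis
    set z : EuclideanSpace ℝ ι := ∑ k, ξ k • b k with hz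
    have h1 : ∑ p, d p * (S.mulVec z.ofLp) p ^ 2 = z.ofLp ⬝ᵥ M.mulVec z.ofLp := by
      rw [hMdef, mul_assoc, ← Matrix.mulVec_mulVec, Matrix.dotProduct_mulVec, ← Matrix.mulVec_transpose,
        hSsymm, ← Matrix.mulVec_mulVec]
      simp only [dotProduct, Matrix.mulVec_diagonal]
      exact Finset.sum_congr rfl fun p _ => by ring
    have h2 : WithLp.toLp 2 (M.mulVec z.ofLp) = ∑ k, (hM.eigenvalues k * ξ k) • b k := by
      rw [← Matrix.toEuclideanCLM_toLp (𝕜 := ℝ)]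
      simp only [WithLp.toLp_ofLp]
      rw [hz, map_sum]
      refine Finset.sum_congr rfl fun k _ => ?_
      rw [map_smul]
      have : (Matrix.toEuclideanCLM (𝕜 := ℝ) M) (b k) = hM.eigenvalues k • b k := by
        ext i
        rw [Matrix.ofLp_toEuclideanCLM, hM.mulVec_eigenvectorBasis]
        rfl
      rw [this, smul_smul, mul_comm]
    have h3 : z.ofLp ⬝ᵥ M.mulVec z.ofLp = inner ℝ z (WithLp.toLp 2 (M.mulVec z.ofLp)) := by
      rw [EuclideanSpace.inner_eq_star_dotProduct]
      simp [dotProduct_comm]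
    have : ∑ p, d p * (S.mulVec z.ofLp) p ^ 2 = ∑ k, hM.eigenvalues k * ξ k ^ 2 := by
      rw [h1, h3, h2, hz, b.orthonormal.inner_sum]
      refine Finset.sum_congr rfl fun k _ => ?_
      simp; ring
    exact this

end

end


/-! ### Normal approximation of Gaussian quadratic forms -/

section

theorem integral_pow_gaussianReal_even :
    ∫ x, x ^ 2 ∂(gaussianReal 0 1) = 1 ∧ ∫ x, x ^ 4 ∂(gaussianReal 0 1) = 3 := by
  constructor
  · have h := variance_eq_integral (X := fun x : ℝ => x) (μ := gaussianReal 0 1) aemeasurable_id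
    rw [variance_fun_id_gaussianReal, integral_id_gaussianReal] at h
    simpa using h.symm
  · rw [integral_gaussianReal_eq_integral_smul one_ne_zero]
    have e : ∀ x : ℝ, gaussianPDFReal 0 1 x • x ^ 4 =
        (√(2 * Real.pi))⁻¹ * (fun y : ℝ => y ^ (4 : ℝ) * Real.exp (-(1 / 2) * y ^ (2 : ℝ))) |x| := by
      intro x
      have h4 : |x| ^ (4 : ℝ) = x ^ 4 := by
        rw [show (4 : ℝ) = ((4 : ℕ) : ℝ) by norm_num, Real.rpow_natCast]
        exact Even.pow_abs (by decide) x
      have h2 : |x| ^ (2 : ℝ) = x ^ 2 := by rw [Real.rpow_two, sq_abs]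
      simp only [h4, h2, gaussianPDFReal, smul_eq_mul]
      simp
      ring_nf
    simp_rw [e]
    rw [integral_const_mul, integral_comp_abs
      (f := fun y : ℝ => y ^ (4 : ℝ) * Real.exp (-(1 / 2) * y ^ (2 : ℝ))),
      integral_rpow_mul_exp_neg_mul_rpow (by norm_num) (by norm_num) (by norm_num)]
    have hG : Real.Gamma ((4 + 1) / 2) = 3 / 4 * √Real.pi := by
      rw [show ((4 : ℝ) + 1) / 2 = (1 / 2 + 1) + 1 by norm_num, Real.Gamma_add_one (by norm_num),
        Real.Gamma_add_one (by norm_num), Real.Gamma_one_half_eq]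
      ring
    rw [hG]
    have hp : (1 / 2 : ℝ) ^ (-(4 + 1) / 2 : ℝ) = 4 * √2 := by
      rw [one_div, Real.inv_rpow (by norm_num), ← Real.rpow_neg (by norm_num),
        show -(-(4 + 1) / 2 : ℝ) = 2 + 1 / 2 by norm_num, Real.rpow_add (by norm_num),
        Real.rpow_two, ← Real.sqrt_eq_rpow]
      norm_num
    rw [hp, Real.sqrt_mul (by norm_num)]
    have := Real.sqrt_pos.2 Real.pi_pos
    have := Real.sqrt_pos.2 (two_pos : (0 : ℝ) < 2)
    field_simp

theorem integrable_pow_gaussianReal (n : ℕ) : Integrable (fun x => x ^ n) (gaussianReal 0 1) := by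
  have h := (memLp_id_gaussianReal (μ := 0) (v := 1) n).integrable_norm_pow'
  refine (h.mono' (by fun_prop) (ae_of_all _ fun x => ?_))
  simp

/-- The characteristic function of `ξ ^ 2 - 1`, for `ξ` standard Gaussian. -/
def sqCharFun (τ : ℝ) : ℂ := ∫ x, Complex.exp ((τ * (x ^ 2 - 1) : ℝ) * Complex.I) ∂(gaussianReal 0 1)

theorem norm_sqCharFun_le (τ : ℝ) : ‖sqCharFun τ‖ ≤ 1 := by
  refine (norm_integral_le_of_norm_le_const (C := 1) (ae_of_all _ fun ω => ?_)).trans ?_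
  · rw [Complex.norm_exp_ofReal_mul_I]
  · simp

theorem integral_sq_sub_one :
    ∫ x, (x ^ 2 - 1) ∂(gaussianReal 0 1) = 0 ∧ ∫ x, (x ^ 2 - 1) ^ 2 ∂(gaussianReal 0 1) = 2 := by
  obtain ⟨h2, h4⟩ := integral_pow_gaussianReal_even
  have i2 := integrable_pow_gaussianReal 2
  have i4 := integrable_pow_gaussianReal 4
  refine ⟨?_, ?_⟩
  · rw [integral_sub i2 (integrable_const _), h2]; simp
  · have e : ∀ x : ℝ, (x ^ 2 - 1) ^ 2 = x ^ 4 - 2 * x ^ 2 + 1 := fun x => by ring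
    simp_rw [e]
    have i3 : Integrable (fun x : ℝ => x ^ 4 - 2 * x ^ 2) (gaussianReal 0 1) :=
      i4.sub (i2.const_mul 2)
    rw [integral_add i3 (integrable_const _), integral_sub i4 (i2.const_mul 2),
      integral_const_mul, h2, h4]
    simp; norm_num

/-- The variable ξ² - 1 has mean 0 and variance 2, so its characteristic function is 1 - τ² + o(τ²),
as is exp(-τ²). -/
theorem exists_norm_sqCharFun_sub_le {ε : ℝ} (hε : 0 < ε) :
    ∃ δ > 0, ∀ τ : ℝ, |τ| ≤ δ →
      ‖sqCharFun τ - Complex.exp (-(τ ^ 2 : ℝ))‖ ≤ ε * τ ^ 2 := by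
  obtain ⟨m0, m2⟩ := integral_sq_sub_one
  have hs : (√2 : ℝ) ≠ 0 := by positivity
  -- Division by √2 normalizes the variance to 1; the argument √2 τ undoes it.
  have ht := taylor_charFun_two (P := gaussianReal 0 1) (X := fun x : ℝ => (x ^ 2 - 1) / √2)
    (by fun_prop) (by rw [integral_div, m0, zero_div])
    (by
      have : ((fun x : ℝ => (x ^ 2 - 1) / √2) ^ 2) = fun x => (x ^ 2 - 1) ^ 2 / 2 := by
        ext x; simp [div_pow]
      rw [this, integral_div, m2]; norm_num)
  have hχ : ∀ τ : ℝ, charFun ((gaussianReal 0 1).map fun x : ℝ => (x ^ 2 - 1) / √2) (√2 * τ) =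
      sqCharFun τ := by
    intro τ
    rw [charFun_apply_real, integral_map (by fun_prop) (by fun_prop), sqCharFun]
    congr 1
    ext x
    rw [← Complex.ofReal_mul]
    congr 3
    field_simp
  rw [Asymptotics.isLittleO_iff] at ht
  have h1 := ht (c := ε / 4) (by positivity)
  rw [Metric.eventually_nhds_iff] at h1
  obtain ⟨δ₁, hδ₁, h1⟩ := h1
  -- The first bound puts √2 τ inside the Taylor neighbourhood; the second and third bound the
  -- remainder τ⁴ of exp(-τ²) by (ε/2) τ².
  refine ⟨min (δ₁ / 4) (min 1 (√(ε / 2))), by positivity, fun τ hτ => ?_⟩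
  have hτ1 : |τ| ≤ δ₁ / 4 := hτ.trans (min_le_left _ _)
  have hτ2 : |τ| ≤ 1 := hτ.trans ((min_le_right _ _).trans (min_le_left _ _))
  have hτ3 : |τ| ≤ √(ε / 2) := hτ.trans ((min_le_right _ _).trans (min_le_right _ _))
  have hτ4 : τ ^ 2 ≤ ε / 2 := by
    rw [← sq_abs, ← Real.sq_sqrt (by positivity : (0 : ℝ) ≤ ε / 2)]
    exact pow_le_pow_left₀ (abs_nonneg _) hτ3 2
  have hs2 : √2 < 2 := by
    rw [Real.sqrt_lt' (by norm_num)]; norm_num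
  have h2 := h1 (y := √2 * τ) (by
    rw [Real.dist_eq, sub_zero, abs_mul, abs_of_nonneg (Real.sqrt_nonneg _)]
    nlinarith [abs_nonneg τ])
  rw [hχ] at h2
  have h3 : ‖sqCharFun τ - (1 - τ ^ 2 : ℝ)‖ ≤ ε / 2 * τ ^ 2 := by
    refine le_of_eq_of_le ?_ (h2.trans_eq ?_)
    · congr 2
      push_cast
      rw [mul_pow, ← Complex.ofReal_pow √2, Real.sq_sqrt (by norm_num)]
      push_cast; ring
    · rw [Real.norm_of_nonneg (sq_nonneg _), mul_pow, Real.sq_sqrt (by norm_num)]; ring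
  have h4 : ‖((1 - τ ^ 2 : ℝ) : ℂ) - Complex.exp (-(τ ^ 2 : ℝ))‖ ≤ ε / 2 * τ ^ 2 := by
    rw [← Complex.ofReal_neg, ← Complex.ofReal_exp, ← Complex.ofReal_sub, Complex.norm_real]
    have h5 := Real.abs_exp_sub_one_sub_id_le (x := -τ ^ 2) (by
      rw [abs_neg, abs_of_nonneg (sq_nonneg _), ← sq_abs]
      exact pow_le_one₀ (abs_nonneg _) hτ2)
    rw [Real.norm_eq_abs, abs_sub_comm]
    calc _ = |Real.exp (-τ ^ 2) - 1 - -τ ^ 2| := by congr 1; ring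
      _ ≤ (-τ ^ 2) ^ 2 := h5
      _ = τ ^ 2 * τ ^ 2 := by ring
      _ ≤ _ := mul_le_mul_of_nonneg_right hτ4 (sq_nonneg _)
  calc _ = ‖(sqCharFun τ - (1 - τ ^ 2 : ℝ)) + (((1 - τ ^ 2 : ℝ) : ℂ) -
        Complex.exp (-(τ ^ 2 : ℝ)))‖ := by congr 1; ring
    _ ≤ _ := norm_add_le _ _
    _ ≤ ε / 2 * τ ^ 2 + ε / 2 * τ ^ 2 := add_le_add h3 h4
    _ = _ := by ring

/-- Replace the factors one at a time; the other factors lie in the unit disc. -/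
theorem norm_prod_sub_prod_le {ι : Type*} (s : Finset ι) (z w : ι → ℂ)
    (hz : ∀ i ∈ s, ‖z i‖ ≤ 1) (hw : ∀ i ∈ s, ‖w i‖ ≤ 1) :
    ‖∏ i ∈ s, z i - ∏ i ∈ s, w i‖ ≤ ∑ i ∈ s, ‖z i - w i‖ := by
  classical
  induction s using Finset.induction_on with
  | empty => simp
  | insert a s ha ih =>
    rw [Finset.prod_insert ha, Finset.prod_insert ha, Finset.sum_insert ha]
    have ih' := ih (fun i hi => hz i (Finset.mem_insert_of_mem hi))
      (fun i hi => hw i (Finset.mem_insert_of_mem hi))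
    have hp : ‖∏ i ∈ s, z i‖ ≤ 1 := by
      rw [norm_prod]
      exact Finset.prod_le_one (fun _ _ => norm_nonneg _)
        fun i hi => hz i (Finset.mem_insert_of_mem hi)
    calc _ = ‖(z a - w a) * ∏ i ∈ s, z i + w a * (∏ i ∈ s, z i - ∏ i ∈ s, w i)‖ := by
          congr 1; ring
      _ ≤ ‖z a - w a‖ * ‖∏ i ∈ s, z i‖ + ‖w a‖ * ‖∏ i ∈ s, z i - ∏ i ∈ s, w i‖ := by
          rw [← norm_mul, ← norm_mul]; exact norm_add_le _ _
      _ ≤ ‖z a - w a‖ * 1 + 1 * ∑ i ∈ s, ‖z i - w i‖ := by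
          have := hw a (Finset.mem_insert_self _ _)
          gcongr
      _ = _ := by ring

section

variable {Ω : Type*} [MeasurableSpace Ω] {μ : Measure Ω}

/-- Gaussian approximation of centered quadratic forms in a Gaussian vector. -/
theorem exists_norm_integral_cexp_quadratic_sub_le [IsProbabilityMeasure μ] {ε : ℝ} (hε : 0 < ε) :
    ∃ δ > 0, ∀ {ι : Type} [Fintype ι] {Y : ι → Ω → ℝ} {R : Matrix ι ι ℝ},
      IsCenteredGaussian Y R μ → R.IsSymm → ∀ d : ι → ℝ, (∀ p, ∑ q, |d p * R p q| ≤ δ) →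
      ‖∫ ω, Complex.exp ((∑ p, d p * (Y p ω ^ 2 - R p p) : ℝ) * Complex.I) ∂μ -
        Complex.exp (-(∑ p, ∑ q, d p * d q * R p q ^ 2 : ℝ))‖ ≤
      ε * ∑ p, ∑ q, d p * d q * R p q ^ 2 := by
  obtain ⟨δ, hδ, h⟩ := exists_norm_sqCharFun_sub_le hε
  refine ⟨δ, hδ, fun {ι} _ {Y R} hY hR d hK => ?_⟩
  classical
  obtain ⟨m, hm1, hm2, hmK, hmeas, hmap⟩ := hY.exists_map_sum_sq_eq hR d hK hδ.le
  have e1 : ∫ ω, Complex.exp ((∑ p, d p * (Y p ω ^ 2 - R p p) : ℝ) * Complex.I) ∂μ =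
      ∏ k, sqCharFun (m k) := by
    have h1 : ∀ ω, ∑ p, d p * (Y p ω ^ 2 - R p p) = ∑ p, d p * Y p ω ^ 2 - ∑ k, m k := by
      intro ω; rw [hm1, ← Finset.sum_sub_distrib]
      exact Finset.sum_congr rfl fun p _ => by ring
    simp_rw [h1]
    have h2 := integral_map (f := fun z : ℝ => Complex.exp ((z - ∑ k, m k : ℝ) * Complex.I)) hmeas
      (by fun_prop)
    have hmsq : Measurable fun ξ : ι → ℝ => ∑ k, m k * ξ k ^ 2 := by fun_prop
    rw [← h2, hmap, integral_map hmsq.aemeasurable (by fun_prop)]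
    unfold sqCharFun
    rw [← integral_fintype_prod_eq_prod
      (f := fun k (x : ℝ) => Complex.exp ((m k * (x ^ 2 - 1) : ℝ) * Complex.I))]
    congr 1
    ext ξ
    rw [← Complex.exp_sum, ← Finset.sum_mul, ← Complex.ofReal_sum, ← Finset.sum_sub_distrib]
    congr 3
    exact Finset.sum_congr rfl fun p _ => by ring
  have e2 : Complex.exp (-(∑ p, ∑ q, d p * d q * R p q ^ 2 : ℝ)) =
      ∏ k, Complex.exp (-(m k ^ 2 : ℝ)) := by
    rw [← hm2, ← Complex.exp_sum]; push_cast; rw [Finset.sum_neg_distrib]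
  rw [e1, e2, ← hm2, Finset.mul_sum]
  -- By independence both terms are products over the eigenvalues. Since |m k| ≤ δ, each pair of
  -- factors differs by at most ε m_k², and these errors sum to ε Σ m_k².
  refine (norm_prod_sub_prod_le _ _ _ (fun k _ => norm_sqCharFun_le _) fun k _ => ?_).trans
    (Finset.sum_le_sum fun k _ => h _ (hmK k))
  rw [Complex.norm_exp, Complex.neg_re, Complex.ofReal_re, Real.exp_le_one_iff]
  linarith [sq_nonneg (m k)]

/-- The variance of a diagonal quadratic form in a Gaussian vector. -/
theorem IsCenteredGaussian.integral_quadratic_sq [IsProbabilityMeasure μ] {ι : Type*} [Fintype ι]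
    {Y : ι → Ω → ℝ} {R : Matrix ι ι ℝ} (hY : IsCenteredGaussian Y R μ) (hR : R.IsSymm)
    (d : ι → ℝ) :
    Integrable (fun ω => (∑ p, d p * (Y p ω ^ 2 - R p p)) ^ 2) μ ∧
    ∫ ω, (∑ p, d p * (Y p ω ^ 2 - R p p)) ^ 2 ∂μ = 2 * ∑ p, ∑ q, d p * d q * R p q ^ 2 := by
  classical
  obtain ⟨m, hm1, hm2, -, hmeas, hmap⟩ := hY.exists_map_sum_sq_eq hR d
    (K := ∑ p, ∑ q, |d p * R p q|) (fun p => Finset.single_le_sum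
      (f := fun p => ∑ q, |d p * R p q|) (fun p _ => Finset.sum_nonneg fun q _ => abs_nonneg _)
      (Finset.mem_univ p))
    (Finset.sum_nonneg fun p _ => Finset.sum_nonneg fun q _ => abs_nonneg _)
  have h1 : ∀ ω, ∑ p, d p * (Y p ω ^ 2 - R p p) = ∑ p, d p * Y p ω ^ 2 - ∑ k, m k := by
    intro ω; rw [hm1, ← Finset.sum_sub_distrib]
    exact Finset.sum_congr rfl fun p _ => by ring
  have h2 : ∀ ξ : ι → ℝ, ∑ k, m k * ξ k ^ 2 - ∑ k, m k = ∑ k, m k * (ξ k ^ 2 - 1) := by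
    intro ξ; rw [← Finset.sum_sub_distrib]
    exact Finset.sum_congr rfl fun p _ => by ring
  obtain ⟨m0, m2⟩ := integral_sq_sub_one
  have hL : MemLp (fun x : ℝ => x ^ 2 - 1) 2 (gaussianReal 0 1) := by
    rw [memLp_two_iff_integrable_sq (by fun_prop)]
    exact .of_integral_ne_zero (by rw [m2]; norm_num)
  have hLk : ∀ k, MemLp (fun x : ℝ => m k * (x ^ 2 - 1)) 2 (gaussianReal 0 1) :=
    fun k => hL.const_mul _
  have hev : ∀ k, MemLp (fun ξ : ι → ℝ => m k * (ξ k ^ 2 - 1)) 2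
      (Measure.pi fun _ : ι => gaussianReal 0 1) := fun k =>
    (hLk k).comp_measurePreserving (measurePreserving_eval (fun _ : ι => gaussianReal 0 1) k)
  have hsum : MemLp (fun ξ : ι → ℝ => ∑ k, m k * (ξ k ^ 2 - 1)) 2
      (Measure.pi fun _ : ι => gaussianReal 0 1) := memLp_finsetSum _ fun k _ => hev k
  have hmean : ∫ ξ, ∑ k, m k * (ξ k ^ 2 - 1) ∂(Measure.pi fun _ : ι => gaussianReal 0 1) = 0 := by
    rw [integral_finsetSum _ fun k _ => (hev k).integrable (by norm_num)]
    refine Finset.sum_eq_zero fun k _ => ?_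
    have := (measurePreserving_eval (fun _ : ι => gaussianReal 0 1) k).map_eq
    have h3 := integral_map (μ := Measure.pi fun _ : ι => gaussianReal 0 1)
      (φ := Function.eval k) (f := fun x : ℝ => m k * (x ^ 2 - 1))
      (measurable_pi_apply k).aemeasurable (by fun_prop)
    rw [this, integral_const_mul, m0, mul_zero] at h3
    exact h3.symm
  have hvar : Var[fun ξ : ι → ℝ => ∑ k, m k * (ξ k ^ 2 - 1);
      Measure.pi fun _ : ι => gaussianReal 0 1] = 2 * ∑ k, m k ^ 2 := by
    have := variance_sum_pi hLk
    rw [Finset.mul_sum]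
    convert this using 1
    · congr 1; ext ξ; simp
    · refine Finset.sum_congr rfl fun k _ => ?_
      rw [variance_const_mul, variance_eq_integral (by fun_prop), m0]
      simp only [sub_zero, m2]; ring
  have hmsq : Measurable fun ξ : ι → ℝ => ∑ k, m k * ξ k ^ 2 := by fun_prop
  rw [variance_eq_integral hsum.aestronglyMeasurable.aemeasurable, hmean] at hvar
  simp only [sub_zero] at hvar
  simp_rw [h1]
  have hsq := (memLp_two_iff_integrable_sq hsum.aestronglyMeasurable).1 hsum
  have hf : AEStronglyMeasurable (fun z : ℝ => (z - ∑ k, m k) ^ 2)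
    (μ.map fun ω => ∑ p, d p * Y p ω ^ 2) := by fun_prop
  constructor
  · have : Integrable (fun z : ℝ => (z - ∑ k, m k) ^ 2) (μ.map fun ω => ∑ p, d p * Y p ω ^ 2) := by
      rw [hmap, integrable_map_measure (by fun_prop) hmsq.aemeasurable]
      simpa only [Function.comp_def, h2] using hsq
    exact (integrable_map_measure hf hmeas).1 this
  · have h3 := integral_map hmeas hf
    rw [← h3, hmap, integral_map hmsq.aemeasurable (by fun_prop)]
    simp only [h2]
    rw [hvar, hm2]

end

end


section

/-! ### Filters -/

/-- The factor 2 in `bVec` counts the two orders of a pair of indices at distance k > 0. -/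
theorem bVec_eq_sum {L : ℕ} (a : Fin (L + 1) → ℝ) (k : Fin (L + 1)) :
    bVec a k = ∑ m : Fin (L + 1), ∑ j : Fin (L + 1),
      if ((m : ℤ) - (j : ℤ)).natAbs = (k : ℕ) then a m * a j else 0 := by
  unfold bVec
  split_ifs with h
  · subst h
    refine Finset.sum_congr rfl fun m _ => ?_
    rw [Finset.sum_eq_single m]
    · simp [sq]
    · intro j _ hj
      rw [if_neg]
      intro h
      exact hj (Fin.ext (by simp at h; omega))
    · simp
  · have hk : 0 < (k : ℕ) := Nat.pos_of_ne_zero fun h0 => h (Fin.ext (by simpa using h0))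
    have e : ∀ m j : Fin (L + 1), (if ((m : ℤ) - (j : ℤ)).natAbs = (k : ℕ) then a m * a j else 0) =
        (if (m : ℕ) = k + j then a m * a j else 0) + (if (j : ℕ) = k + m then a j * a m else 0) := by
      intro m j
      split_ifs <;> first | omega | ring
    simp_rw [e, Finset.sum_add_distrib]
    rw [two_mul]
    congr 1
    exact Finset.sum_comm

theorem sum_bVec_mul {L : ℕ} (a : Fin (L + 1) → ℝ) (F : ℕ → ℝ) :
    ∑ k, bVec a k * F k =
      ∑ m : Fin (L + 1), ∑ j : Fin (L + 1), a m * a j * F ((m : ℤ) - (j : ℤ)).natAbs := by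
  simp_rw [bVec_eq_sum, Finset.sum_mul]
  rw [Finset.sum_comm]
  refine Finset.sum_congr rfl fun m _ => ?_
  rw [Finset.sum_comm]
  refine Finset.sum_congr rfl fun j _ => ?_
  rw [Finset.sum_eq_single (⟨((m : ℤ) - (j : ℤ)).natAbs, by omega⟩ : Fin (L + 1))]
  · simp
  · intro k _ hk
    rw [if_neg, zero_mul]
    intro h
    exact hk (Fin.ext h.symm)
  · simp

theorem rho_neg (θ : EuclideanSpace ℝ (Fin 3)) (t : ℝ) : rho θ (-t) = rho θ t := by
  simp [rho]

theorem IsFilter.sum_eq_zero {L : ℕ} {a : Fin (L + 1) → ℝ} {l : ℕ} (h : IsFilter a l)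
    (hl : 1 ≤ l) : ∑ q, a q = 0 := by
  rw [IsFilter, if_neg (by omega)] at h
  simpa using h.1 0 (by omega)

/-- The sum is (Σ a_q)². Consequently V depends on ρ only through its variogram. -/
theorem sum_bVec_eq_zero {L : ℕ} {a : Fin (L + 1) → ℝ} (h : ∑ q, a q = 0) :
    ∑ k, bVec a k = 0 := by
  have := sum_bVec_mul a (fun _ => 1)
  simp only [mul_one] at this
  rw [this, ← Finset.sum_mul_sum, h, zero_mul]

theorem crossCov_zero {L : ℕ} (a : Fin L → Fin (L + 1) → ℝ) (α : ℝ)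
    (θ : EuclideanSpace ℝ (Fin 3)) (ℓ : Fin L) : crossCov a α θ ℓ ℓ 0 = V (a ℓ) α θ := by
  unfold V crossCov
  rw [sum_bVec_mul (a ℓ) (fun n => rho θ (α * n))]
  refine Finset.sum_congr rfl fun m _ => Finset.sum_congr rfl fun j _ => ?_
  congr 1
  have : (((m : ℤ) - (j : ℤ)).natAbs : ℝ) = |(m : ℝ) - (j : ℝ)| := by
    rw [Nat.cast_natAbs]; push_cast; rfl
  rw [this]
  rcases abs_cases ((m : ℝ) - (j : ℝ)) with h | h <;> rw [h.1]
  · rw [← rho_neg]; congr 1; push_cast; ring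
  · congr 1; push_cast; ring

theorem crossCov_neg {L : ℕ} (a : Fin L → Fin (L + 1) → ℝ) (α : ℝ)
    (θ : EuclideanSpace ℝ (Fin 3)) (i j : Fin L) (k : ℤ) :
    crossCov a α θ i j (-k) = crossCov a α θ j i k := by
  unfold crossCov
  rw [Finset.sum_comm]
  refine Finset.sum_congr rfl fun m _ => Finset.sum_congr rfl fun j _ => ?_
  rw [mul_comm (a _ _) (a _ _), ← rho_neg]
  congr 2
  push_cast
  ring

/-! ### Decay of the covariances of the filtered process -/

/-- The spectral density `x ^ (1 - 2 H) / (lam ^ 2 + x ^ 2)` of the stationary fractional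
Ornstein-Uhlenbeck process, up to a constant. -/
def ouDensity (H lam x : ℝ) : ℝ := x ^ (1 - 2 * H) / (lam ^ 2 + x ^ 2)

variable {H lam : ℝ}

theorem measurable_ouDensity : Measurable (ouDensity H lam) := by
  unfold ouDensity; fun_prop

theorem ouDensity_nonneg {x : ℝ} (hx : 0 < x) : 0 ≤ ouDensity H lam x :=
  div_nonneg (Real.rpow_nonneg hx.le _) (by positivity)

theorem ouDensity_eq {x : ℝ} (hx : 0 < x) :
    ouDensity H lam x = x ^ 2 / (lam ^ 2 + x ^ 2) * x ^ (-1 - 2 * H) := by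
  rw [ouDensity, show (1 - 2 * H) = 2 + (-1 - 2 * H) by ring, Real.rpow_add hx, Real.rpow_two]
  ring

theorem integrableOn_ouDensity (h0 : 0 < H) (h1 : H < 1) (hlam : 0 < lam) :
    IntegrableOn (ouDensity H lam) (Set.Ioi 0) := by
  have := integrableOn_mul_rpow_of_le h0 h1 (f := fun x => x ^ 2 / (lam ^ 2 + x ^ 2))
    (by fun_prop) (K := 1 + (1 / lam) ^ 2) fun x _ => by
      rw [← norm_div_add_mul_I_sq, abs_of_nonneg (sq_nonneg ‖_‖)]
      exact norm_div_add_mul_I_sq_le hlam x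
  exact this.congr_fun (fun x hx => (ouDensity_eq hx).symm) measurableSet_Ioi

theorem hasDerivAt_ouDensity (hlam : 0 < lam) {x : ℝ} (hx : 0 < x) :
    HasDerivAt (ouDensity H lam)
      (((1 - 2 * H) / x - 2 * x / (lam ^ 2 + x ^ 2)) * ouDensity H lam x) x := by
  have h1 : HasDerivAt (fun y : ℝ => y ^ (1 - 2 * H)) ((1 - 2 * H) * x ^ (1 - 2 * H - 1)) x :=
    Real.hasDerivAt_rpow_const (Or.inl hx.ne')
  have h2 : HasDerivAt (fun y : ℝ => lam ^ 2 + y ^ 2) (2 * x) x := by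
    simpa using (hasDerivAt_pow 2 x).const_add (lam ^ 2)
  have hpos : 0 < lam ^ 2 + x ^ 2 := by positivity
  refine (h1.div h2 hpos.ne').congr_deriv ?_
  rw [ouDensity, Real.rpow_sub_one hx.ne']
  field_simp

/-- The logarithmic derivative times x equals (1 - 2H) - 2x²/(λ²+x²), which lies in [-3, 1]. -/
theorem abs_deriv_ouDensity_mul_le (h0 : 0 < H) (h1 : H < 1) (hlam : 0 < lam) {x : ℝ} (hx : 0 < x) :
    |((1 - 2 * H) / x - 2 * x / (lam ^ 2 + x ^ 2)) * ouDensity H lam x| * x ≤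
      3 * ouDensity H lam x := by
  have hpos : 0 < lam ^ 2 + x ^ 2 := by positivity
  have hψ : 0 ≤ ouDensity H lam x := ouDensity_nonneg hx
  have e : |((1 - 2 * H) / x - 2 * x / (lam ^ 2 + x ^ 2)) * ouDensity H lam x| * x =
      |(1 - 2 * H) - 2 * (x ^ 2 / (lam ^ 2 + x ^ 2))| * ouDensity H lam x := by
    rw [abs_mul, abs_of_nonneg hψ]
    have : |(1 - 2 * H) - 2 * (x ^ 2 / (lam ^ 2 + x ^ 2))| =
        |((1 - 2 * H) / x - 2 * x / (lam ^ 2 + x ^ 2))| * x := by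
      rw [← abs_of_pos hx, ← abs_mul, abs_of_pos hx]
      congr 1; field_simp
    rw [this]; ring
  rw [e]
  refine mul_le_mul_of_nonneg_right ?_ hψ
  have h2 : 0 ≤ x ^ 2 / (lam ^ 2 + x ^ 2) := by positivity
  have h3 : x ^ 2 / (lam ^ 2 + x ^ 2) ≤ 1 := div_le_one_of_le₀ (by nlinarith) hpos.le
  rw [abs_le]; constructor <;> nlinarith

/-- Integration by parts: κu is the derivative of the bounded function U, and the boundary terms
vanish. With U and u trigonometric of frequency κ this gives decay of order 1/|κ|. -/
theorem abs_integral_mul_le_of_deriv {U u f f' b : ℝ → ℝ} {κ : ℝ}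
    (hU : ∀ x, HasDerivAt U (κ * u x) x) (hU1 : ∀ x, |U x| ≤ 1) (hu1 : ∀ x, |u x| ≤ 1)
    (hum : Measurable u)
    (hf : ∀ x ∈ Set.Ioi (0 : ℝ), HasDerivAt f (f' x) x) (hfi : IntegrableOn f (Set.Ioi 0))
    (hf' : AEStronglyMeasurable f' (volume.restrict (Set.Ioi 0)))
    (hb : IntegrableOn b (Set.Ioi 0)) (hfb : ∀ x ∈ Set.Ioi (0 : ℝ), |f' x| ≤ b x)
    (h0 : Tendsto f (𝓝[>] 0) (𝓝 0)) (h1 : Tendsto f atTop (𝓝 0)) :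
    |κ| * |∫ x in Set.Ioi 0, u x * f x| ≤ ∫ x in Set.Ioi 0, b x := by
  have hUm : Measurable U := (continuous_iff_continuousAt.2 fun x => (hU x).continuousAt).measurable
  have hf'i : IntegrableOn f' (Set.Ioi 0) :=
    Integrable.mono' hb hf' ((ae_restrict_iff' measurableSet_Ioi).2 (ae_of_all _ hfb))
  have i1 : IntegrableOn (fun x => U x * f' x) (Set.Ioi 0) :=
    Integrable.bdd_mul (c := 1) hf'i hUm.aestronglyMeasurable (ae_of_all _ hU1)
  have i2 : IntegrableOn (fun x => u x * f x) (Set.Ioi 0) :=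
    Integrable.bdd_mul (c := 1) hfi hum.aestronglyMeasurable (ae_of_all _ hu1)
  have i3 : IntegrableOn (fun x => (κ * u x) * f x) (Set.Ioi 0) := by
    simp only [mul_assoc]
    exact i2.const_mul κ
  have b0 : ∀ {l : Filter ℝ}, Tendsto f l (𝓝 0) → Tendsto (U * f) l (𝓝 0) := by
    intro l hl
    refine squeeze_zero_norm (fun x => ?_) (tendsto_zero_iff_norm_tendsto_zero.1 hl)
    rw [Pi.mul_apply, norm_mul]
    exact mul_le_of_le_one_left (norm_nonneg _) (hU1 x)
  have h := integral_Ioi_mul_deriv_eq_deriv_mul (u := U) (v := f) (u' := fun x => κ * u x) (v' := f')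
    (a := 0) (fun x _ => hU x) hf i1 i3 (b0 h0) (b0 h1)
  have h2 : κ * ∫ x in Set.Ioi 0, u x * f x = - ∫ x in Set.Ioi 0, U x * f' x := by
    rw [h, ← integral_const_mul]
    simp only [mul_assoc]
    ring
  rw [← abs_mul, h2, abs_neg]
  refine (norm_integral_le_integral_norm (fun x => U x * f' x)).trans
    (setIntegral_mono_on i1.norm hb measurableSet_Ioi fun x hx => ?_)
  rw [norm_mul]
  exact (mul_le_of_le_one_left (norm_nonneg _) (hU1 x)).trans (hfb x hx)

/-- The density itself may be singular at 0 with a non-integrable derivative. The factor P repairs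
this: P(0) = 0 and |P'| ≤ C give |P(x)| ≤ Cx, hence |Pψ'| ≤ 3Cψ, while |P'ψ| ≤ Cψ. It also makes the
boundary term at 0 of order x^(2-2H). -/
theorem abs_integral_mul_ouDensity_le (h0 : 0 < H) (h1 : H < 1) (hlam : 0 < lam)
    {U u P P' : ℝ → ℝ} {κ C : ℝ}
    (hU : ∀ x, HasDerivAt U (κ * u x) x) (hU1 : ∀ x, |U x| ≤ 1) (hu1 : ∀ x, |u x| ≤ 1)
    (hum : Measurable u) (hP : ∀ x, HasDerivAt P (P' x) x) (hP'm : Measurable P')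
    (hP' : ∀ x, |P' x| ≤ C) (hPC : ∀ x, |P x| ≤ C) (hP0 : P 0 = 0) :
    |κ| * |∫ x in Set.Ioi 0, u x * (P x * ouDensity H lam x)| ≤
      4 * C * ∫ x in Set.Ioi 0, ouDensity H lam x := by
  have hψ := integrableOn_ouDensity h0 h1 hlam
  have hψm := measurable_ouDensity (H := H) (lam := lam)
  have hPm : Measurable P := (continuous_iff_continuousAt.2 fun x => (hP x).continuousAt).measurable
  have hC : 0 ≤ C := (abs_nonneg _).trans (hPC 0)
  have hPx : ∀ x, 0 < x → |P x| ≤ C * x := by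
    intro x hx
    have := Convex.norm_image_sub_le_of_norm_hasDerivWithin_le (f := P) (f' := P') (C := C)
      (s := Set.univ) (x := 0) (y := x) (fun y _ => (hP y).hasDerivWithinAt) (fun y _ => hP' y)
      convex_univ (Set.mem_univ _) (Set.mem_univ _)
    simpa [hP0, abs_of_pos hx] using this
  rw [← integral_const_mul]
  refine abs_integral_mul_le_of_deriv hU hU1 hu1 hum
    (f := fun x => P x * ouDensity H lam x)
    (f' := fun x => P' x * ouDensity H lam x +
      P x * (((1 - 2 * H) / x - 2 * x / (lam ^ 2 + x ^ 2)) * ouDensity H lam x))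
    (fun x hx => (hP x).mul (hasDerivAt_ouDensity hlam hx)) ?_ ?_ (hψ.const_mul (4 * C)) ?_ ?_ ?_
  · exact Integrable.bdd_mul (c := C) hψ hPm.aestronglyMeasurable (ae_of_all _ hPC)
  · exact Measurable.aestronglyMeasurable (by fun_prop)
  · intro x hx
    have hx0 : (0 : ℝ) < x := hx
    have hψ0 : 0 ≤ ouDensity H lam x := ouDensity_nonneg hx
    refine (abs_add_le _ _).trans ?_
    rw [abs_mul, abs_mul (P x), abs_of_nonneg hψ0]
    have e1 := mul_le_mul_of_nonneg_right (hP' x) hψ0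
    have e2 := mul_le_mul_of_nonneg_right (hPx x hx)
      (abs_nonneg (((1 - 2 * H) / x - 2 * x / (lam ^ 2 + x ^ 2)) * ouDensity H lam x))
    have e3 := mul_le_mul_of_nonneg_left (abs_deriv_ouDensity_mul_le h0 h1 hlam hx0) hC
    nlinarith
  · have ht : Tendsto (fun x : ℝ => C / lam ^ 2 * x ^ (2 - 2 * H)) (𝓝[>] 0) (𝓝 0) := by
      have : ContinuousAt (fun x : ℝ => x ^ (2 - 2 * H)) 0 :=
        Real.continuousAt_rpow_const _ _ (Or.inr (by linarith))
      have h2 := (this.tendsto.mono_left (nhdsWithin_le_nhds (s := Set.Ioi 0))).const_mul (C / lam ^ 2)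
      rwa [Real.zero_rpow (by linarith), mul_zero] at h2
    refine squeeze_zero_norm' ?_ ht
    filter_upwards [self_mem_nhdsWithin] with x hx
    have hx0 : (0 : ℝ) < x := hx
    rw [norm_mul, Real.norm_eq_abs, Real.norm_of_nonneg (ouDensity_nonneg hx), ouDensity,
      show 2 - 2 * H = 1 + (1 - 2 * H) by ring, Real.rpow_add hx0, Real.rpow_one]
    have hr := Real.rpow_nonneg hx0.le (1 - 2 * H)
    calc |P x| * (x ^ (1 - 2 * H) / (lam ^ 2 + x ^ 2))
        ≤ C * x * (x ^ (1 - 2 * H) / lam ^ 2) := by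
          refine mul_le_mul (hPx x hx) ?_ (by positivity) (by positivity)
          exact div_le_div_of_nonneg_left hr (by positivity) (by nlinarith)
      _ = _ := by ring
  · have ht : Tendsto (fun x : ℝ => C * x ^ (-1 - 2 * H)) atTop (𝓝 0) := by
      have := (tendsto_rpow_neg_atTop (y := 1 + 2 * H) (by linarith)).const_mul C
      rw [mul_zero] at this
      refine this.congr fun x => ?_
      congr 2; ring
    refine squeeze_zero_norm' ?_ ht
    filter_upwards [eventually_gt_atTop 0] with x hx
    have hr := Real.rpow_nonneg hx.le (-1 - 2 * H)
    rw [norm_mul, Real.norm_eq_abs, Real.norm_of_nonneg (ouDensity_nonneg hx), ouDensity_eq hx]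
    refine mul_le_mul (hPC x) (mul_le_of_le_one_left hr ?_)
      (mul_nonneg (by positivity) hr) hC
    exact div_le_one_of_le₀ (by nlinarith [sq_nonneg lam]) (by positivity)

theorem rho_eq (θ : EuclideanSpace ℝ (Fin 3)) (t : ℝ) :
    rho θ t = 2 * (θ 2) ^ 2 * cH (θ 0) *
      ∫ x in Set.Ioi (0 : ℝ), Real.cos (t * x) * ouDensity (θ 0) (θ 1) x := rfl

theorem integrableOn_cos_mul_ouDensity (h0 : 0 < H) (h1 : H < 1) (hlam : 0 < lam) (t : ℝ) :
    IntegrableOn (fun x => Real.cos (t * x) * ouDensity H lam x) (Set.Ioi 0) :=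
  Integrable.bdd_mul (c := 1) (integrableOn_ouDensity h0 h1 hlam)
    (Measurable.aestronglyMeasurable (by fun_prop)) (ae_of_all _ fun x => Real.abs_cos_le_one _)

theorem hasDerivAt_cos_mul (β x : ℝ) :
    HasDerivAt (fun x => Real.cos (β * x)) (-(β * Real.sin (β * x))) x := by
  have := (Real.hasDerivAt_cos (β * x)).comp x ((hasDerivAt_id x).const_mul β)
  refine this.congr_deriv ?_
  simp; ring

theorem hasDerivAt_sin_mul (β x : ℝ) :
    HasDerivAt (fun x => Real.sin (β * x)) (β * Real.cos (β * x)) x := by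
  have := (Real.hasDerivAt_sin (β * x)).comp x ((hasDerivAt_id x).const_mul β)
  refine this.congr_deriv ?_
  simp; ring

theorem abs_sum_mul_le {κ : Type*} [Fintype κ] (w v β : κ → ℝ) (hv : ∀ k, |v k| ≤ 1 + |β k|) :
    |∑ k, w k * v k| ≤ ∑ k, |w k| * (1 + |β k|) :=
  (Finset.abs_sum_le_sum_abs _ _).trans (Finset.sum_le_sum fun k _ => by
    rw [abs_mul]; exact mul_le_mul_of_nonneg_left (hv k) (abs_nonneg _))

/-- A linear combination of translates of `rho θ` with coefficients summing to zero decays. -/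
theorem exists_abs_sum_rho_le {θ : EuclideanSpace ℝ (Fin 3)} (h0 : 0 < θ 0) (h1 : θ 0 < 1)
    (hlam : 0 < θ 1) {κ : Type*} [Fintype κ] (w β : κ → ℝ) (hw : ∑ k, w k = 0) :
    ∃ K, ∀ s : ℝ, |s| * |∑ k, w k * rho θ (s + β k)| ≤ K := by
  set C := ∑ k, |w k| * (1 + |β k|) with hC
  set A := 4 * C * ∫ x in Set.Ioi 0, ouDensity (θ 0) (θ 1) x with hA
  set D := 2 * (θ 2) ^ 2 * cH (θ 0) with hD
  refine ⟨|D| * (A + A), fun s => ?_⟩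
  -- Expanding cos((s+β)x) gives cos(sx) P(x) - sin(sx) S(x) as integrand. P vanishes at 0 because
  -- the weights sum to 0, and S because sin 0 = 0.
  set P : ℝ → ℝ := fun x => ∑ k, w k * Real.cos (β k * x) with hP
  set S : ℝ → ℝ := fun x => ∑ k, w k * Real.sin (β k * x) with hS
  have hcosle : ∀ k x, |Real.cos (β k * x)| ≤ 1 + |β k| := fun k x =>
    (Real.abs_cos_le_one _).trans (by linarith [abs_nonneg (β k)])
  have hsinle : ∀ k x, |Real.sin (β k * x)| ≤ 1 + |β k| := fun k x =>
    (Real.abs_sin_le_one _).trans (by linarith [abs_nonneg (β k)])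
  have hdcos : ∀ k x, |β k * Real.cos (β k * x)| ≤ 1 + |β k| := fun k x => by
    rw [abs_mul]
    nlinarith [Real.abs_cos_le_one (β k * x), abs_nonneg (β k), abs_nonneg (Real.cos (β k * x))]
  have hdsin : ∀ k x, |-(β k * Real.sin (β k * x))| ≤ 1 + |β k| := fun k x => by
    rw [abs_neg, abs_mul]
    nlinarith [Real.abs_sin_le_one (β k * x), abs_nonneg (β k), abs_nonneg (Real.sin (β k * x))]
  have I1 := abs_integral_mul_ouDensity_le h0 h1 hlam (U := fun x => Real.sin (s * x))
    (u := fun x => Real.cos (s * x)) (P := P) (P' := fun x => ∑ k, w k * -(β k * Real.sin (β k * x)))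
    (κ := s) (C := C) (hasDerivAt_sin_mul s) (fun x => Real.abs_sin_le_one _)
    (fun x => Real.abs_cos_le_one _) (by fun_prop)
    (fun x => HasDerivAt.fun_sum fun k _ => (hasDerivAt_cos_mul (β k) x).const_mul (w k))
    (by fun_prop) (fun x => abs_sum_mul_le _ _ _ fun k => hdsin k x)
    (fun x => abs_sum_mul_le _ _ _ fun k => hcosle k x) (by simp [hP, hw])
  have I2 := abs_integral_mul_ouDensity_le h0 h1 hlam (U := fun x => -Real.cos (s * x))
    (u := fun x => Real.sin (s * x)) (P := S) (P' := fun x => ∑ k, w k * (β k * Real.cos (β k * x)))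
    (κ := s) (C := C) (fun x => (hasDerivAt_cos_mul s x).neg.congr_deriv (by ring))
    (fun x => by rw [abs_neg]; exact Real.abs_cos_le_one _)
    (fun x => Real.abs_sin_le_one _) (by fun_prop)
    (fun x => HasDerivAt.fun_sum fun k _ => (hasDerivAt_sin_mul (β k) x).const_mul (w k))
    (by fun_prop) (fun x => abs_sum_mul_le _ _ _ fun k => hdcos k x)
    (fun x => abs_sum_mul_le _ _ _ fun k => hsinle k x) (by simp [hS])
  have hψ := integrableOn_ouDensity h0 h1 hlam
  have hPi : IntegrableOn (fun x => P x * ouDensity (θ 0) (θ 1) x) (Set.Ioi 0) :=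
    Integrable.bdd_mul (c := C) hψ (Measurable.aestronglyMeasurable (by fun_prop))
      (ae_of_all _ fun x => abs_sum_mul_le _ _ _ fun k => hcosle k x)
  have hSi : IntegrableOn (fun x => S x * ouDensity (θ 0) (θ 1) x) (Set.Ioi 0) :=
    Integrable.bdd_mul (c := C) hψ (Measurable.aestronglyMeasurable (by fun_prop))
      (ae_of_all _ fun x => abs_sum_mul_le _ _ _ fun k => hsinle k x)
  have i1 : IntegrableOn (fun x => Real.cos (s * x) * (P x * ouDensity (θ 0) (θ 1) x)) (Set.Ioi 0) :=
    Integrable.bdd_mul (c := 1) hPi (Measurable.aestronglyMeasurable (by fun_prop))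
      (ae_of_all _ fun x => Real.abs_cos_le_one _)
  have i2 : IntegrableOn (fun x => Real.sin (s * x) * (S x * ouDensity (θ 0) (θ 1) x)) (Set.Ioi 0) :=
    Integrable.bdd_mul (c := 1) hSi (Measurable.aestronglyMeasurable (by fun_prop))
      (ae_of_all _ fun x => Real.abs_sin_le_one _)
  have e : ∑ k, w k * rho θ (s + β k) = D *
      ((∫ x in Set.Ioi 0, Real.cos (s * x) * (P x * ouDensity (θ 0) (θ 1) x)) -
        ∫ x in Set.Ioi 0, Real.sin (s * x) * (S x * ouDensity (θ 0) (θ 1) x)) := by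
    rw [← integral_sub i1 i2]
    have e1 : ∀ x, Real.cos (s * x) * (P x * ouDensity (θ 0) (θ 1) x) -
        Real.sin (s * x) * (S x * ouDensity (θ 0) (θ 1) x) =
        ∑ k, w k * (Real.cos ((s + β k) * x) * ouDensity (θ 0) (θ 1) x) := by
      intro x
      simp only [hP, hS, Finset.sum_mul, Finset.mul_sum, ← Finset.sum_sub_distrib]
      refine Finset.sum_congr rfl fun k _ => ?_
      rw [add_mul, Real.cos_add]; ring
    simp_rw [e1]
    rw [integral_finsetSum _ fun k _ =>
      (integrableOn_cos_mul_ouDensity h0 h1 hlam (s + β k)).const_mul _, Finset.mul_sum]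
    refine Finset.sum_congr rfl fun k _ => ?_
    rw [rho_eq, integral_const_mul]; ring
  rw [e, abs_mul, mul_left_comm]
  refine mul_le_mul_of_nonneg_left ?_ (abs_nonneg _)
  calc _ ≤ |s| * (|∫ x in Set.Ioi 0, Real.cos (s * x) * (P x * ouDensity (θ 0) (θ 1) x)| +
        |∫ x in Set.Ioi 0, Real.sin (s * x) * (S x * ouDensity (θ 0) (θ 1) x)|) :=
        mul_le_mul_of_nonneg_left (abs_sub _ _) (abs_nonneg _)
    _ ≤ _ := by rw [mul_add]; exact add_le_add I1 I2

/-- The coefficients a_{i,q} a_{j,q'} sum to 0 as soon as one of the two filters does, so the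
covariances are O(1/|k|), whatever the value of H in (0,1). -/
theorem summable_crossCov_sq {L : ℕ} {a : Fin L → Fin (L + 1) → ℝ} {α : ℝ} (hα : 0 < α)
    {θ : EuclideanSpace ℝ (Fin 3)} (h0 : 0 < θ 0) (h1 : θ 0 < 1) (hlam : 0 < θ 1)
    {i j : Fin L} (ha : ∑ q, a i q = 0) :
    Summable fun k : ℤ => crossCov a α θ i j k ^ 2 := by
  obtain ⟨K, hK⟩ := exists_abs_sum_rho_le h0 h1 hlam
    (fun p : Fin (L + 1) × Fin (L + 1) => a i p.1 * a j p.2)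
    (fun p => α * (((p.2 : ℕ) : ℝ) - ((p.1 : ℕ) : ℝ)))
    (by rw [Fintype.sum_prod_type, ← Finset.sum_mul_sum, ha, zero_mul])
  have hs : Summable fun k : ℤ => (K / α) ^ 2 * (1 / (k : ℝ) ^ 2) :=
    (Real.summable_one_div_int_pow.2 (by norm_num)).mul_left _
  refine Summable.of_norm_bounded_eventually hs ?_
  have hfin : ({0} : Set ℤ).Finite := Set.finite_singleton 0
  filter_upwards [hfin.compl_mem_cofinite] with k hk
  have hk0 : (k : ℝ) ≠ 0 := by exact_mod_cast hk
  have hkpos : 0 < |(k : ℝ)| := abs_pos.2 hk0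
  have h := hK (α * k)
  rw [Fintype.sum_prod_type] at h
  have e : ∑ x, ∑ y, a i x * a j y * rho θ (α * k + α * (((y : ℕ) : ℝ) - ((x : ℕ) : ℝ))) =
      crossCov a α θ i j k := by
    unfold crossCov
    refine Finset.sum_congr rfl fun m _ => Finset.sum_congr rfl fun j _ => ?_
    congr 2; ring
  simp only at h
  rw [e, abs_mul, abs_of_pos hα] at h
  have h2 : |crossCov a α θ i j k| ≤ K / α / |(k : ℝ)| := by
    rw [le_div_iff₀ hkpos, le_div_iff₀ hα]; linarith
  rw [Real.norm_of_nonneg (sq_nonneg _), ← sq_abs]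
  refine (pow_le_pow_left₀ (abs_nonneg _) h2 2).trans_eq ?_
  rw [div_pow _ |(k : ℝ)|, sq_abs]; ring

end


section

/-! ### Sums of a stationary array -/

theorem sum_fin_sub_le_tsum {f : ℤ → ℝ} (hf : Summable f) (h0 : ∀ k, 0 ≤ f k) (n : ℕ) (i : ℤ) :
    ∑ j : Fin n, f (i - (j : ℤ)) ≤ ∑' k, f k := by
  have hinj : Function.Injective fun j : Fin n => i - (j : ℤ) := fun a b h => by
    simp only [sub_right_inj, Nat.cast_inj] at h
    exact Fin.ext h
  rw [← Finset.sum_image (s := Finset.univ) (f := f) (g := fun j : Fin n => i - (j : ℤ))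
    (fun a _ b _ h => hinj h)]
  exact hf.sum_le_tsum _ fun k _ => h0 k

theorem sum_sum_fin_sub_le {f : ℤ → ℝ} (hf : Summable f) (h0 : ∀ k, 0 ≤ f k) (n : ℕ) :
    ∑ i : Fin n, ∑ j : Fin n, f ((i : ℤ) - (j : ℤ)) ≤ n * ∑' k, f k := by
  refine (Finset.sum_le_sum fun (i : Fin n) _ =>
    sum_fin_sub_le_tsum hf h0 n ((i : ℕ) : ℤ)).trans_eq ?_
  simp

/-- The row sums of a square summable Toeplitz array of size `n` are `o(√n)`. -/
theorem eventually_sum_abs_le_mul_sqrt {r : ℤ → ℝ} (hr : Summable fun k => r k ^ 2) {ε : ℝ}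
    (hε : 0 < ε) :
    ∀ᶠ n : ℕ in atTop, ∀ i : ℤ, ∑ j : Fin n, |r (i - (j : ℤ))| ≤ ε * √n := by
  -- Split off a finite set F outside which the squares sum to less than (ε/2)². The part on F has
  -- bounded row sums; Cauchy-Schwarz bounds the rest by (ε/2)√n.
  obtain ⟨F, hF⟩ := (Metric.tendsto_atTop.1 (tendsto_tsum_compl_atTop_zero fun k => r k ^ 2))
    ((ε / 2) ^ 2) (by positivity)
  have hF := hF F le_rfl
  rw [Real.dist_eq, sub_zero] at hF
  set τ := ∑' k : {x // x ∉ F}, r k ^ 2 with hτ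
  have hτε : τ ≤ (ε / 2) ^ 2 := (le_abs_self _).trans hF.le
  set f1 : ℤ → ℝ := fun k => if k ∈ F then |r k| else 0 with hf1
  set f2 : ℤ → ℝ := fun k => if k ∈ F then 0 else |r k| with hf2
  have hs1 : Summable f1 := summable_of_ne_finset_zero (s := F) fun k hk => by simp [hf1, hk]
  have e2 : (fun k => f2 k ^ 2) = Set.indicator {x | x ∉ F} fun k => r k ^ 2 := by
    ext k
    by_cases h : k ∈ F <;> simp [hf2, h, Set.indicator]
  have hs2 : Summable fun k => f2 k ^ 2 := by
    rw [e2]; exact hr.indicator _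
  have ht2 : ∑' k, f2 k ^ 2 = τ := by
    rw [e2, hτ]
    exact (tsum_subtype {x | x ∉ F} fun k => r k ^ 2).symm
  have hlim : Tendsto (fun n : ℕ => √(n : ℝ)) atTop atTop :=
    Real.tendsto_sqrt_atTop.comp tendsto_natCast_atTop_atTop
  filter_upwards [hlim.eventually_ge_atTop ((∑' k, f1 k) / (ε / 2))] with n hn i
  rw [div_le_iff₀ (by positivity)] at hn
  have hsplit : ∀ k, |r k| = f1 k + f2 k := fun k => by
    by_cases h : k ∈ F <;> simp [hf1, hf2, h]
  simp_rw [hsplit, Finset.sum_add_distrib]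
  have b1 := sum_fin_sub_le_tsum hs1 (fun k => by simp only [hf1]; split_ifs <;> positivity) n i
  have b2 : ∑ j : Fin n, f2 (i - (j : ℤ)) ≤ ε / 2 * √n := by
    refine le_of_sq_le_sq ?_ (by positivity)
    calc (∑ j : Fin n, f2 (i - (j : ℤ))) ^ 2
        ≤ (Finset.univ : Finset (Fin n)).card * ∑ j : Fin n, f2 (i - (j : ℤ)) ^ 2 :=
          sq_sum_le_card_mul_sum_sq
      _ ≤ n * τ := by
          rw [Finset.card_univ, Fintype.card_fin]
          refine mul_le_mul_of_nonneg_left ?_ (Nat.cast_nonneg n)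
          rw [← ht2]
          exact sum_fin_sub_le_tsum hs2 (fun k => sq_nonneg _) n i
      _ ≤ n * (ε / 2) ^ 2 := by gcongr
      _ = (ε / 2 * √n) ^ 2 := by rw [mul_pow, Real.sq_sqrt (Nat.cast_nonneg n)]; ring
  linarith

/-- The difference k occurs c times with n - |k| ≤ c ≤ n, so after division by n its weight tends to
1 and stays at most 1; dominated convergence for series applies. -/
theorem tendsto_sum_sum_fin_sub_div {f : ℤ → ℝ} (hf : Summable f) :
    Tendsto (fun n : ℕ => (∑ i : Fin n, ∑ j : Fin n, f ((i : ℤ) - (j : ℤ))) / n) atTop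
      (𝓝 (∑' k, f k)) := by
  classical
  set c : ℕ → ℤ → ℕ := fun n k =>
    ((Finset.univ : Finset (Fin n × Fin n)).filter fun p => (p.1 : ℤ) - (p.2 : ℤ) = k).card with hc
  have hcn : ∀ n k, c n k ≤ n := by
    intro n k
    have : c n k ≤ (Finset.univ : Finset (Fin n)).card := by
      refine Finset.card_le_card_of_injOn Prod.fst (fun _ _ => Finset.mem_univ _) ?_
      intro p hp q hq h
      simp only [Finset.coe_filter, Finset.mem_univ, true_and, Set.mem_ofPred_eq] at hp hq
      refine Prod.ext h (Fin.ext ?_)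
      rw [h] at hp
      omega
    simpa using this
  have hck : ∀ (n : ℕ) (k : ℤ), (n : ℤ) - |k| ≤ c n k := by
    intro n k
    have : (Finset.range (n - k.natAbs)).card ≤ c n k := by
      -- A pair with difference k is found from its smaller entry j, which may be any number below n
      -- - |k|.
      refine Finset.card_le_card_of_surjOn (fun p : Fin n × Fin n => min (p.1 : ℕ) p.2) ?_
      intro j hj
      simp only [Finset.coe_range, Set.mem_Iio] at hj
      refine ⟨(⟨j + k.toNat, by omega⟩, ⟨j + (-k).toNat, by omega⟩), ?_, ?_⟩
      · simp only [Finset.coe_filter, Finset.mem_univ, true_and, Set.mem_ofPred_eq]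
        push_cast
        omega
      · simp only; omega
    rw [Finset.card_range] at this
    rw [Int.abs_eq_natAbs]
    omega
  have key : ∀ n : ℕ, (∑ i : Fin n, ∑ j : Fin n, f ((i : ℤ) - (j : ℤ))) / n =
      ∑' k, (c n k / n : ℝ) * f k := by
    intro n
    have h1 := Finset.sum_comp (s := (Finset.univ : Finset (Fin n × Fin n))) f
      (fun p => (p.1 : ℤ) - (p.2 : ℤ))
    rw [← Fintype.sum_prod_type' (fun i j : Fin n => f ((i : ℤ) - (j : ℤ))), h1,
      tsum_eq_sum (s := Finset.univ.image fun p : Fin n × Fin n => (p.1 : ℤ) - (p.2 : ℤ)),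
      Finset.sum_div]
    · refine Finset.sum_congr rfl fun k _ => ?_
      rw [nsmul_eq_mul]; ring
    · intro k hk
      have : c n k = 0 := by
        rw [hc, Finset.card_eq_zero, Finset.filter_eq_empty_iff]
        intro p _ hp
        exact hk (Finset.mem_image.2 ⟨p, Finset.mem_univ _, hp⟩)
      simp [this]
  simp_rw [key]
  refine tendsto_tsum_of_dominated_convergence (bound := fun k => |f k|) hf.abs (fun k => ?_)
    (Eventually.of_forall fun n k => ?_)
  · have hlim : Tendsto (fun n : ℕ => (c n k / n : ℝ)) atTop (𝓝 1) := by
      have hl : Tendsto (fun n : ℕ => 1 - |(k : ℝ)| / n) atTop (𝓝 1) := by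
        simpa using (tendsto_const_div_atTop_nhds_zero_nat |(k : ℝ)|).const_sub 1
      refine tendsto_of_tendsto_of_tendsto_of_le_of_le' hl tendsto_const_nhds ?_ ?_
      · filter_upwards [eventually_gt_atTop 0] with n hn
        have hn0 : (0 : ℝ) < n := by exact_mod_cast hn
        have : ((n : ℝ) - |(k : ℝ)|) ≤ c n k := by exact_mod_cast hck n k
        rw [le_div_iff₀ hn0, sub_mul, div_mul_cancel₀ _ hn0.ne']
        linarith
      · exact Eventually.of_forall fun n =>
          div_le_one_of_le₀ (by exact_mod_cast hcn n k) (Nat.cast_nonneg n)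
    simpa using hlim.mul_const (f k)
  · rw [norm_mul, Real.norm_eq_abs (f k)]
    refine mul_le_of_le_one_left (abs_nonneg _) ?_
    rw [Real.norm_of_nonneg (by positivity)]
    exact div_le_one_of_le₀ (by exact_mod_cast hcn n k) (Nat.cast_nonneg n)

/-! ### Law of large numbers -/

section

variable {Ω : Type*} [MeasurableSpace Ω] {μ : Measure Ω}

/-- By Tonelli the series of the f n has finite expectation, so it converges almost surely and its
terms tend to 0. -/
theorem ae_tendsto_zero_of_summable_integral {f : ℕ → Ω → ℝ} (hf : ∀ n, Integrable (f n) μ)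
    (h0 : ∀ n ω, 0 ≤ f n ω) (hs : Summable fun n => ∫ ω, f n ω ∂μ) :
    ∀ᵐ ω ∂μ, Tendsto (fun n => f n ω) atTop (𝓝 0) := by
  have h1 : ∫⁻ ω, ∑' n, ENNReal.ofReal (f n ω) ∂μ ≠ ⊤ := by
    rw [lintegral_tsum fun n => (hf n).aemeasurable.ennreal_ofReal]
    simp_rw [← ofReal_integral_eq_lintegral_ofReal (hf _) (ae_of_all _ (h0 _))]
    exact hs.tsum_ofReal_ne_top
  have h2 := ae_lt_top' (AEMeasurable.tsum fun n => (hf n).aemeasurable.ennreal_ofReal) h1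
  filter_upwards [h2] with ω hω
  have h3 := ENNReal.tendsto_atTop_zero_of_tsum_ne_top hω.ne
  have h4 := (ENNReal.tendsto_toReal ENNReal.zero_ne_top).comp h3
  refine h4.congr fun n => ?_
  simp [ENNReal.toReal_ofReal (h0 n ω)]

/-- A strong law for sums of nonnegative variables whose variances grow at most linearly. -/
theorem ae_tendsto_div_of_integral_sq_le {u : ℕ → Ω → ℝ} (hu : ∀ n ω, 0 ≤ u n ω) {V T : ℝ}
    (hi : ∀ n, Integrable (fun ω => (∑ i ∈ Finset.range n, (u i ω - V)) ^ 2) μ)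
    (hT : ∀ n : ℕ, ∫ ω, (∑ i ∈ Finset.range n, (u i ω - V)) ^ 2 ∂μ ≤ T * n) :
    ∀ᵐ ω ∂μ, Tendsto (fun n : ℕ => (∑ i ∈ Finset.range n, u i ω) / n) atTop (𝓝 V) := by
  -- Along the squares n² the mean square error of the average is at most T/n², which is summable.
  have h1 := ae_tendsto_zero_of_summable_integral
    (f := fun n ω => ((∑ i ∈ Finset.range (n ^ 2), (u i ω - V)) / (n ^ 2 : ℕ)) ^ 2) (μ := μ)
    (fun n => by
      simp_rw [div_pow]
      exact (hi (n ^ 2)).div_const _) (fun n ω => sq_nonneg _) (by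
      refine Summable.of_nonneg_of_le (fun n => integral_nonneg fun ω => sq_nonneg _) (fun n => ?_)
        ((Real.summable_one_div_nat_pow.2 one_lt_two).mul_left T)
      simp_rw [div_pow]
      rw [integral_div]
      rcases Nat.eq_zero_or_pos n with rfl | hn
      · simp
      · have hn0 : (0 : ℝ) < n := by exact_mod_cast hn
        rw [div_le_iff₀ (by positivity)]
        refine (hT (n ^ 2)).trans_eq ?_
        push_cast
        field_simp)
  filter_upwards [h1] with ω hω
  -- Nonnegative terms make the partial sums monotone, so they can be interpolated between
  -- consecutive squares, whose ratio tends to 1.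
  refine tendsto_div_of_monotone_of_exists_subseq_tendsto_div _ V ?_ fun a ha => ?_
  · intro m n hmn
    exact Finset.sum_le_sum_of_subset_of_nonneg (Finset.range_mono hmn) fun i _ _ => hu i ω
  · refine ⟨fun n => n ^ 2, ?_, tendsto_pow_atTop two_ne_zero, ?_⟩
    · have hl : Tendsto (fun n : ℕ => (1 + 1 / (n : ℝ)) ^ 2) atTop (𝓝 ((1 + 0) ^ 2)) :=
        (tendsto_one_div_atTop_nhds_zero_nat.const_add 1).pow 2
      filter_upwards [hl.eventually_le_const (u := a) (by simpa using ha), eventually_gt_atTop 0]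
        with n hn hn0
      have hn0 : (0 : ℝ) < n := by exact_mod_cast hn0
      push_cast
      calc ((n : ℝ) + 1) ^ 2 = (1 + 1 / (n : ℝ)) ^ 2 * n ^ 2 := by field_simp
        _ ≤ a * n ^ 2 := by gcongr
    · have h2 : Tendsto (fun n : ℕ => (∑ i ∈ Finset.range (n ^ 2), (u i ω - V)) / (n ^ 2 : ℕ)) atTop
          (𝓝 0) := by
        rw [tendsto_zero_iff_abs_tendsto_zero]
        have := hω.sqrt
        simp_rw [Real.sqrt_sq_eq_abs, Real.sqrt_zero] at this
        exact this
      have h3 := h2.add_const V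
      rw [zero_add] at h3
      refine h3.congr' ?_
      filter_upwards [eventually_gt_atTop 0] with n hn
      have hn0 : ((n ^ 2 : ℕ) : ℝ) ≠ 0 := by positivity
      rw [Finset.sum_sub_distrib]
      simp only [Finset.sum_const, Finset.card_range, nsmul_eq_mul]
      field_simp
      ring

theorem IsCenteredGaussian.comp {T S : Type*} {X : T → Ω → ℝ} {R : T → T → ℝ}
    (hX : IsCenteredGaussian X R μ) (f : S → T) :
    IsCenteredGaussian (fun s => X (f s)) (fun s s' => R (f s) (f s')) μ :=
  ⟨fun _ => hX.aemeasurable _, fun n c t => hX.integral_cexp n c (f ∘ t)⟩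

variable {L : ℕ} {a : Fin L → Fin (L + 1) → ℝ} {α : ℝ} {θ : EuclideanSpace ℝ (Fin 3)}
  {X : ℝ → Ω → ℝ}

theorem IsCenteredGaussian.filtered (hX : IsCenteredGaussian X (fun s t => rho θ (s - t)) μ)
    (a : Fin L → Fin (L + 1) → ℝ) (α : ℝ) :
    IsCenteredGaussian (fun (p : Fin L × ℕ) ω => filtered (a p.1) α (fun t => X t ω) (p.2 * α))
      (fun p q => crossCov a α θ p.1 q.1 ((p.2 : ℤ) - (q.2 : ℤ))) μ := by
  have h := hX.linear_combination (fun p : Fin L × ℕ => a p.1)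
    (fun p q => p.2 * α - α * ((q : ℕ) : ℝ))
  convert h using 3 with p q
  · rfl
  · unfold crossCov
    refine Finset.sum_congr rfl fun m _ => Finset.sum_congr rfl fun j _ => ?_
    congr 2
    push_cast
    ring

theorem isSymm_crossCov (a : Fin L → Fin (L + 1) → ℝ) (α : ℝ)
    (θ : EuclideanSpace ℝ (Fin 3)) {ι : Type*} (f : ι → Fin L × ℕ) :
    Matrix.IsSymm (fun p q : ι => crossCov a α θ (f p).1 (f q).1 (((f p).2 : ℤ) - ((f q).2 : ℤ))) := by
  refine Matrix.ext fun p q => ?_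
  change crossCov a α θ (f q).1 (f p).1 _ = crossCov a α θ (f p).1 (f q).1 _
  rw [← crossCov_neg, neg_sub]

variable [IsProbabilityMeasure μ]

/-- The mean square is twice the double sum of squared covariances, and each of the n rows is at
most the full series over ℤ. This linear growth serves both the strong law and tightness. -/
theorem integral_sum_filtered_sq_sub (hX : IsCenteredGaussian X (fun s t => rho θ (s - t)) μ)
    {ℓ : Fin L} (hs : Summable fun k : ℤ => crossCov a α θ ℓ ℓ k ^ 2) (m n : ℕ) :
    Integrable (fun ω => (∑ i ∈ Finset.range n,
      (filtered (a ℓ) α (fun t => X t ω) ((m + i : ℕ) * α) ^ 2 - V (a ℓ) α θ)) ^ 2) μ ∧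
    ∫ ω, (∑ i ∈ Finset.range n,
      (filtered (a ℓ) α (fun t => X t ω) ((m + i : ℕ) * α) ^ 2 - V (a ℓ) α θ)) ^ 2 ∂μ ≤
      2 * (∑' k : ℤ, crossCov a α θ ℓ ℓ k ^ 2) * n := by
  set f : Fin n → Fin L × ℕ := fun i => (ℓ, m + i) with hf
  have h := ((hX.filtered a α).comp f).integral_quadratic_sq (isSymm_crossCov a α θ f)
    (fun _ => 1)
  simp only [one_mul, hf, sub_self, crossCov_zero] at h
  simp_rw [← Fin.sum_univ_eq_sum_range (fun i =>
      filtered (a ℓ) α (fun t => X t _) ((m + i : ℕ) * α) ^ 2 - V (a ℓ) α θ)]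
  refine ⟨h.1, h.2.trans_le ?_⟩
  have := sum_sum_fin_sub_le hs (fun k => sq_nonneg _) n
  rw [mul_assoc, mul_comm _ (n : ℝ)]
  refine mul_le_mul_of_nonneg_left (le_of_eq_of_le ?_ this) zero_le_two
  refine Finset.sum_congr rfl fun i _ => Finset.sum_congr rfl fun j _ => ?_
  congr 2; push_cast; ring

theorem ae_tendsto_mean_filtered_sq (hX : IsCenteredGaussian X (fun s t => rho θ (s - t)) μ)
    {ℓ : Fin L} (hs : Summable fun k : ℤ => crossCov a α θ ℓ ℓ k ^ 2) (m : ℕ) :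
    ∀ᵐ ω ∂μ, Tendsto (fun n : ℕ => (∑ i ∈ Finset.range n,
      filtered (a ℓ) α (fun t => X t ω) ((m + i : ℕ) * α) ^ 2) / n) atTop (𝓝 (V (a ℓ) α θ)) :=
  ae_tendsto_div_of_integral_sq_le (fun _ _ => sq_nonneg _)
    (fun n => (integral_sum_filtered_sq_sub hX hs m n).1)
    (fun n => (integral_sum_filtered_sq_sub hX hs m n).2)

/-! ### Central limit theorem -/

/-- Convergence of the characteristic functions of the normalized sums. -/
theorem tendsto_integral_cexp_sum_filtered_sq
    (hX : IsCenteredGaussian X (fun s t => rho θ (s - t)) μ)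
    (hs : ∀ i j, Summable fun k : ℤ => crossCov a α θ i j k ^ 2) (m : ℕ) (c : Fin L → ℝ)
    {s : ℕ → ℝ} (hs0 : ∀ n, 0 ≤ s n) (hs1 : Tendsto (fun n : ℕ => s n ^ 2 * n) atTop (𝓝 1)) :
    Tendsto (fun n : ℕ => ∫ ω, Complex.exp ((∑ ℓ, c ℓ * (s n * ∑ i ∈ Finset.range n,
      (filtered (a ℓ) α (fun t => X t ω) ((m + i : ℕ) * α) ^ 2 - V (a ℓ) α θ)) : ℝ) *
        Complex.I) ∂μ) atTop
      (𝓝 (Complex.exp (-(∑ i, ∑ j, c i * c j * ∑' k : ℤ, crossCov a α θ i j k ^ 2 : ℝ)))) := by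
  set f : ∀ n, Fin L × Fin n → Fin L × ℕ := fun n p => (p.1, m + p.2) with hf
  set R : ∀ n, Matrix (Fin L × Fin n) (Fin L × Fin n) ℝ := fun n p q =>
    crossCov a α θ (f n p).1 (f n q).1 (((f n p).2 : ℤ) - ((f n q).2 : ℤ)) with hR
  -- All L filters are treated at once, as one quadratic form indexed by (filter, time); this
  -- handles every linear combination of the coordinates.
  set d : ∀ n, Fin L × Fin n → ℝ := fun n p => s n * c p.1 with hd
  have hRsub : ∀ n (i : Fin L) (x : Fin n) (j : Fin L) (y : Fin n), R n (i, x) (j, y) =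
      crossCov a α θ i j ((x : ℤ) - (y : ℤ)) := by
    intro n i x j y
    simp only [hR, hf]
    congr 1; push_cast; ring
  have hvar : Tendsto (fun n => ∑ p, ∑ q, d n p * d n q * R n p q ^ 2) atTop
      (𝓝 (∑ i, ∑ j, c i * c j * ∑' k : ℤ, crossCov a α θ i j k ^ 2)) := by
    have h1 : Tendsto (fun n : ℕ => ∑ i, ∑ j, c i * c j * ((s n ^ 2 * n) *
        ((∑ x : Fin n, ∑ y : Fin n, crossCov a α θ i j ((x : ℤ) - (y : ℤ)) ^ 2) / n))) atTop
        (𝓝 (∑ i, ∑ j, c i * c j * (1 * ∑' k : ℤ, crossCov a α θ i j k ^ 2))) :=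
      tendsto_finsetSum _ fun i _ => tendsto_finsetSum _ fun j _ =>
        (hs1.mul (tendsto_sum_sum_fin_sub_div (hs i j))).const_mul _
    simp only [one_mul] at h1
    refine h1.congr' ?_
    filter_upwards [eventually_gt_atTop 0] with n hn
    have hn0 : (n : ℝ) ≠ 0 := by positivity
    rw [Fintype.sum_prod_type]
    refine Finset.sum_congr rfl fun i _ => ?_
    simp_rw [Fintype.sum_prod_type]
    rw [Finset.sum_comm]
    refine Finset.sum_congr rfl fun j _ => ?_
    have : ∀ x, c i * c j * (s n ^ 2 * n * (x / n)) = c i * c j * s n ^ 2 * x := by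
      intro x; field_simp
    rw [this]
    simp only [Finset.mul_sum, hRsub, hd]
    refine Finset.sum_congr rfl fun x _ => Finset.sum_congr rfl fun y _ => ?_
    ring
  have hle : ∀ ε > 0, ∀ᶠ n in atTop,
      ‖∫ ω, Complex.exp ((∑ ℓ, c ℓ * (s n * ∑ i ∈ Finset.range n,
      (filtered (a ℓ) α (fun t => X t ω) ((m + i : ℕ) * α) ^ 2 - V (a ℓ) α θ)) : ℝ) *
        Complex.I) ∂μ - Complex.exp (-(∑ p, ∑ q, d n p * d n q * R n p q ^ 2 : ℝ))‖ ≤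
        ε * ∑ p, ∑ q, d n p * d n q * R n p q ^ 2 := by
    intro ε hε
    obtain ⟨δ, hδ, h⟩ := exists_norm_integral_cexp_quadratic_sub_le (μ := μ) hε
    -- Eventually s_n √n ≤ 2, and each filter contributes a row sum of at most (δ/A) √n, so the
    -- total weighted row sum is at most 2 |c_i| L δ/A ≤ δ. The `+ 1` keeps A positive.
    set A := 2 * (∑ i, |c i|) * L + 1 with hA
    have hA0 : 0 < A := by positivity
    have hrow : ∀ᶠ n : ℕ in atTop, ∀ i j : Fin L, ∀ x : ℤ,
        ∑ y : Fin n, |crossCov a α θ i j (x - (y : ℤ))| ≤ δ / A * √n :=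
      eventually_all.2 fun i => eventually_all.2 fun j =>
        eventually_sum_abs_le_mul_sqrt (hs i j) (by positivity)
    filter_upwards [hrow, hs1.eventually_le_const (u := 4) (by norm_num)] with n hn hsn
    have hsq : s n * √n ≤ 2 := by
      refine le_of_sq_le_sq ?_ zero_le_two
      rw [mul_pow, Real.sq_sqrt (Nat.cast_nonneg n)]
      linarith
    have hfin := h ((hX.filtered a α).comp (f n)) (isSymm_crossCov a α θ (f n)) (d n)
      (fun p => ?_)
    · refine le_of_eq_of_le ?_ hfin
      congr 4
      ext ω
      congr 3
      rw [Fintype.sum_prod_type]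
      refine Finset.sum_congr rfl fun ℓ _ => ?_
      rw [← mul_assoc, Finset.mul_sum, ← Fin.sum_univ_eq_sum_range (fun i => c ℓ * s n *
        (filtered (a ℓ) α (fun t => X t ω) ((m + i : ℕ) * α) ^ 2 - V (a ℓ) α θ))]
      refine Finset.sum_congr rfl fun i _ => ?_
      simp only [hf, hd, sub_self, crossCov_zero]
      ring
    · obtain ⟨i, x⟩ := p
      change ∑ q, |d n (i, x) * R n (i, x) q| ≤ δ
      rw [Fintype.sum_prod_type]
      have e : ∀ j, ∑ y, |d n (i, x) * R n (i, x) (j, y)| ≤ |c i| * (2 * (δ / A)) := by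
        intro j
        simp only [abs_mul, hRsub, hd, ← Finset.mul_sum, abs_of_nonneg (hs0 n)]
        calc s n * |c i| * ∑ y : Fin n, |crossCov a α θ i j ((x : ℤ) - (y : ℤ))|
            ≤ s n * |c i| * (δ / A * √n) :=
              mul_le_mul_of_nonneg_left (hn i j x) (mul_nonneg (hs0 n) (abs_nonneg _))
          _ = |c i| * ((s n * √n) * (δ / A)) := by ring
          _ ≤ _ := by gcongr
      refine (Finset.sum_le_sum fun j _ => e j).trans ?_
      rw [Finset.sum_const, Finset.card_univ, Fintype.card_fin, nsmul_eq_mul]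
      have hci : |c i| ≤ ∑ i, |c i| :=
        Finset.single_le_sum (f := fun i => |c i|) (fun i _ => abs_nonneg _) (Finset.mem_univ i)
      calc L * (|c i| * (2 * (δ / A))) = 2 * |c i| * L * (δ / A) := by ring
        _ ≤ A * (δ / A) := by
            refine mul_le_mul_of_nonneg_right ?_ (by positivity)
            rw [hA]
            have : 2 * |c i| * L ≤ 2 * (∑ i, |c i|) * L := by gcongr
            linarith
        _ = δ := by field_simp
  have hexp : Tendsto (fun n => Complex.exp (-(∑ p, ∑ q, d n p * d n q * R n p q ^ 2 : ℝ))) atTop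
      (𝓝 (Complex.exp (-(∑ i, ∑ j, c i * c j * ∑' k : ℤ, crossCov a α θ i j k ^ 2 : ℝ)))) := by
    have : Continuous fun z : ℝ => Complex.exp (-(z : ℂ)) := by fun_prop
    exact (this.tendsto _).comp hvar
  refine hexp.congr_dist ?_
  rw [Metric.tendsto_atTop']
  intro ε hε
  set W := ∑ i, ∑ j, c i * c j * ∑' k : ℤ, crossCov a α θ i j k ^ 2 with hW
  have h1 := hle (ε / (2 * (|W| + 1))) (by positivity)
  have h2 := hvar.eventually_le_const (u := |W| + 1) (by linarith [le_abs_self W])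
  obtain ⟨n₀, hn₀⟩ := eventually_atTop.1 (h1.and h2)
  refine ⟨n₀, fun n hn => ?_⟩
  obtain ⟨h3, h4⟩ := hn₀ n hn.le
  rw [Real.dist_eq, sub_zero, abs_of_nonneg dist_nonneg, dist_comm, dist_eq_norm]
  calc _ ≤ _ := h3
    _ ≤ ε / (2 * (|W| + 1)) * (|W| + 1) := by gcongr
    _ = ε / 2 := by field_simp
    _ < ε := by linarith

end

end


section

/-! ### Dependence of the spectral density on the parameters -/

variable {H lam : ℝ}

/-- The logarithm is dominated by powers x^(±2η), and multiplication by such a power only shifts H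
by ∓η. -/
theorem abs_log_mul_ouDensity_le {η x : ℝ} (hη : 0 < η) (hx : 0 < x) :
    |Real.log x| * ouDensity H lam x ≤
      η⁻¹ * (ouDensity (H - η) lam x + ouDensity (H + η) lam x) := by
  have h1 : Real.log x ≤ x ^ (2 * η) / (2 * η) := Real.log_le_rpow_div hx.le (by linarith)
  have h2 : -Real.log x ≤ x ^ (-(2 * η)) / (2 * η) := by
    rw [← Real.log_inv, Real.rpow_neg hx.le, ← Real.inv_rpow hx.le]
    exact Real.log_le_rpow_div (inv_pos.2 hx).le (by linarith)
  have p1 := Real.rpow_pos_of_pos hx (2 * η)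
  have p2 := Real.rpow_pos_of_pos hx (-(2 * η))
  have h3 : |Real.log x| ≤ η⁻¹ * (x ^ (2 * η) + x ^ (-(2 * η))) := by
    have q1 := div_pos p1 hη
    have q2 := div_pos p2 hη
    rw [inv_mul_eq_div, add_div, abs_le]
    have e1 : x ^ (2 * η) / (2 * η) = x ^ (2 * η) / η / 2 := by field_simp
    have e2 : x ^ (-(2 * η)) / (2 * η) = x ^ (-(2 * η)) / η / 2 := by field_simp
    rw [e1] at h1
    rw [e2] at h2
    constructor <;> linarith
  have h4 := mul_le_mul_of_nonneg_right h3 (ouDensity_nonneg (H := H) (lam := lam) hx)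
  refine h4.trans_eq ?_
  unfold ouDensity
  rw [show 1 - 2 * (H - η) = 2 * η + (1 - 2 * H) by ring,
    show 1 - 2 * (H + η) = -(2 * η) + (1 - 2 * H) by ring, Real.rpow_add hx, Real.rpow_add hx]
  ring

theorem rpow_le_rpow_add_rpow {x p q r : ℝ} (hx : 0 < x) (hp : p ≤ q) (hq : q ≤ r) :
    x ^ q ≤ x ^ p + x ^ r := by
  have h1 := Real.rpow_pos_of_pos hx p
  have h2 := Real.rpow_pos_of_pos hx r
  rcases le_total x 1 with h | h
  · linarith [Real.rpow_le_rpow_of_exponent_ge hx h hp]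
  · linarith [Real.rpow_le_rpow_of_exponent_le h hq]

/-- One envelope serves all H in [a, b] and all λ ≥ l: small exponents dominate for x ≤ 1, large
ones for x ≥ 1. -/
theorem ouDensity_le_add {a b l x : ℝ} (hl : 0 < l) (ha : a ≤ H) (hb : H ≤ b) (hlam : l ≤ lam)
    (hx : 0 < x) : ouDensity H lam x ≤ ouDensity a l x + ouDensity b l x := by
  unfold ouDensity
  rw [← add_div]
  refine div_le_div₀ ?_ ?_ (by positivity) ?_
  · exact add_nonneg (Real.rpow_nonneg hx.le _) (Real.rpow_nonneg hx.le _)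
  · rw [add_comm]; exact rpow_le_rpow_add_rpow hx (by linarith) (by linarith)
  · nlinarith

theorem abs_log_mul_ouDensity_le_add {a b l η x : ℝ} (hl : 0 < l) (hη : 0 < η) (ha : a + η ≤ H)
    (hb : H + η ≤ b) (hlam : l ≤ lam) (hx : 0 < x) :
    |Real.log x| * ouDensity H lam x ≤ 2 * η⁻¹ * (ouDensity a l x + ouDensity b l x) := by
  refine (abs_log_mul_ouDensity_le hη hx).trans ?_
  have h1 := ouDensity_le_add (H := H - η) hl (by linarith) (by linarith : H - η ≤ b) hlam hx
    (a := a)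
  have h2 := ouDensity_le_add (H := H + η) hl (by linarith : a ≤ H + η) hb hlam hx
  have := inv_pos.2 hη
  nlinarith

theorem hasDerivAt_ouDensity_left (lam : ℝ) {x : ℝ} (hx : 0 < x) (H : ℝ) :
    HasDerivAt (fun h => ouDensity h lam x) (-2 * Real.log x * ouDensity H lam x) H := by
  unfold ouDensity
  have h1 : HasDerivAt (fun h : ℝ => 1 - 2 * h) (-2) H := by
    simpa using ((hasDerivAt_id H).const_mul 2).const_sub 1
  refine ((h1.const_rpow hx).div_const (lam ^ 2 + x ^ 2)).congr_deriv ?_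
  ring

theorem hasFDerivAt_ouDensity {x : ℝ} (hx : 0 < x) {θ : EuclideanSpace ℝ (Fin 3)} :
    HasFDerivAt (fun θ : EuclideanSpace ℝ (Fin 3) => ouDensity (θ 0) (θ 1) x)
      ((-2 * Real.log x * ouDensity (θ 0) (θ 1) x) • EuclideanSpace.proj (𝕜 := ℝ) (0 : Fin 3) +
        (-(2 * θ 1) / (θ 1 ^ 2 + x ^ 2) * ouDensity (θ 0) (θ 1) x) •
          EuclideanSpace.proj (𝕜 := ℝ) (1 : Fin 3)) θ := by
  have p0 : HasFDerivAt (fun θ : EuclideanSpace ℝ (Fin 3) => θ 0)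
    (EuclideanSpace.proj (𝕜 := ℝ) (0 : Fin 3)) θ :=
    (EuclideanSpace.proj (𝕜 := ℝ) (0 : Fin 3)).hasFDerivAt
  have p1 : HasFDerivAt (fun θ : EuclideanSpace ℝ (Fin 3) => θ 1)
    (EuclideanSpace.proj (𝕜 := ℝ) (1 : Fin 3)) θ :=
    (EuclideanSpace.proj (𝕜 := ℝ) (1 : Fin 3)).hasFDerivAt
  have hd1 : HasDerivAt (fun h : ℝ => x ^ (1 - 2 * h)) (Real.log x * -2 * x ^ (1 - 2 * θ 0)) (θ 0) := by
    have h1 : HasDerivAt (fun h : ℝ => 1 - 2 * h) (-2) (θ 0) := by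
      simpa using ((hasDerivAt_id (θ 0)).const_mul 2).const_sub 1
    exact h1.const_rpow hx
  have hpos : θ 1 ^ 2 + x ^ 2 ≠ 0 := by positivity
  have hd2 : HasDerivAt (fun l : ℝ => (l ^ 2 + x ^ 2)⁻¹)
      (-(2 * θ 1) / (θ 1 ^ 2 + x ^ 2) ^ 2) (θ 1) := by
    have := ((hasDerivAt_pow 2 (θ 1)).add_const (x ^ 2)).fun_inv hpos
    simpa using this
  have h := (hd1.comp_hasFDerivAt θ p0).mul (hd2.comp_hasFDerivAt θ p1)
  refine (h.congr_fderiv ?_)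
  ext v
  simp [ouDensity]
  field_simp
  ring

theorem norm_proj_le_one (i : Fin 3) : ‖EuclideanSpace.proj (𝕜 := ℝ) i‖ ≤ 1 :=
  ContinuousLinearMap.opNorm_le_bound _ zero_le_one fun v => by
    rw [one_mul]; exact PiLp.norm_apply_le v i

theorem differentiableAt_integral_mul_ouDensity {m : ℝ → ℝ} (hm : Measurable m)
    (hm1 : ∀ x, |m x| ≤ 1) {θ : EuclideanSpace ℝ (Fin 3)} (h0 : 0 < θ 0) (h1 : θ 0 < 1)
    (hlam : 0 < θ 1) :
    DifferentiableAt ℝ (fun θ : EuclideanSpace ℝ (Fin 3) =>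
      ∫ x in Set.Ioi (0 : ℝ), m x * ouDensity (θ 0) (θ 1) x) θ := by
  -- The room 2η on each side of H is shared: η for the neighbourhood of θ and η for absorbing the
  -- logarithm produced by differentiating in H.
  obtain ⟨η, hη, hη0, hη1⟩ : ∃ η > 0, 2 * η < θ 0 ∧ θ 0 + 2 * η < 1 :=
    ⟨min (θ 0) (1 - θ 0) / 4, by have := lt_min h0 (sub_pos.2 h1); positivity,
      by linarith [min_le_left (θ 0) (1 - θ 0)], by linarith [min_le_right (θ 0) (1 - θ 0)]⟩
  set a := θ 0 - 2 * η with ha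
  set b := θ 0 + 2 * η with hb
  set l := θ 1 / 2 with hl
  have hl0 : 0 < l := by positivity
  set s : Set (EuclideanSpace ℝ (Fin 3)) := {v | θ 0 - η < v 0 ∧ v 0 < θ 0 + η ∧ l < v 1} with hs
  have hsn : s ∈ 𝓝 θ := by
    refine IsOpen.mem_nhds ?_ ⟨by linarith, by linarith, by linarith⟩
    have c0 : Continuous fun v : EuclideanSpace ℝ (Fin 3) => v 0 :=
      (EuclideanSpace.proj (𝕜 := ℝ) (0 : Fin 3)).continuous
    have c1 : Continuous fun v : EuclideanSpace ℝ (Fin 3) => v 1 :=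
      (EuclideanSpace.proj (𝕜 := ℝ) (1 : Fin 3)).continuous
    exact (isOpen_lt continuous_const c0).inter
      ((isOpen_lt c0 continuous_const).inter (isOpen_lt continuous_const c1))
  set env : ℝ → ℝ := fun x => ouDensity a l x + ouDensity b l x with henv
  have henvi : IntegrableOn env (Set.Ioi 0) :=
    (integrableOn_ouDensity (by linarith) (by linarith) hl0).add
      (integrableOn_ouDensity (by linarith) (by linarith) hl0)
  set F' : EuclideanSpace ℝ (Fin 3) → ℝ → (EuclideanSpace ℝ (Fin 3) →L[ℝ] ℝ) := fun v x =>
    m x • ((-2 * Real.log x * ouDensity (v 0) (v 1) x) • EuclideanSpace.proj (𝕜 := ℝ) (0 : Fin 3) +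
        (-(2 * v 1) / (v 1 ^ 2 + x ^ 2) * ouDensity (v 0) (v 1) x) •
          EuclideanSpace.proj (𝕜 := ℝ) (1 : Fin 3)) with hF'
  have hmeas : ∀ v : EuclideanSpace ℝ (Fin 3),
      Measurable fun x => m x * ouDensity (v 0) (v 1) x := fun v =>
    hm.mul measurable_ouDensity
  refine (hasFDerivAt_integral_of_dominated_of_fderiv_le (F' := F')
    (F := fun (v : EuclideanSpace ℝ (Fin 3)) x => m x * ouDensity (v 0) (v 1) x)
    -- The H-derivative carries -2 log x and contributes 4/η; the λ-derivative carries 2λ/(λ²+x²) ≤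
    -- 2/l.
    (bound := fun x => (4 * η⁻¹ + 2 * l⁻¹) * env x) hsn
    (Eventually.of_forall fun v => (hmeas v).aestronglyMeasurable) ?_ ?_ ?_
    (henvi.const_mul _) ?_).differentiableAt
  · exact Integrable.bdd_mul (c := 1) (integrableOn_ouDensity h0 h1 hlam) hm.aestronglyMeasurable
      (ae_of_all _ hm1)
  · have := measurable_ouDensity (H := θ 0) (lam := θ 1)
    simp only [hF']
    refine hm.aestronglyMeasurable.smul (AEStronglyMeasurable.add ?_ ?_)
    · exact (Measurable.aestronglyMeasurable (by fun_prop)).smul_const _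
    · exact (Measurable.aestronglyMeasurable (by fun_prop)).smul_const _
  · refine (ae_restrict_iff' measurableSet_Ioi).2 (ae_of_all _ fun x hx v hv => ?_)
    have hx0 : (0 : ℝ) < x := hx
    obtain ⟨hv0, hv1, hv2⟩ := hv
    have hvpos : 0 < v 1 := hl0.trans hv2
    have e1 := abs_log_mul_ouDensity_le_add (H := v 0) (lam := v 1) (a := a) (b := b) hl0 hη
      (by linarith) (by linarith) hv2.le hx0
    have e2 := ouDensity_le_add (H := v 0) (lam := v 1) (a := a) (b := b) hl0
      (by linarith) (by linarith) hv2.le hx0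
    have hψ : 0 ≤ ouDensity (v 0) (v 1) x := ouDensity_nonneg hx0
    have e3 : |-(2 * v 1) / (v 1 ^ 2 + x ^ 2)| ≤ 2 * l⁻¹ := by
      rw [abs_div, abs_neg, abs_of_pos (by positivity), abs_of_pos (by positivity),
        div_le_iff₀ (by positivity), mul_assoc]
      refine mul_le_mul_of_nonneg_left ?_ zero_le_two
      rw [inv_mul_eq_div, le_div_iff₀ hl0]
      nlinarith [sq_nonneg x]
    calc ‖F' v x‖ ≤ 1 * (|-2 * Real.log x * ouDensity (v 0) (v 1) x| * 1 +
          |-(2 * v 1) / (v 1 ^ 2 + x ^ 2) * ouDensity (v 0) (v 1) x| * 1) := by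
          rw [hF', norm_smul]
          refine mul_le_mul (hm1 x) ((norm_add_le _ _).trans (add_le_add ?_ ?_)) (norm_nonneg _)
            zero_le_one
          · rw [norm_smul]
            exact mul_le_mul_of_nonneg_left (norm_proj_le_one _) (abs_nonneg _)
          · rw [norm_smul]
            exact mul_le_mul_of_nonneg_left (norm_proj_le_one _) (abs_nonneg _)
      _ = 2 * (|Real.log x| * ouDensity (v 0) (v 1) x) +
          |-(2 * v 1) / (v 1 ^ 2 + x ^ 2)| * ouDensity (v 0) (v 1) x := by
          rw [abs_mul, abs_mul, abs_mul, abs_of_nonneg hψ]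
          simp; ring
      _ ≤ 2 * (2 * η⁻¹ * env x) + 2 * l⁻¹ * env x :=
          add_le_add (mul_le_mul_of_nonneg_left e1 zero_le_two)
            (mul_le_mul e3 e2 hψ (by positivity))
      _ = _ := by ring
  · refine (ae_restrict_iff' measurableSet_Ioi).2 (ae_of_all _ fun x hx v _ => ?_)
    exact (hasFDerivAt_ouDensity hx).const_mul (m x)

theorem differentiableAt_cH (h0 : 0 < H) : DifferentiableAt ℝ cH H := by
  unfold cH
  have : DifferentiableAt ℝ (fun H : ℝ => Real.Gamma (2 * H + 1)) H := by
    refine DifferentiableAt.comp H (g := Real.Gamma) (f := fun H : ℝ => 2 * H + 1)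
      (Real.differentiableAt_Gamma fun m => ?_) (by fun_prop)
    have : (0 : ℝ) ≤ m := m.cast_nonneg
    intro h
    linarith
  fun_prop

theorem differentiableAt_rho {θ : EuclideanSpace ℝ (Fin 3)} (h0 : 0 < θ 0) (h1 : θ 0 < 1)
    (hlam : 0 < θ 1) (t : ℝ) : DifferentiableAt ℝ (fun θ => rho θ t) θ := by
  have hI := differentiableAt_integral_mul_ouDensity (m := fun x => Real.cos (t * x))
    (by fun_prop) (fun x => Real.abs_cos_le_one _) h0 h1 hlam
  have hc : DifferentiableAt ℝ (fun θ : EuclideanSpace ℝ (Fin 3) => cH (θ 0)) θ :=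
    DifferentiableAt.comp θ (g := cH) (f := fun θ : EuclideanSpace ℝ (Fin 3) => θ 0)
      (differentiableAt_cH h0) (by fun_prop)
  have h2 : DifferentiableAt ℝ (fun θ : EuclideanSpace ℝ (Fin 3) => θ 2) θ := by fun_prop
  exact (((h2.pow 2).const_mul 2).mul hc).mul hI

theorem differentiableAt_V {L : ℕ} (a : Fin (L + 1) → ℝ) (α : ℝ) {θ : EuclideanSpace ℝ (Fin 3)}
    (h0 : 0 < θ 0) (h1 : θ 0 < 1) (hlam : 0 < θ 1) : DifferentiableAt ℝ (V a α) θ := by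
  unfold V
  exact DifferentiableAt.fun_sum fun k _ => (differentiableAt_rho h0 h1 hlam _).const_mul _

end


section

/-! ### The variogram at small lags -/

/-- The function `(1 - cos z) / z ^ 2`. -/
def cosKernel (z : ℝ) : ℝ := (1 - Real.cos z) / z ^ 2

theorem measurable_cosKernel : Measurable cosKernel := by
  unfold cosKernel; fun_prop

theorem cosKernel_nonneg (z : ℝ) : 0 ≤ cosKernel z :=
  div_nonneg (by linarith [Real.cos_le_one z]) (sq_nonneg z)

theorem cosKernel_le (z : ℝ) : cosKernel z ≤ 1 / 2 := by
  unfold cosKernel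
  rcases eq_or_ne z 0 with rfl | hz
  · norm_num
  · rw [div_le_iff₀ (by positivity)]
    linarith [Real.one_sub_sq_div_two_le_cos (x := z)]

theorem abs_cosKernel_le_one (z : ℝ) : |cosKernel z| ≤ 1 := by
  rw [abs_of_nonneg (cosKernel_nonneg z)]; linarith [cosKernel_le z]

/-- The error is O(z²) near 0 and bounded elsewhere. The weaker power z^(2η) is used because, for
small η, its product with the density remains integrable, which z² does not guarantee. -/
theorem abs_cosKernel_sub_half_le {z η : ℝ} (hz : 0 < z) (hη : 0 ≤ η) (hη1 : η ≤ 1) :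
    |cosKernel z - 1 / 2| ≤ z ^ (2 * η) := by
  rcases le_total z 1 with h | h
  · have h1 := Real.cos_bound (x := z) (by rwa [abs_of_pos hz])
    have h2 : cosKernel z - 1 / 2 = -(Real.cos z - (1 - z ^ 2 / 2)) / z ^ 2 := by
      unfold cosKernel; field_simp; ring
    rw [h2, abs_div, abs_neg, abs_of_pos (a := z ^ 2) (by positivity),
      div_le_iff₀ (by positivity)]
    have h3 : z ^ (2 : ℝ) ≤ z ^ (2 * η) :=
      Real.rpow_le_rpow_of_exponent_ge hz h (by linarith)
    rw [Real.rpow_two] at h3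
    rw [abs_of_pos hz] at h1
    have h4 : 0 < z ^ 2 := by positivity
    nlinarith [mul_le_mul_of_nonneg_right h3 h4.le]
  · have h1 := Real.one_le_rpow h (z := 2 * η) (by linarith)
    have := cosKernel_nonneg z
    have := cosKernel_le z
    rw [abs_le]; constructor <;> linarith

/-- The relative deviation of the variogram of the process from that of a fractional Brownian
motion, up to the factor `t ^ (2 - 2 H)`. -/
def varioRemainder (t H lam : ℝ) : ℝ :=
  4 * cH H * lam ^ 2 * ∫ x in Set.Ioi (0 : ℝ), cosKernel (t * x) * ouDensity H lam x

variable {H lam : ℝ}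

theorem integrableOn_bdd_mul_ouDensity (h0 : 0 < H) (h1 : H < 1) (hlam : 0 < lam) {m : ℝ → ℝ}
    (hm : Measurable m) {c : ℝ} (hmc : ∀ x, |m x| ≤ c) :
    IntegrableOn (fun x => m x * ouDensity H lam x) (Set.Ioi 0) :=
  Integrable.bdd_mul (c := c) (integrableOn_ouDensity h0 h1 hlam) hm.aestronglyMeasurable
    (ae_of_all _ hmc)

theorem integrableOn_cosKernel_mul_ouDensity (h0 : 0 < H) (h1 : H < 1) (hlam : 0 < lam) (t : ℝ) :
    IntegrableOn (fun x => cosKernel (t * x) * ouDensity H lam x) (Set.Ioi 0) :=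
  integrableOn_bdd_mul_ouDensity h0 h1 hlam (measurable_cosKernel.comp (by fun_prop))
    fun x => abs_cosKernel_le_one (t * x)

/-- Since x²/(λ²+x²) = 1 - λ²/(λ²+x²), the spectral integral splits into that of fractional Brownian
motion, equal to a power of t, and a correction carrying the factor t²λ². -/
theorem rho_zero_sub_rho {θ : EuclideanSpace ℝ (Fin 3)} (h0 : 0 < θ 0) (h1 : θ 0 < 1)
    (hlam : 0 < θ 1) {t : ℝ} (ht : 0 < t) :
    rho θ 0 - rho θ t = θ 2 ^ 2 / 2 * t ^ (2 * θ 0) *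
      (1 - t ^ (2 - 2 * θ 0) * varioRemainder t (θ 0) (θ 1)) := by
  have i0 := integrableOn_cos_mul_ouDensity h0 h1 hlam 0
  have it := integrableOn_cos_mul_ouDensity h0 h1 hlam t
  have is := integrableOn_cosKernel_mul_ouDensity h0 h1 hlam t
  have ic := integrableOn_one_sub_cos_mul_rpow h0 h1 t
  have hc := cH_mul_integral_one_sub_cos h0 h1 t
  have e : (∫ x in Set.Ioi 0, Real.cos (0 * x) * ouDensity (θ 0) (θ 1) x) -
      ∫ x in Set.Ioi 0, Real.cos (t * x) * ouDensity (θ 0) (θ 1) x =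
      (∫ x in Set.Ioi 0, (1 - Real.cos (t * x)) * x ^ (-1 - 2 * θ 0)) -
      t ^ 2 * θ 1 ^ 2 * ∫ x in Set.Ioi 0, cosKernel (t * x) * ouDensity (θ 0) (θ 1) x := by
    rw [← integral_sub i0 it, ← integral_const_mul, ← integral_sub ic (is.const_mul _)]
    refine setIntegral_congr_fun measurableSet_Ioi fun x hx => ?_
    have hx0 : (0 : ℝ) < x := hx
    simp only
    rw [ouDensity_eq hx0, zero_mul, Real.cos_zero, cosKernel]
    have : θ 1 ^ 2 + x ^ 2 ≠ 0 := by positivity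
    field_simp
    ring
  rw [abs_of_pos ht] at hc
  have ht2 : t ^ (2 * θ 0) * t ^ (2 - 2 * θ 0) = t ^ 2 := by
    rw [← Real.rpow_add ht, ← Real.rpow_two]; congr 1; ring
  rw [rho_eq, rho_eq, ← mul_sub, e, varioRemainder, mul_sub (θ 2 ^ 2 / 2 * _)]
  set I := ∫ x in Set.Ioi 0, (1 - Real.cos (t * x)) * x ^ (-1 - 2 * θ 0)
  set J := ∫ x in Set.Ioi 0, cosKernel (t * x) * ouDensity (θ 0) (θ 1) x
  rw [show θ 2 ^ 2 / 2 * t ^ (2 * θ 0) * (t ^ (2 - 2 * θ 0) * (4 * cH (θ 0) * θ 1 ^ 2 * J)) =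
    θ 2 ^ 2 / 2 * (t ^ (2 * θ 0) * t ^ (2 - 2 * θ 0)) * (4 * cH (θ 0) * θ 1 ^ 2 * J) by ring, ht2,
    ← hc]
  ring

/-- Convexity of Γ makes it locally Lipschitz on the positive axis, hence Lipschitz on a compact
interval; no bound on its derivative is needed. -/
theorem exists_lipschitzOnWith_cH {h₁ h₂ : ℝ} (h0 : 0 < h₁) :
    ∃ K, 0 ≤ K ∧ ∀ H ∈ Set.Icc h₁ h₂, ∀ H' ∈ Set.Icc h₁ h₂, |cH H - cH H'| ≤ K * |H - H'| := by
  set I := Set.Icc (2 * h₁ + 1) (2 * h₂ + 1) with hI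
  have hsub : I ⊆ Set.Ioi 0 := fun x hx => by
    have := hx.1; simp only [Set.mem_Ioi]; linarith
  have hL : LocallyLipschitzOn (Set.Ioi 0) Real.Gamma := by
    have := Real.convexOn_Gamma.locallyLipschitzOn_interior
    rwa [interior_Ioi] at this
  obtain ⟨K, hK⟩ := (hL.mono hsub).exists_lipschitzOnWith_of_compact isCompact_Icc
  have hcont : ContinuousOn Real.Gamma I := hK.continuousOn
  obtain ⟨M, hM⟩ := isCompact_Icc.exists_bound_of_continuousOn hcont
  refine ⟨(2 * K + Real.pi * |M|) / (2 * Real.pi), by positivity, fun H hH H' hH' => ?_⟩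
  have m1 : 2 * H + 1 ∈ I := ⟨by linarith [hH.1], by linarith [hH.2]⟩
  have m2 : 2 * H' + 1 ∈ I := ⟨by linarith [hH'.1], by linarith [hH'.2]⟩
  have e1 : |Real.Gamma (2 * H + 1) - Real.Gamma (2 * H' + 1)| ≤ K * (2 * |H - H'|) := by
    have := hK.dist_le_mul _ m1 _ m2
    rw [Real.dist_eq, Real.dist_eq, show 2 * H + 1 - (2 * H' + 1) = 2 * (H - H') by ring, abs_mul,
      abs_two] at this
    exact this
  have e2 : |Real.sin (Real.pi * H) - Real.sin (Real.pi * H')| ≤ Real.pi * |H - H'| := by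
    have := Convex.norm_image_sub_le_of_norm_hasDerivWithin_le (f := Real.sin) (f' := Real.cos)
      (C := 1) (s := Set.univ) (x := Real.pi * H') (y := Real.pi * H)
      (fun y _ => (Real.hasDerivAt_sin y).hasDerivWithinAt) (fun y _ => Real.abs_cos_le_one y)
      convex_univ (Set.mem_univ _) (Set.mem_univ _)
    rw [← mul_sub, norm_mul, one_mul, Real.norm_of_nonneg Real.pi_pos.le] at this
    exact this
  have e3 : |Real.Gamma (2 * H' + 1)| ≤ |M| := (hM _ m2).trans (le_abs_self M)
  unfold cH
  rw [← sub_div, abs_div, abs_of_pos (a := 2 * Real.pi) (by positivity), div_mul_eq_mul_div]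
  refine div_le_div_of_nonneg_right ?_ (by positivity)
  calc |Real.Gamma (2 * H + 1) * Real.sin (Real.pi * H) -
        Real.Gamma (2 * H' + 1) * Real.sin (Real.pi * H')|
      = |(Real.Gamma (2 * H + 1) - Real.Gamma (2 * H' + 1)) * Real.sin (Real.pi * H) +
        Real.Gamma (2 * H' + 1) * (Real.sin (Real.pi * H) - Real.sin (Real.pi * H'))| := by
        congr 1; ring
    _ ≤ K * (2 * |H - H'|) * 1 + |M| * (Real.pi * |H - H'|) := by
        refine (abs_add_le _ _).trans (add_le_add ?_ ?_) <;> rw [abs_mul]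
        · exact mul_le_mul e1 (Real.abs_sin_le_one _) (abs_nonneg _) (by positivity)
        · exact mul_le_mul e3 e2 (abs_nonneg _) (abs_nonneg _)
    _ = _ := by ring

theorem exists_cH_bounds {h₁ h₂ : ℝ} (h0 : 0 < h₁) (h1 : h₂ < 1) (h12 : h₁ ≤ h₂) :
    ∃ c₀ c₁, 0 < c₀ ∧ ∀ H ∈ Set.Icc h₁ h₂, c₀ ≤ cH H ∧ cH H ≤ c₁ := by
  have hc : ContinuousOn cH (Set.Icc h₁ h₂) := fun H hH =>
    (differentiableAt_cH (h0.trans_le hH.1)).continuousAt.continuousWithinAt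
  obtain ⟨u, hu, hu'⟩ := isCompact_Icc.exists_isMinOn (Set.nonempty_Icc.2 h12) hc
  obtain ⟨v, hv, hv'⟩ := isCompact_Icc.exists_isMaxOn (Set.nonempty_Icc.2 h12) hc
  exact ⟨cH u, cH v, cH_pos (h0.trans_le hu.1) (hu.2.trans_lt h1), fun H hH => ⟨hu' hH, hv' hH⟩⟩

/-- `κ t H lam` is bounded, Lipschitz in `H`, and its slope in `lam` is bounded below uniformly as
`t → 0`, where `k H lam lam'` is the limit slope. -/
structure IsRegularRemainder (κ : ℝ → ℝ → ℝ → ℝ) (k : ℝ → ℝ → ℝ → ℝ) (I J : Set ℝ)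
    (C k₀ p : ℝ) : Prop where
  nonneg : ∀ t, 0 < t → t ≤ 1 → ∀ H ∈ I, ∀ lam ∈ J, 0 ≤ κ t H lam
  le : ∀ t, 0 < t → t ≤ 1 → ∀ H ∈ I, ∀ lam ∈ J, κ t H lam ≤ C
  lipschitz_left : ∀ t, 0 < t → t ≤ 1 → ∀ H ∈ I, ∀ H' ∈ I, ∀ lam ∈ J,
    |κ t H lam - κ t H' lam| ≤ C * |H - H'|
  lipschitz_right : ∀ t, 0 < t → t ≤ 1 → ∀ H ∈ I, ∀ lam ∈ J, ∀ lam' ∈ J,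
    |κ t H lam' - κ t H lam| ≤ C * |lam' - lam|
  slope : ∀ t, 0 < t → t ≤ 1 → ∀ H ∈ I, ∀ lam ∈ J, ∀ lam' ∈ J,
    |κ t H lam' - κ t H lam - (lam' - lam) * k H lam lam'| ≤ C * t ^ p * |lam' - lam|
  le_slope : ∀ H ∈ I, ∀ lam ∈ J, ∀ lam' ∈ J, k₀ ≤ k H lam lam'

theorem abs_ouDensity_sub_le {a b l η h₁ h₂ x : ℝ} (hl : 0 < l) (hη : 0 < η) (ha : a + η ≤ h₁)
    (hb : h₂ + η ≤ b) (hlam : l ≤ lam) (hx : 0 < x) {H H' : ℝ} (hH : H ∈ Set.Icc h₁ h₂)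
    (hH' : H' ∈ Set.Icc h₁ h₂) :
    |ouDensity H lam x - ouDensity H' lam x| ≤
      4 * η⁻¹ * (ouDensity a l x + ouDensity b l x) * |H - H'| := by
  refine Convex.norm_image_sub_le_of_norm_hasDerivWithin_le (f := fun h => ouDensity h lam x)
    (s := Set.Icc h₁ h₂) (fun h _ => (hasDerivAt_ouDensity_left lam hx h).hasDerivWithinAt)
    (fun h hh => ?_) (convex_Icc h₁ h₂) hH' hH
  have := abs_log_mul_ouDensity_le_add (H := h) (a := a) (b := b) hl hη (by linarith [hh.1])
    (by linarith [hh.2]) hlam hx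
  rw [norm_mul, norm_mul, norm_neg, Real.norm_two, Real.norm_of_nonneg (ouDensity_nonneg hx),
    Real.norm_eq_abs]
  linarith

/-- With w(x) = x²/(λ'²+x²), the difference quotient in λ is 4 c_H (λ+λ') times the integral of
`cosKernel (t * x)` w ψ, where ψ is the density at λ. As t → 0 the kernel tends to 1/2, so the limit
slope is 2 c_H (λ+λ') ∫ wψ, which is positive. Working with exact quotients instead of derivatives
makes all bounds uniform in λ and λ'. -/
theorem exists_isRegularRemainder {h₁ h₂ l₁ l₂ : ℝ} (h0 : 0 < h₁) (h1 : h₂ < 1) (h12 : h₁ ≤ h₂)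
    (hl : 0 < l₁) (hl12 : l₁ ≤ l₂) :
    ∃ k C k₀ p, 0 < C ∧ 0 < k₀ ∧ 0 < p ∧
      IsRegularRemainder varioRemainder k (Set.Icc h₁ h₂) (Set.Icc l₁ l₂) C k₀ p := by
  obtain ⟨η, hη, hη0, hη1, hη2⟩ : ∃ η > 0, η < h₁ ∧ h₂ + η < 1 ∧ η ≤ 1 :=
    ⟨min h₁ (1 - h₂) / 2, by have := lt_min h0 (sub_pos.2 h1); positivity,
      by linarith [min_le_left h₁ (1 - h₂)], by linarith [min_le_right h₁ (1 - h₂)],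
      by linarith [min_le_left h₁ (1 - h₂)]⟩
  obtain ⟨K, hK0, hK⟩ := exists_lipschitzOnWith_cH (h₂ := h₂) h0
  obtain ⟨c₀, c₁, hc₀, hc⟩ := exists_cH_bounds h0 h1 h12
  have hc₁ : 0 < c₁ := hc₀.trans_le ((hc h₁ ⟨le_rfl, h12⟩).1.trans (hc h₁ ⟨le_rfl, h12⟩).2)
  set a := h₁ - η with ha
  set b := h₂ + η with hb
  set env : ℝ → ℝ := fun x => ouDensity a l₁ x + ouDensity b l₁ x with henv
  have henvi : IntegrableOn env (Set.Ioi 0) :=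
    (integrableOn_ouDensity (by linarith) (by linarith) hl).add
      (integrableOn_ouDensity (by linarith) (by linarith) hl)
  set E := ∫ x in Set.Ioi 0, env x with hE
  have hE0 : 0 ≤ E := setIntegral_nonneg measurableSet_Ioi fun x hx =>
    add_nonneg (ouDensity_nonneg hx) (ouDensity_nonneg hx)
  have hle : ∀ H ∈ Set.Icc h₁ h₂, ∀ lam ∈ Set.Icc l₁ l₂, ∀ x ∈ Set.Ioi (0 : ℝ),
      ouDensity H lam x ≤ env x := fun H hH lam hlam x hx =>
    ouDensity_le_add hl (by linarith [hH.1]) (by linarith [hH.2]) hlam.1 hx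
  -- the integral of a bounded multiple of the density
  have hint : ∀ H ∈ Set.Icc h₁ h₂, ∀ lam ∈ Set.Icc l₁ l₂, ∀ m : ℝ → ℝ, Measurable m →
      (∀ x, |m x| ≤ 1) → IntegrableOn (fun x => m x * ouDensity H lam x) (Set.Ioi 0) ∧
      |∫ x in Set.Ioi 0, m x * ouDensity H lam x| ≤ E := by
    intro H hH lam hlam m hm hm1
    have hi := integrableOn_bdd_mul_ouDensity (h0.trans_le hH.1) (hH.2.trans_lt h1)
      (hl.trans_le hlam.1) hm hm1
    refine ⟨hi, (norm_integral_le_integral_norm _).trans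
      (setIntegral_mono_on hi.norm henvi measurableSet_Ioi fun x hx => ?_)⟩
    rw [norm_mul, Real.norm_of_nonneg (ouDensity_nonneg hx)]
    exact (mul_le_of_le_one_left (ouDensity_nonneg hx) (hm1 x)).trans (hle H hH lam hlam x hx)
  have hsm : ∀ t : ℝ, Measurable fun x => cosKernel (t * x) := fun t =>
    measurable_cosKernel.comp (by fun_prop)
  set S : ℝ → ℝ → ℝ → ℝ := fun t H lam =>
    ∫ x in Set.Ioi 0, cosKernel (t * x) * ouDensity H lam x with hS
  have hSle : ∀ t, ∀ H ∈ Set.Icc h₁ h₂, ∀ lam ∈ Set.Icc l₁ l₂, |S t H lam| ≤ E :=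
    fun t H hH lam hlam => (hint H hH lam hlam _ (hsm t) fun x => abs_cosKernel_le_one _).2
  have hS0 : ∀ t H lam, 0 ≤ S t H lam := fun t H lam =>
    setIntegral_nonneg measurableSet_Ioi fun x hx =>
      mul_nonneg (cosKernel_nonneg _) (ouDensity_nonneg hx)
  -- the integrals in the difference quotients with respect to `lam`
  set w : ℝ → ℝ → ℝ := fun lam' x => x ^ 2 / (lam' ^ 2 + x ^ 2) with hw
  have hwm : ∀ lam', Measurable (w lam') := fun lam' => by simp only [hw]; fun_prop
  have hw0 : ∀ lam' x, 0 ≤ w lam' x := fun lam' x => by positivity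
  have hw1 : ∀ lam' x, w lam' x ≤ 1 := fun lam' x =>
    div_le_one_of_le₀ (by nlinarith [sq_nonneg lam']) (by positivity)
  set T : ℝ → ℝ → ℝ → ℝ := fun H lam lam' =>
    ∫ x in Set.Ioi 0, w lam' x * ouDensity H lam x with hT
  have hTle : ∀ H ∈ Set.Icc h₁ h₂, ∀ lam ∈ Set.Icc l₁ l₂, ∀ lam' ∈ Set.Icc l₁ l₂,
      |T H lam lam'| ≤ E := fun H hH lam hlam lam' _ =>
    (hint H hH lam hlam _ (hwm lam') fun x => by
      rw [abs_of_nonneg (hw0 lam' x)]; exact hw1 lam' x).2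
  -- The integrand is nonnegative, so it suffices to keep x in (1, 2], where both factors are
  -- bounded below uniformly in the parameters.
  have hTge : ∀ H ∈ Set.Icc h₁ h₂, ∀ lam ∈ Set.Icc l₁ l₂, ∀ lam' ∈ Set.Icc l₁ l₂,
      1 / (2 * (l₂ ^ 2 + 4) ^ 2) ≤ T H lam lam' := by
    intro H hH lam hlam lam' hlam'
    have hi := (hint H hH lam hlam _ (hwm lam') fun x => by
      rw [abs_of_nonneg (hw0 lam' x)]; exact hw1 lam' x).1
    have hsub : Set.Ioc (1 : ℝ) 2 ⊆ Set.Ioi 0 := fun x hx => zero_lt_one.trans hx.1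
    calc 1 / (2 * (l₂ ^ 2 + 4) ^ 2)
        = ∫ _ in Set.Ioc (1 : ℝ) 2, 1 / (2 * (l₂ ^ 2 + 4) ^ 2) := by
          rw [setIntegral_const]; norm_num
      _ ≤ ∫ x in Set.Ioc (1 : ℝ) 2, w lam' x * ouDensity H lam x := by
          refine setIntegral_mono_on (integrableOn_const (by simp)) (hi.mono_set hsub)
            measurableSet_Ioc fun x hx => ?_
          have hx0 : (0 : ℝ) < x := zero_lt_one.trans hx.1
          have l1 : lam' ^ 2 ≤ l₂ ^ 2 := pow_le_pow_left₀ (hl.le.trans hlam'.1) hlam'.2 2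
          have l2 : lam ^ 2 ≤ l₂ ^ 2 := pow_le_pow_left₀ (hl.le.trans hlam.1) hlam.2 2
          have hx2 : x ^ 2 ≤ 4 := by nlinarith [hx.1, hx.2]
          have e1 : 1 / (l₂ ^ 2 + 4) ≤ w lam' x :=
            div_le_div₀ (by positivity) (by nlinarith [hx.1]) (by positivity) (by linarith)
          have e3 : (1 / 2 : ℝ) ≤ x ^ (1 - 2 * H) := by
            have : x ^ (-1 : ℝ) ≤ x ^ (1 - 2 * H) :=
              Real.rpow_le_rpow_of_exponent_le hx.1.le (by linarith [hH.2])
            refine le_trans ?_ this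
            rw [Real.rpow_neg_one, one_div]
            exact inv_anti₀ hx0 hx.2
          have e2 : 1 / 2 / (l₂ ^ 2 + 4) ≤ ouDensity H lam x :=
            div_le_div₀ (by positivity) e3 (by positivity) (by linarith)
          calc 1 / (2 * (l₂ ^ 2 + 4) ^ 2) = 1 / (l₂ ^ 2 + 4) * (1 / 2 / (l₂ ^ 2 + 4)) := by
                field_simp
            _ ≤ _ := mul_le_mul e1 e2 (by positivity) (hw0 lam' x)
      _ ≤ T H lam lam' := setIntegral_mono_set hi
          ((ae_restrict_iff' measurableSet_Ioi).2 (ae_of_all _ fun x hx =>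
            mul_nonneg (hw0 lam' x) (ouDensity_nonneg hx))) hsub.eventuallyLE
  have hslope : ∀ t, 0 < t → ∀ H ∈ Set.Icc h₁ h₂, ∀ lam ∈ Set.Icc l₁ l₂, ∀ lam' ∈ Set.Icc l₁ l₂,
      |varioRemainder t H lam' - varioRemainder t H lam -
        (lam' - lam) * (2 * cH H * (lam + lam') * T H lam lam')| ≤
      8 * c₁ * l₂ * E * t ^ (2 * η) * |lam' - lam| := by
    intro t ht H hH lam hlam lam' hlam'
    have hmk : Measurable fun x => cosKernel (t * x) * w lam' x := (hsm t).mul (hwm lam')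
    have hi1 := (hint H hH lam' hlam' _ (hsm t) fun x => abs_cosKernel_le_one _).1
    have hi2 := (hint H hH lam hlam _ (hsm t) fun x => abs_cosKernel_le_one _).1
    have hi3 := (hint H hH lam hlam _ (hwm lam') fun x => by
      rw [abs_of_nonneg (hw0 lam' x)]; exact hw1 lam' x).1
    have hi4 := (hint H hH lam hlam _ hmk fun x => by
      rw [abs_mul, abs_of_nonneg (hw0 lam' x)]
      exact mul_le_one₀ (abs_cosKernel_le_one _) (hw0 lam' x) (hw1 lam' x)).1
    have e : varioRemainder t H lam' - varioRemainder t H lam -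
        (lam' - lam) * (2 * cH H * (lam + lam') * T H lam lam') =
        (lam' - lam) * (4 * cH H * (lam + lam')) *
        ∫ x in Set.Ioi 0, (cosKernel (t * x) * w lam' x * ouDensity H lam x -
          2⁻¹ * (w lam' x * ouDensity H lam x)) := by
      have e1 : varioRemainder t H lam' - varioRemainder t H lam =
          (lam' - lam) * (4 * cH H * (lam + lam')) *
          ∫ x in Set.Ioi 0, cosKernel (t * x) * w lam' x * ouDensity H lam x := by
        unfold varioRemainder
        rw [mul_assoc, mul_assoc (4 * cH H), ← mul_sub, ← integral_const_mul, ← integral_const_mul,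
          ← integral_sub (hi1.const_mul _) (hi2.const_mul _),
          show (lam' - lam) * (4 * cH H * (lam + lam')) = 4 * cH H * (lam' ^ 2 - lam ^ 2) by ring,
          mul_assoc (4 * cH H) (lam' ^ 2 - lam ^ 2), ← integral_const_mul (lam' ^ 2 - lam ^ 2)]
        congr 1
        refine setIntegral_congr_fun measurableSet_Ioi fun x hx => ?_
        have hx0 : (0 : ℝ) < x := hx
        simp only [hw, ouDensity]
        have p1 : lam ^ 2 + x ^ 2 ≠ 0 := by positivity
        have p2 : lam' ^ 2 + x ^ 2 ≠ 0 := by positivity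
        field_simp
        ring
      rw [integral_sub hi4 (hi3.const_mul _), integral_const_mul, e1]
      ring
    rw [e, abs_mul, abs_mul]
    have hint2 : |∫ x in Set.Ioi 0, (cosKernel (t * x) * w lam' x * ouDensity H lam x -
          2⁻¹ * (w lam' x * ouDensity H lam x))| ≤ t ^ (2 * η) * E := by
      rw [hE, ← integral_const_mul]
      refine (norm_integral_le_integral_norm _).trans (setIntegral_mono_on
        (hi4.sub (hi3.const_mul _)).norm (henvi.const_mul _) measurableSet_Ioi fun x hx => ?_)
      have hx0 : (0 : ℝ) < x := hx
      have hψ := ouDensity_nonneg (H := H) (lam := lam) hx0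
      rw [Pi.sub_apply, show cosKernel (t * x) * w lam' x * ouDensity H lam x -
          2⁻¹ * (w lam' x * ouDensity H lam x) =
          (cosKernel (t * x) - 1 / 2) * (w lam' x * ouDensity H lam x) by ring, norm_mul,
        Real.norm_of_nonneg (mul_nonneg (hw0 lam' x) hψ)]
      calc |cosKernel (t * x) - 1 / 2| * (w lam' x * ouDensity H lam x)
          ≤ (t * x) ^ (2 * η) * ouDensity H lam x :=
            mul_le_mul (abs_cosKernel_sub_half_le (by positivity) hη.le hη2)
              (mul_le_of_le_one_left hψ (hw1 lam' x)) (mul_nonneg (hw0 lam' x) hψ)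
              (by positivity)
        -- The factor x^(2η) is absorbed by lowering H to H - η, still within the range of the
        -- envelope.
        _ = t ^ (2 * η) * ouDensity (H - η) lam x := by
            unfold ouDensity
            rw [Real.mul_rpow ht.le hx0.le,
              show 1 - 2 * (H - η) = 2 * η + (1 - 2 * H) by ring, Real.rpow_add hx0]
            ring
        _ ≤ t ^ (2 * η) * env x := by
            refine mul_le_mul_of_nonneg_left ?_ (by positivity)
            exact ouDensity_le_add hl (by linarith [hH.1]) (by linarith [hH.2]) hlam.1 hx0
    have hc4 : |4 * cH H * (lam + lam')| ≤ 8 * c₁ * l₂ := by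
      have hcp := hc₀.trans_le (hc H hH).1
      have p1 : 0 < lam + lam' := by linarith [hlam.1, hlam'.1]
      rw [abs_of_pos (by positivity)]
      calc 4 * cH H * (lam + lam') ≤ 4 * c₁ * (2 * l₂) :=
            mul_le_mul (by linarith [(hc H hH).2]) (by linarith [hlam.2, hlam'.2]) p1.le
              (by positivity)
        _ = _ := by ring
    calc |lam' - lam| * |4 * cH H * (lam + lam')| * _
        ≤ |lam' - lam| * (8 * c₁ * l₂) * (t ^ (2 * η) * E) :=
          mul_le_mul (mul_le_mul_of_nonneg_left hc4 (abs_nonneg _)) hint2 (abs_nonneg _)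
            (mul_nonneg (abs_nonneg _) (by have := hl.le.trans hl12; positivity))
      _ = _ := by ring
  have hl₂ : 0 < l₂ := hl.trans_le hl12
  have hkle : ∀ H ∈ Set.Icc h₁ h₂, ∀ lam ∈ Set.Icc l₁ l₂, ∀ lam' ∈ Set.Icc l₁ l₂,
      |2 * cH H * (lam + lam') * T H lam lam'| ≤ 4 * c₁ * l₂ * E := by
    intro H hH lam hlam lam' hlam'
    have hcp := hc₀.trans_le (hc H hH).1
    have p1 : 0 < lam + lam' := by linarith [hlam.1, hlam'.1]
    rw [abs_mul, abs_of_pos (by positivity)]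
    refine mul_le_mul ?_ (hTle H hH lam hlam lam' hlam') (abs_nonneg _) (by positivity)
    calc 2 * cH H * (lam + lam') ≤ 2 * c₁ * (2 * l₂) :=
          mul_le_mul (by linarith [(hc H hH).2]) (by linarith [hlam.2, hlam'.2]) p1.le
            (by positivity)
      _ = _ := by ring
  -- A single constant exceeding the four that are needed: the size of κ, its two Lipschitz
  -- constants, and the error in the slope.
  set C := 4 * l₂ ^ 2 * (c₁ + K) * E * (1 + 4 * η⁻¹) + 12 * c₁ * l₂ * E + 1 with hC
  have hCa : 4 * c₁ * l₂ ^ 2 * E ≤ C := by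
    have : 0 ≤ 4 * l₂ ^ 2 * K * E + 4 * l₂ ^ 2 * (c₁ + K) * E * (4 * η⁻¹) +
      12 * c₁ * l₂ * E + 1 := by positivity
    rw [hC]; nlinarith
  have hCb : 4 * l₂ ^ 2 * (K * E + c₁ * (4 * η⁻¹ * E)) ≤ C := by
    have : 0 ≤ 4 * l₂ ^ 2 * c₁ * E + 4 * l₂ ^ 2 * K * E * (4 * η⁻¹) +
      12 * c₁ * l₂ * E + 1 := by positivity
    rw [hC]; nlinarith
  have hCc : 12 * c₁ * l₂ * E ≤ C := by
    have : 0 ≤ 4 * l₂ ^ 2 * (c₁ + K) * E * (1 + 4 * η⁻¹) := by positivity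
    rw [hC]; linarith
  have hCd : 8 * c₁ * l₂ * E ≤ C := by
    have : 0 ≤ 4 * c₁ * l₂ * E := by positivity
    linarith
  have hC0 : 0 < C := by positivity
  refine ⟨fun H lam lam' => 2 * cH H * (lam + lam') * T H lam lam', C,
    2 * c₀ * (2 * l₁) * (1 / (2 * (l₂ ^ 2 + 4) ^ 2)), 2 * η, hC0, by positivity, by positivity,
    ?_, ?_, ?_, ?_, ?_, ?_⟩
  · intro t _ _ H hH lam hlam
    exact mul_nonneg (mul_nonneg (by linarith [(hc H hH).1]) (sq_nonneg _)) (hS0 t H lam)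
  · intro t _ _ H hH lam hlam
    refine le_trans ?_ hCa
    have hcp := hc₀.trans_le (hc H hH).1
    have hl2 : lam ^ 2 ≤ l₂ ^ 2 := pow_le_pow_left₀ (hl.le.trans hlam.1) hlam.2 2
    exact mul_le_mul (mul_le_mul (by linarith [(hc H hH).2]) hl2 (sq_nonneg _) (by positivity))
      ((le_abs_self _).trans (hSle t H hH lam hlam)) (hS0 t H lam) (by positivity)
  · intro t _ _ H hH H' hH' lam hlam
    refine le_trans ?_ (mul_le_mul_of_nonneg_right hCb (abs_nonneg _))
    have hcp := hc₀.trans_le (hc H hH).1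
    have hcp' := hc₀.trans_le (hc H' hH').1
    have hl2 : lam ^ 2 ≤ l₂ ^ 2 := pow_le_pow_left₀ (hl.le.trans hlam.1) hlam.2 2
    have hi1 := (hint H hH lam hlam _ (hsm t) fun x => abs_cosKernel_le_one _).1
    have hi2 := (hint H' hH' lam hlam _ (hsm t) fun x => abs_cosKernel_le_one _).1
    have hSS : |S t H lam - S t H' lam| ≤ 4 * η⁻¹ * E * |H - H'| := by
      rw [hS, ← integral_sub hi1 hi2,
        show 4 * η⁻¹ * E * |H - H'| = ∫ x in Set.Ioi 0, 4 * η⁻¹ * |H - H'| * env x by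
          rw [integral_const_mul]; ring]
      refine (norm_integral_le_integral_norm _).trans (setIntegral_mono_on
        (hi1.sub hi2).norm (henvi.const_mul _) measurableSet_Ioi fun x hx => ?_)
      rw [Pi.sub_apply, ← mul_sub, norm_mul]
      have := abs_ouDensity_sub_le (a := a) (b := b) hl hη (by linarith) (by linarith) hlam.1
        (show (0 : ℝ) < x from hx) hH hH'
      refine (mul_le_of_le_one_left (norm_nonneg _) (abs_cosKernel_le_one _)).trans
        (this.trans_eq (by ring))
    have e : varioRemainder t H lam - varioRemainder t H' lam = 4 * lam ^ 2 *
        ((cH H - cH H') * S t H lam + cH H' * (S t H lam - S t H' lam)) := by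
      unfold varioRemainder; simp only [hS]; ring
    rw [e, abs_mul, abs_of_nonneg (by positivity)]
    calc 4 * lam ^ 2 * |(cH H - cH H') * S t H lam + cH H' * (S t H lam - S t H' lam)|
        ≤ 4 * l₂ ^ 2 * (K * |H - H'| * E + c₁ * (4 * η⁻¹ * E * |H - H'|)) := by
          refine mul_le_mul (by linarith) ((abs_add_le _ _).trans (add_le_add ?_ ?_))
            (abs_nonneg _) (by positivity) <;> rw [abs_mul]
          · exact mul_le_mul (hK H hH H' hH') (hSle t H hH lam hlam) (abs_nonneg _)
              (by positivity)
          · rw [abs_of_pos hcp']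
            exact mul_le_mul (hc H' hH').2 hSS (abs_nonneg _) hc₁.le
      _ = _ := by ring
  · intro t ht ht1 H hH lam hlam lam' hlam'
    have h3 := hslope t ht H hH lam hlam lam' hlam'
    have h4 := hkle H hH lam hlam lam' hlam'
    have h5 : t ^ (2 * η) ≤ 1 := Real.rpow_le_one ht.le ht1 (by positivity)
    have h6 : 8 * c₁ * l₂ * E * t ^ (2 * η) * |lam' - lam| ≤ 8 * c₁ * l₂ * E * |lam' - lam| :=
      mul_le_mul_of_nonneg_right (mul_le_of_le_one_right (by positivity) h5) (abs_nonneg _)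
    have h7 : |(lam' - lam) * (2 * cH H * (lam + lam') * T H lam lam')| ≤
        4 * c₁ * l₂ * E * |lam' - lam| := by
      rw [abs_mul, mul_comm]; exact mul_le_mul_of_nonneg_right h4 (abs_nonneg _)
    have h8 := abs_sub_abs_le_abs_sub (varioRemainder t H lam' - varioRemainder t H lam)
      ((lam' - lam) * (2 * cH H * (lam + lam') * T H lam lam'))
    refine le_trans ?_ (mul_le_mul_of_nonneg_right hCc (abs_nonneg _))
    linarith
  · intro t ht _ H hH lam hlam lam' hlam'
    refine (hslope t ht H hH lam hlam lam' hlam').trans ?_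
    exact mul_le_mul_of_nonneg_right (mul_le_mul_of_nonneg_right hCd
      (Real.rpow_nonneg ht.le _)) (abs_nonneg _)
  · intro H hH lam hlam lam' hlam'
    have hcp := hc₀.trans_le (hc H hH).1
    exact mul_le_mul (mul_le_mul (by linarith [(hc H hH).1]) (by linarith [hlam.1, hlam'.1])
      (by positivity) (by positivity)) (hTge H hH lam hlam lam' hlam') (by positivity)
      (by have := hlam.1; have := hlam'.1; have : 0 < lam + lam' := by linarith
          positivity)

end


section

/-! ### Identification of the parameters from the variogram -/

/-- The derivative of log(1-x) + x is -x/(1-x), at most 2m in absolute value on [0, m] since m ≤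
1/2. -/
theorem abs_log_one_sub_sub_add_le {a b m : ℝ} (ha : 0 ≤ a) (hb : 0 ≤ b) (ham : a ≤ m) (hbm : b ≤ m)
    (hm : m ≤ 1 / 2) : |Real.log (1 - a) - Real.log (1 - b) + (a - b)| ≤ 2 * m * |a - b| := by
  have := Convex.norm_image_sub_le_of_norm_hasDerivWithin_le
    (f := fun x : ℝ => Real.log (1 - x) + x) (f' := fun x => -1 / (1 - x) + 1) (C := 2 * m)
    (s := Set.Icc 0 m) (x := b) (y := a) (fun x hx => ?_) (fun x hx => ?_) (convex_Icc 0 m)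
    ⟨hb, hbm⟩ ⟨ha, ham⟩
  · rw [Real.norm_eq_abs, Real.norm_eq_abs] at this
    convert this using 2; ring
  · have h1 : (1 : ℝ) - x ≠ 0 := by linarith [hx.2]
    exact ((((hasDerivAt_id x).const_sub 1).log h1).add (hasDerivAt_id x)).hasDerivWithinAt
  · have h1 : 0 < 1 - x := by linarith [hx.2]
    have h2 : -1 / (1 - x) + 1 = -(x / (1 - x)) := by field_simp; ring
    rw [h2, norm_neg, Real.norm_of_nonneg (div_nonneg hx.1 h1.le), div_le_iff₀ h1]
    nlinarith [hx.1, hx.2]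

theorem abs_log_one_sub_sub_le {a b : ℝ} (ha : 0 ≤ a) (hb : 0 ≤ b) (ham : a ≤ 1 / 2)
    (hbm : b ≤ 1 / 2) : |Real.log (1 - a) - Real.log (1 - b)| ≤ 2 * |a - b| := by
  have h := abs_log_one_sub_sub_add_le ha hb ham hbm le_rfl
  have h2 := abs_sub_abs_le_abs_sub (Real.log (1 - a) - Real.log (1 - b)) (-(a - b))
  rw [sub_neg_eq_add, abs_neg] at h2
  linarith

/-- Strict convexity of exp at the points 0 < u log 2 < u log 3. The weights log(3/2), -log 3, log 2
are, up to a factor, the only ones on {1, 2, 3} that annihilate both 1 and log n; the content is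
that they do not annihilate n^u. -/
theorem log_mul_rpow_combination_pos {u : ℝ} (hu : 0 < u) :
    0 < Real.log (3 / 2) - Real.log 3 * 2 ^ u + Real.log 2 * 3 ^ u := by
  have l2 : 0 < Real.log 2 := Real.log_pos (by norm_num)
  have l23 : Real.log 2 < Real.log 3 := Real.log_lt_log (by norm_num) (by norm_num)
  have l3 := l2.trans l23
  have h := strictConvexOn_exp.2 (Set.mem_univ (Real.log 3 * u)) (Set.mem_univ 0)
    (mul_pos l3 hu).ne' (div_pos l2 l3) (sub_pos.2 ((div_lt_one l3).2 l23)) (by ring)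
  simp only [smul_eq_mul, mul_zero, add_zero, Real.exp_zero, mul_one] at h
  rw [← mul_assoc, div_mul_cancel₀ _ l3.ne', ← Real.rpow_def_of_pos (by norm_num),
    ← Real.rpow_def_of_pos (by norm_num)] at h
  have h2 := mul_lt_mul_of_pos_left h l3
  have e : Real.log 3 * (Real.log 2 / Real.log 3 * 3 ^ u + (1 - Real.log 2 / Real.log 3)) =
      Real.log 2 * 3 ^ u + (Real.log 3 - Real.log 2) := by field_simp
  rw [e] at h2
  rw [Real.log_div (by norm_num) (by norm_num)]
  linarith

theorem exists_le_log_mul_rpow_combination {u₁ u₂ : ℝ} (hu : 0 < u₁) (hu12 : u₁ ≤ u₂) :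
    ∃ c > 0, ∀ u ∈ Set.Icc u₁ u₂,
      c ≤ Real.log (3 / 2) - Real.log 3 * 2 ^ u + Real.log 2 * 3 ^ u := by
  have hc : Continuous fun u : ℝ =>
      Real.log (3 / 2) - Real.log 3 * 2 ^ u + Real.log 2 * 3 ^ u := by
    have h2 : Continuous fun u : ℝ => (2 : ℝ) ^ u :=
      Real.continuous_const_rpow (by norm_num)
    have h3 : Continuous fun u : ℝ => (3 : ℝ) ^ u :=
      Real.continuous_const_rpow (by norm_num)
    fun_prop
  obtain ⟨v, hv, hv'⟩ := isCompact_Icc.exists_isMinOn (Set.nonempty_Icc.2 hu12) hc.continuousOn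
  exact ⟨_, log_mul_rpow_combination_pos (hu.trans_le hv.1), fun u hu => hv' hu⟩

namespace IsRegularRemainder

variable {κ k : ℝ → ℝ → ℝ → ℝ} {h₁ h₂ : ℝ} {J : Set ℝ} {C k₀ p : ℝ}

theorem mul_mem (hκ : IsRegularRemainder κ k (Set.Icc h₁ h₂) J C k₀ p) {t : ℝ} (ht : 0 < t)
    (ht1 : t ≤ 1) {H : ℝ} (hH : H ∈ Set.Icc h₁ h₂) {lam : ℝ} (hlam : lam ∈ J) :
    0 ≤ t ^ (2 - 2 * H) * κ t H lam ∧ t ^ (2 - 2 * H) * κ t H lam ≤ C * t ^ (2 - 2 * H) := by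
  have h := Real.rpow_nonneg ht.le (2 - 2 * H)
  refine ⟨mul_nonneg h (hκ.nonneg t ht ht1 H hH lam hlam), ?_⟩
  rw [mul_comm]
  exact mul_le_mul_of_nonneg_right (hκ.le t ht ht1 H hH lam hlam) h

/-- H enters through κ, which is Lipschitz, and through the power t^(2-2H), whose variation costs a
factor -log t. As t ≤ 1 and H' ≤ H, the power at H is the larger of the two. -/
theorem abs_log_sub_left_le (hκ : IsRegularRemainder κ k (Set.Icc h₁ h₂) J C k₀ p) (hC : 0 < C)
    {t : ℝ} (ht : 0 < t) (ht1 : t ≤ 1) (htC : C * t ^ (2 - 2 * h₂) ≤ 1 / 2) {H H' : ℝ}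
    (hH : H ∈ Set.Icc h₁ h₂) (hH' : H' ∈ Set.Icc h₁ h₂) (hle : H' ≤ H) {lam : ℝ} (hlam : lam ∈ J) :
    |Real.log (1 - t ^ (2 - 2 * H) * κ t H lam) - Real.log (1 - t ^ (2 - 2 * H') * κ t H' lam)| ≤
      2 * C * (2 * -Real.log t + 1) * t ^ (2 - 2 * H) * (H - H') := by
  have hsmall : ∀ h ∈ Set.Icc h₁ h₂, t ^ (2 - 2 * h) * κ t h lam ≤ 1 / 2 := fun h hh =>
    (hκ.mul_mem ht ht1 hh hlam).2.trans (le_trans (mul_le_mul_of_nonneg_left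
      (Real.rpow_le_rpow_of_exponent_ge ht ht1 (by linarith [hh.2])) hC.le) htC)
  refine (abs_log_one_sub_sub_le (hκ.mul_mem ht ht1 hH hlam).1 (hκ.mul_mem ht ht1 hH' hlam).1
    (hsmall H hH) (hsmall H' hH')).trans ?_
  set τ := t ^ (2 - 2 * H) with hτ
  have hτ0 : 0 < τ := Real.rpow_pos_of_pos ht _
  have e1 : t ^ (2 - 2 * H') = τ * Real.exp (2 * Real.log t * (H - H')) := by
    rw [hτ, show 2 * Real.log t * (H - H') = Real.log t * (2 * (H - H')) by ring,
      ← Real.rpow_def_of_pos ht, ← Real.rpow_add ht]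
    congr 1; ring
  have hlog : Real.log t ≤ 0 := Real.log_nonpos ht.le ht1
  have e2 := Real.add_one_le_exp (2 * Real.log t * (H - H'))
  have e3 : Real.exp (2 * Real.log t * (H - H')) ≤ 1 := by
    rw [Real.exp_le_one_iff]; nlinarith
  have e4 := hκ.lipschitz_left t ht ht1 H hH H' hH' lam hlam
  rw [abs_of_nonneg (sub_nonneg.2 hle)] at e4
  have e5 := hκ.nonneg t ht ht1 H' hH' lam hlam
  have e6 := hκ.le t ht ht1 H' hH' lam hlam
  rw [e1, show τ * κ t H lam - τ * Real.exp (2 * Real.log t * (H - H')) * κ t H' lam =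
    τ * ((κ t H lam - κ t H' lam) + (1 - Real.exp (2 * Real.log t * (H - H'))) * κ t H' lam) by ring,
    abs_mul, abs_of_pos hτ0]
  have e7 : |(κ t H lam - κ t H' lam) + (1 - Real.exp (2 * Real.log t * (H - H'))) * κ t H' lam| ≤
      C * (H - H') + (2 * -Real.log t * (H - H')) * C := by
    refine (abs_add_le _ _).trans (add_le_add e4 ?_)
    rw [abs_of_nonneg (mul_nonneg (by linarith) e5)]
    exact mul_le_mul (by linarith) e6 e5 (by nlinarith)
  nlinarith [mul_le_mul_of_nonneg_left e7 hτ0.le]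

/-- The first estimate is a crude Lipschitz bound. The second isolates the leading term and leaves
an error which is small relative to t^(2-2H) |λ'-λ| as t → 0. -/
theorem abs_log_sub_right_le (hκ : IsRegularRemainder κ k (Set.Icc h₁ h₂) J C k₀ p) (hC : 0 < C)
    {t : ℝ} (ht : 0 < t) (ht1 : t ≤ 1) (htC : C * t ^ (2 - 2 * h₂) ≤ 1 / 2) {H : ℝ}
    (hH : H ∈ Set.Icc h₁ h₂) {lam lam' : ℝ} (hlam : lam ∈ J) (hlam' : lam' ∈ J) :
    |Real.log (1 - t ^ (2 - 2 * H) * κ t H lam') - Real.log (1 - t ^ (2 - 2 * H) * κ t H lam)| ≤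
      2 * C * t ^ (2 - 2 * H) * |lam' - lam| ∧
    |Real.log (1 - t ^ (2 - 2 * H) * κ t H lam') - Real.log (1 - t ^ (2 - 2 * H) * κ t H lam) +
      t ^ (2 - 2 * H) * ((lam' - lam) * k H lam lam')| ≤
      t ^ (2 - 2 * H) * |lam' - lam| * (C * t ^ p + 2 * C ^ 2 * t ^ (2 - 2 * h₂)) := by
  set τ := t ^ (2 - 2 * H) with hτ
  have hτ0 : 0 < τ := Real.rpow_pos_of_pos ht _
  have hτle : τ ≤ t ^ (2 - 2 * h₂) :=
    Real.rpow_le_rpow_of_exponent_ge ht ht1 (by linarith [hH.2])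
  have hCτ : C * τ ≤ 1 / 2 := (mul_le_mul_of_nonneg_left hτle hC.le).trans htC
  obtain ⟨m1, m2⟩ := hκ.mul_mem ht ht1 hH hlam
  obtain ⟨m1', m2'⟩ := hκ.mul_mem ht ht1 hH hlam'
  have e1 := hκ.lipschitz_right t ht ht1 H hH lam hlam lam' hlam'
  have e2 : |τ * κ t H lam' - τ * κ t H lam| ≤ τ * (C * |lam' - lam|) := by
    rw [← mul_sub, abs_mul, abs_of_pos hτ0]
    exact mul_le_mul_of_nonneg_left e1 hτ0.le
  refine ⟨(abs_log_one_sub_sub_le m1' m1 (m2'.trans hCτ) (m2.trans hCτ)).trans (by linarith), ?_⟩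
  have e3 := abs_log_one_sub_sub_add_le m1' m1 m2' m2 hCτ
  have e4 := hκ.slope t ht ht1 H hH lam hlam lam' hlam'
  calc _ = |(Real.log (1 - τ * κ t H lam') - Real.log (1 - τ * κ t H lam) +
          (τ * κ t H lam' - τ * κ t H lam)) -
          τ * (κ t H lam' - κ t H lam - (lam' - lam) * k H lam lam')| := by congr 1; ring
    _ ≤ 2 * (C * τ) * (τ * (C * |lam' - lam|)) + τ * (C * t ^ p * |lam' - lam|) := by
        refine (abs_sub _ _).trans (add_le_add (e3.trans ?_) ?_)
        · exact mul_le_mul_of_nonneg_left e2 (by positivity)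
        · rw [abs_mul, abs_of_pos hτ0]
          exact mul_le_mul_of_nonneg_left e4 hτ0.le
    _ ≤ 2 * (C * t ^ (2 - 2 * h₂)) * (τ * (C * |lam' - lam|)) + τ * (C * t ^ p * |lam' - lam|) := by
        gcongr
    _ = _ := by ring

/-- At the lags nα with 1 ≤ n ≤ 3 all powers are comparable with α^(2-2H), since n^(2-2H) ≤ 9; hence
the constants 18 = 2 · 9. -/
theorem abs_log_sub_le_at_multiple (hκ : IsRegularRemainder κ k (Set.Icc h₁ h₂) J C k₀ p)
    (hC : 0 < C) (h0 : 0 < h₁) (h1 : h₂ < 1) (hp : 0 ≤ p) {α B : ℝ}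
    (hB : B = 18 * C * (2 * -Real.log α + 1)) (hα : 0 < α)
    (hα1 : 3 * α ≤ 1) (hα2 : C * (3 * α) ^ (2 - 2 * h₂) ≤ 1 / 2) {H H' : ℝ}
    (hH : H ∈ Set.Icc h₁ h₂) (hH' : H' ∈ Set.Icc h₁ h₂) (hle : H' ≤ H) {lam lam' : ℝ}
    (hlam : lam ∈ J) (hlam' : lam' ∈ J) {ℓ : ℝ → ℝ → ℝ → ℝ}
    (hℓ : ∀ n h l, ℓ n h l = Real.log (1 - (n * α) ^ (2 - 2 * h) * κ (n * α) h l)) {n : ℝ}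
    (hn1 : 1 ≤ n) (hn3 : n ≤ 3) :
    |ℓ n H lam' - ℓ n H' lam'| ≤ B * α ^ (2 - 2 * H) * (H - H') ∧
    |ℓ n H lam - ℓ n H lam'| ≤ 18 * C * α ^ (2 - 2 * H) * |lam - lam'| ∧
    |ℓ n H lam - ℓ n H lam' + n ^ (2 - 2 * H) *
        (α ^ (2 - 2 * H) * ((lam - lam') * k H lam' lam))| ≤
      9 * α ^ (2 - 2 * H) * |lam - lam'| *
        (C * (3 * α) ^ p + 2 * C ^ 2 * (3 * α) ^ (2 - 2 * h₂)) := by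
  set M := α ^ (2 - 2 * H) with hM
  have hM0 : 0 < M := Real.rpow_pos_of_pos hα _
  have ht : 0 < n * α := by positivity
  have ht3 : n * α ≤ 3 * α := mul_le_mul_of_nonneg_right hn3 hα.le
  have ht1 : n * α ≤ 1 := ht3.trans hα1
  have hpow : (n * α) ^ (2 - 2 * h₂) ≤ (3 * α) ^ (2 - 2 * h₂) :=
    Real.rpow_le_rpow ht.le ht3 (by linarith)
  have htC : C * (n * α) ^ (2 - 2 * h₂) ≤ 1 / 2 :=
    (mul_le_mul_of_nonneg_left hpow hC.le).trans hα2
  set τ := (n * α) ^ (2 - 2 * H) with hτ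
  have hτM : τ = n ^ (2 - 2 * H) * M := Real.mul_rpow (by linarith) hα.le
  have hn9 : n ^ (2 - 2 * H) ≤ 9 := by
    calc n ^ (2 - 2 * H) ≤ n ^ (2 : ℝ) :=
          Real.rpow_le_rpow_of_exponent_le hn1 (by linarith [hH.1])
      _ ≤ 9 := by rw [Real.rpow_two]; nlinarith
  have hτ9 : τ ≤ 9 * M := by
    rw [hτM]; exact mul_le_mul_of_nonneg_right hn9 hM0.le
  have hτ0 : 0 ≤ τ := Real.rpow_nonneg ht.le _
  have hlog : -Real.log (n * α) ≤ -Real.log α := by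
    rw [neg_le_neg_iff]
    exact Real.log_le_log hα (by nlinarith)
  have hlog0 : Real.log (n * α) ≤ 0 := Real.log_nonpos ht.le ht1
  have e1 := hκ.abs_log_sub_left_le hC ht ht1 htC hH hH' hle hlam'
  have e2 := hκ.abs_log_sub_right_le hC ht ht1 htC hH hlam' hlam
  simp only [hℓ]
  refine ⟨e1.trans ?_, e2.1.trans ?_, ?_⟩
  · refine mul_le_mul_of_nonneg_right ?_ (sub_nonneg.2 hle)
    calc 2 * C * (2 * -Real.log (n * α) + 1) * τ
        ≤ 2 * C * (2 * -Real.log α + 1) * (9 * M) :=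
          mul_le_mul (mul_le_mul_of_nonneg_left (by linarith) (by positivity)) hτ9 hτ0
            (mul_nonneg (by positivity) (by linarith))
      _ = B * M := by rw [hB]; ring
  · refine mul_le_mul_of_nonneg_right ?_ (abs_nonneg _)
    calc 2 * C * τ ≤ 2 * C * (9 * M) := mul_le_mul_of_nonneg_left hτ9 (by positivity)
      _ = _ := by ring
  · rw [← mul_assoc (n ^ (2 - 2 * H)), ← hτM]
    refine e2.2.trans (mul_le_mul (mul_le_mul_of_nonneg_right hτ9 (abs_nonneg _))
      (add_le_add ?_ ?_) ?_ ?_)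
    · exact mul_le_mul_of_nonneg_left (Real.rpow_le_rpow ht.le ht3 hp) hC.le
    · exact mul_le_mul_of_nonneg_left hpow (by positivity)
    · positivity
    · positivity

set_option maxHeartbeats 800000 in
-- Write x = H - H', y = |λ - λ'| and M = α^(2-2H). Subtracting the equations at n = 1 and n = 2
-- eliminates s and gives x = O(ε + BMx + My). The annihilating combination of n = 1, 2, 3
-- eliminates s and the linear terms in H, and gives cMy ≤ 6ε + 6BMx. The two inequalities contain
-- the same product My, so the second can be substituted in the first without dividing by the small
-- M; since BM is small, x is bounded by a multiple of ε. The bounds for y and for s follow.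
theorem exists_identification_of_le (hκ : IsRegularRemainder κ k (Set.Icc h₁ h₂) J C k₀ p)
    (hC : 0 < C) (hk₀ : 0 < k₀) (h0 : 0 < h₁) {ω₀ : ℝ} (hω₀ : 0 < ω₀)
    (hω : ∀ u ∈ Set.Icc (2 - 2 * h₂) (2 - 2 * h₁),
      ω₀ ≤ Real.log (3 / 2) - Real.log 3 * 2 ^ u + Real.log 2 * 3 ^ u)
    {α c B : ℝ} (hc : c = k₀ * ω₀ / 2) (hB : B = 18 * C * (2 * -Real.log α + 1)) (hα : 0 < α)
    (hα1 : 3 * α ≤ 1) (hα2 : C * (3 * α) ^ (2 - 2 * h₂) ≤ 1 / 2)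
    (hα3 : 54 * (C * (3 * α) ^ p + 2 * C ^ 2 * (3 * α) ^ (2 - 2 * h₂)) ≤ c)
    (hα4 : B * α ^ (2 - 2 * h₂) * (2 + 216 * C / c) ≤ 1 / 2) (hp : 0 ≤ p) (h1 : h₂ < 1) :
    ∃ A, ∀ H ∈ Set.Icc h₁ h₂, ∀ H' ∈ Set.Icc h₁ h₂, H' ≤ H → ∀ lam ∈ J, ∀ lam' ∈ J, ∀ s s' ε : ℝ,
      (∀ n : ℕ, 1 ≤ n → n ≤ 3 →
        |(s + 2 * H * Real.log (n * α) +
            Real.log (1 - (n * α) ^ (2 - 2 * H) * κ (n * α) H lam)) -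
          (s' + 2 * H' * Real.log (n * α) +
            Real.log (1 - (n * α) ^ (2 - 2 * H') * κ (n * α) H' lam'))| ≤ ε) →
      |H - H'| ≤ A * ε ∧ |lam - lam'| ≤ A * ε ∧ |s - s'| ≤ A * ε := by
  have hc0 : 0 < c := by rw [hc]; positivity
  have hlogα : Real.log α ≤ 0 := Real.log_nonpos hα.le (by linarith)
  have hB0 : 0 < B := by
    rw [hB]; have : 0 < 2 * -Real.log α + 1 := by linarith
    positivity
  -- After substitution x ≤ (2 + 216 C/c)(ε + BMx), and the term in x is at most x/2 by the last
  -- smallness condition on α.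
  set A₁ := 2 * (2 + 216 * C / c) with hA₁
  have hA₁0 : 0 < A₁ := by positivity
  -- Here one divides by M ≥ α². The constant blows up as α → 0, which is harmless because α is
  -- fixed.
  set A₂ := (6 + 6 * B * A₁) / (c * α ^ 2) with hA₂
  have hA₂0 : 0 < A₂ := by positivity
  set A₃ := 1 + 2 * A₁ * -Real.log α + B * A₁ + 18 * C * A₂ with hA₃
  have hA₃0 : 0 ≤ A₃ := by
    have : 0 ≤ 2 * A₁ * -Real.log α := mul_nonneg (by positivity) (by linarith)
    positivity
  refine ⟨A₁ + A₂ + A₃, fun H hH H' hH' hle lam hlam lam' hlam' s s' ε hε => ?_⟩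
  have hε0 : 0 ≤ ε := (abs_nonneg _).trans (hε 1 le_rfl (by norm_num))
  set x := H - H' with hx
  have hx0 : 0 ≤ x := sub_nonneg.2 hle
  set y := |lam - lam'| with hy
  have hy0 : 0 ≤ y := abs_nonneg _
  set M := α ^ (2 - 2 * H) with hM
  have hM0 : 0 < M := Real.rpow_pos_of_pos hα _
  have hMle : M ≤ α ^ (2 - 2 * h₂) :=
    Real.rpow_le_rpow_of_exponent_ge hα (by linarith) (by linarith [hH.2])
  have hM1 : M ≤ 1 := Real.rpow_le_one hα.le (by linarith) (by linarith [hH.2])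
  have hMge : α ^ 2 ≤ M := by
    rw [← Real.rpow_two]
    exact Real.rpow_le_rpow_of_exponent_ge hα (by linarith) (by linarith [hH.1])
  set ℓ : ℝ → ℝ → ℝ → ℝ := fun n h l =>
    Real.log (1 - (n * α) ^ (2 - 2 * h) * κ (n * α) h l) with hℓ
  set r := C * (3 * α) ^ p + 2 * C ^ 2 * (3 * α) ^ (2 - 2 * h₂) with hr
  have key : ∀ n : ℝ, 1 ≤ n → n ≤ 3 → _ := fun n hn1 hn3 =>
    hκ.abs_log_sub_le_at_multiple hC h0 h1 hp hB hα hα1 hα2 hH hH' hle hlam hlam'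
      (ℓ := ℓ) (fun _ _ _ => rfl) hn1 hn3
  have hF : ∀ n : ℕ, 1 ≤ n → n ≤ 3 → |s - s' + 2 * x * (Real.log n + Real.log α) +
      ((ℓ n H lam - ℓ n H lam') + (ℓ n H lam' - ℓ n H' lam'))| ≤ ε := by
    intro n hn1 hn3
    refine le_trans (le_of_eq ?_) (hε n hn1 hn3)
    have hn0 : (n : ℝ) ≠ 0 := by positivity
    rw [Real.log_mul hn0 hα.ne']
    congr 1
    simp only [hℓ, hx]
    ring
  have hF1 := hF 1 le_rfl (by norm_num)
  have hF2 := hF 2 (by norm_num) (by norm_num)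
  have hF3 := hF 3 (by norm_num) le_rfl
  obtain ⟨p1, q1, r1⟩ := key 1 le_rfl (by norm_num)
  obtain ⟨p2, q2, r2⟩ := key 2 (by norm_num) (by norm_num)
  obtain ⟨p3, q3, r3⟩ := key 3 (by norm_num) le_rfl
  simp only [Nat.cast_one, Nat.cast_ofNat, Real.log_one, zero_add, Real.one_rpow, one_mul]
    at hF1 hF2 hF3 r1 r2 r3
  set P1 := ℓ 1 H lam' - ℓ 1 H' lam'
  set P2 := ℓ 2 H lam' - ℓ 2 H' lam'
  set P3 := ℓ 3 H lam' - ℓ 3 H' lam'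
  set Q1 := ℓ 1 H lam - ℓ 1 H lam'
  set Q2 := ℓ 2 H lam - ℓ 2 H lam'
  set Q3 := ℓ 3 H lam - ℓ 3 H lam'
  set U := M * ((lam - lam') * k H lam' lam) with hU
  have l2 : 1 / 2 < Real.log 2 := by linarith [Real.log_two_gt_d9]
  have l2' : Real.log 2 ≤ 2 := by linarith [Real.log_two_lt_d9]
  have l3 : Real.log 3 ≤ 2 := by linarith [Real.log_le_sub_one_of_pos (x := 3) (by norm_num)]
  have l23 : Real.log 2 < Real.log 3 := Real.log_lt_log (by norm_num) (by norm_num)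
  -- the bound on the first parameter
  have hxle : x ≤ 2 * ε + 2 * (B * M * x) + 36 * C * M * y := by
    have h1 := abs_le.1 hF1
    have h2 := abs_le.1 hF2
    have := abs_le.1 p1
    have := abs_le.1 p2
    have := abs_le.1 q1
    have := abs_le.1 q2
    -- Between lags 1 and 2 the linear term changes by 2x log 2, which is at least x because log 2 >
    -- 1/2.
    have hxl : x ≤ 2 * (x * Real.log 2) := by
      have := mul_le_mul_of_nonneg_left l2.le hx0
      linarith
    linarith
  -- the bound on the second parameter
  have hyle : c * M * y ≤ 6 * ε + 6 * (B * M * x) := by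
    have hu := hω (2 - 2 * H) ⟨by linarith [hH.2], by linarith [hH.1]⟩
    have hk := hκ.le_slope H hH lam' hlam' lam hlam
    set W := Real.log (3 / 2) - Real.log 3 * 2 ^ (2 - 2 * H) + Real.log 2 * 3 ^ (2 - 2 * H) with hW
    have eU : |U * W| = M * y * (k H lam' lam * W) := by
      rw [hU, abs_mul, abs_mul, abs_mul, abs_of_pos hM0, abs_of_pos (hk₀.trans_le hk),
        abs_of_pos (hω₀.trans_le hu)]
      ring
    have hUW : 2 * c * (M * y) ≤ |U * W| := by
      rw [eU, hc, mul_comm]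
      refine mul_le_mul_of_nonneg_left ?_ (by positivity)
      rw [mul_div_cancel₀ _ two_ne_zero]
      exact mul_le_mul hk hu hω₀.le (hk₀.le.trans hk)
    have hlog32 : Real.log (3 / 2) = Real.log 3 - Real.log 2 :=
      Real.log_div (by norm_num) (by norm_num)
    -- In the last bracket s - s', x log α and x log n all cancel, by the choice of weights; what
    -- remains are the linearization errors, the H-variations and the data, each of which is
    -- bounded.
    have e : U * W = Real.log (3 / 2) * (Q1 + U) - Real.log 3 * (Q2 + 2 ^ (2 - 2 * H) * U) +
        Real.log 2 * (Q3 + 3 ^ (2 - 2 * H) * U) +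
        (Real.log (3 / 2) * P1 - Real.log 3 * P2 + Real.log 2 * P3) -
        (Real.log (3 / 2) * (s - s' + 2 * x * Real.log α + (Q1 + P1)) -
          Real.log 3 * (s - s' + 2 * x * (Real.log 2 + Real.log α) + (Q2 + P2)) +
          Real.log 2 * (s - s' + 2 * x * (Real.log 3 + Real.log α) + (Q3 + P3))) := by
      rw [hW, hlog32]; ring
    have comb : ∀ {u v w b : ℝ}, |u| ≤ b → |v| ≤ b → |w| ≤ b →
        |Real.log (3 / 2) * u - Real.log 3 * v + Real.log 2 * w| ≤ 6 * b := by
      intro u v w b hu hv hw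
      have hb : 0 ≤ b := (abs_nonneg _).trans hu
      have a1 : |Real.log (3 / 2) * u| ≤ 2 * b := by
        rw [abs_mul]
        refine mul_le_mul ?_ hu (abs_nonneg _) zero_le_two
        rw [hlog32, abs_of_nonneg (by linarith)]; linarith
      have a2 : |Real.log 3 * v| ≤ 2 * b := by
        rw [abs_mul]
        refine mul_le_mul ?_ hv (abs_nonneg _) zero_le_two
        rw [abs_of_nonneg (by linarith)]; linarith
      have a3 : |Real.log 2 * w| ≤ 2 * b := by
        rw [abs_mul]
        refine mul_le_mul ?_ hw (abs_nonneg _) zero_le_two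
        rw [abs_of_nonneg (by linarith)]; linarith
      refine (abs_add_le _ _).trans ?_
      linarith [abs_sub (Real.log (3 / 2) * u) (Real.log 3 * v)]
    have c1 := comb r1 r2 r3
    have c2 := comb p1 p2 p3
    have c3 := comb hF1 hF2 hF3
    have hsum : |U * W| ≤ 6 * (9 * M * y * r) + 6 * (B * M * x) + 6 * ε := by
      rw [e]
      refine (abs_sub _ _).trans (add_le_add ((abs_add_le _ _).trans (add_le_add c1 c2)) c3)
    -- The main term is at least 2cMy; the linearization error, 6 · 9 · rMy, consumes at most half
    -- of it.
    have hr54 : M * y * (54 * r) ≤ M * y * c := mul_le_mul_of_nonneg_left hα3 (by positivity)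
    linarith
  have hBM : B * M * (2 + 216 * C / c) ≤ 1 / 2 := le_trans (by gcongr) hα4
  have hyle' : 36 * C * M * y ≤ 36 * C / c * (6 * ε + 6 * (B * M * x)) := by
    calc 36 * C * M * y = 36 * C / c * (c * M * y) := by field_simp
      _ ≤ _ := mul_le_mul_of_nonneg_left hyle (by positivity)
  have hxA : x ≤ A₁ * ε := by
    have h1 := mul_le_mul_of_nonneg_right hBM hx0
    have h2 : 36 * C / c * (6 * ε + 6 * (B * M * x)) = 216 * C / c * ε + 216 * C / c * (B * M * x) := by
      ring
    rw [hA₁]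
    linarith
  have hyA : y ≤ A₂ * ε := by
    rw [hA₂, div_mul_eq_mul_div, le_div_iff₀ (by positivity)]
    have h1 : c * α ^ 2 * y ≤ c * M * y := by gcongr
    have h2 : B * M * x ≤ B * 1 * (A₁ * ε) := by gcongr
    linarith
  have hsA : |s - s'| ≤ A₃ * ε := by
    have e : s - s' = (s - s' + 2 * x * Real.log α + (Q1 + P1)) + 2 * x * -Real.log α - Q1 - P1 := by
      ring
    have h1 : |s - s'| ≤ ε + 2 * x * -Real.log α + 18 * C * M * y + B * M * x := by
      rw [e]
      have h3 : |2 * x * -Real.log α| = 2 * x * -Real.log α :=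
        abs_of_nonneg (mul_nonneg (by positivity) (by linarith))
      refine (abs_sub _ _).trans (add_le_add ((abs_sub _ _).trans (add_le_add
        ((abs_add_le _ _).trans (add_le_add hF1 h3.le)) q1)) p1)
    have h2 : B * M * x ≤ B * 1 * (A₁ * ε) := by gcongr
    have h3 : 18 * C * M * y ≤ 18 * C * 1 * (A₂ * ε) := by gcongr
    have h4 : 2 * x * -Real.log α ≤ 2 * (A₁ * ε) * -Real.log α :=
      mul_le_mul_of_nonneg_right (by linarith) (by linarith)
    rw [hA₃]
    linarith
  rw [abs_of_nonneg hx0]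
  have m1 : 0 ≤ A₁ * ε := by positivity
  have m2 : 0 ≤ A₂ * ε := by positivity
  have m3 : 0 ≤ A₃ * ε := by positivity
  refine ⟨?_, ?_, ?_⟩ <;> linarith

theorem exists_identification (hκ : IsRegularRemainder κ k (Set.Icc h₁ h₂) J C k₀ p)
    (hC : 0 < C) (hk₀ : 0 < k₀) (hp : 0 < p) (h0 : 0 < h₁) (h1 : h₂ < 1) (h12 : h₁ ≤ h₂) :
    ∀ᶠ α in 𝓝[>] (0 : ℝ), 3 * α ≤ 1 ∧ C * (3 * α) ^ (2 - 2 * h₂) ≤ 1 / 2 ∧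
      ∃ A, ∀ H ∈ Set.Icc h₁ h₂, ∀ H' ∈ Set.Icc h₁ h₂, ∀ lam ∈ J, ∀ lam' ∈ J, ∀ s s' ε : ℝ,
      (∀ n : ℕ, 1 ≤ n → n ≤ 3 →
        |(s + 2 * H * Real.log (n * α) +
            Real.log (1 - (n * α) ^ (2 - 2 * H) * κ (n * α) H lam)) -
          (s' + 2 * H' * Real.log (n * α) +
            Real.log (1 - (n * α) ^ (2 - 2 * H') * κ (n * α) H' lam'))| ≤ ε) →
      |H - H'| ≤ A * ε ∧ |lam - lam'| ≤ A * ε ∧ |s - s'| ≤ A * ε := by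
  obtain ⟨ω₀, hω₀, hω⟩ := exists_le_log_mul_rpow_combination (u₁ := 2 - 2 * h₂)
    (u₂ := 2 - 2 * h₁) (by linarith) (by linarith)
  set c := k₀ * ω₀ / 2 with hc
  have hc0 : 0 < c := by positivity
  have hpow : ∀ {q : ℝ}, 0 < q → Tendsto (fun α : ℝ => (3 * α) ^ q) (𝓝[>] 0) (𝓝 0) := by
    intro q hq
    have h2 : Continuous fun α : ℝ => (3 * α) ^ q :=
      (Real.continuous_rpow_const hq.le).comp (by fun_prop)
    have := (h2.tendsto 0).mono_left (nhdsWithin_le_nhds (s := Set.Ioi 0))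
    simpa [Real.zero_rpow hq.ne'] using this
  have hpow1 : ∀ {q : ℝ}, 0 < q → Tendsto (fun α : ℝ => α ^ q) (𝓝[>] 0) (𝓝 0) := by
    intro q hq
    have := ((Real.continuous_rpow_const hq.le).tendsto 0).mono_left
      (nhdsWithin_le_nhds (s := Set.Ioi (0 : ℝ)))
    simpa [Real.zero_rpow hq.ne'] using this
  have hq : 0 < 2 - 2 * h₂ := by linarith
  have t1 : Tendsto (fun α : ℝ => 3 * α) (𝓝[>] 0) (𝓝 0) := by
    have : Tendsto (fun α : ℝ => 3 * α) (𝓝 0) (𝓝 (3 * 0)) := tendsto_id.const_mul 3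
    rw [mul_zero] at this
    exact this.mono_left nhdsWithin_le_nhds
  have t2 : Tendsto (fun α : ℝ => C * (3 * α) ^ (2 - 2 * h₂)) (𝓝[>] 0) (𝓝 0) := by
    simpa using (hpow hq).const_mul C
  have t3 : Tendsto (fun α : ℝ => 54 * (C * (3 * α) ^ p + 2 * C ^ 2 * (3 * α) ^ (2 - 2 * h₂)))
      (𝓝[>] 0) (𝓝 0) := by
    simpa using (((hpow hp).const_mul C).add ((hpow hq).const_mul (2 * C ^ 2))).const_mul 54
  -- B grows like -log α, but the positive power of α wins.
  have t4 : Tendsto (fun α : ℝ => 18 * C * (2 * -Real.log α + 1) * α ^ (2 - 2 * h₂) *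
      (2 + 216 * C / c)) (𝓝[>] 0) (𝓝 0) := by
    have h := ((((tendsto_log_mul_rpow_nhdsGT_zero hq).const_mul (-2)).add (hpow1 hq)).const_mul
      (18 * C)).mul_const (2 + 216 * C / c)
    simp only [mul_zero, add_zero, zero_mul] at h
    refine h.congr fun α => ?_
    ring
  filter_upwards [self_mem_nhdsWithin, t1.eventually (ge_mem_nhds one_pos),
    t2.eventually (ge_mem_nhds (by norm_num : (0 : ℝ) < 1 / 2)), t3.eventually (ge_mem_nhds hc0),
    t4.eventually (ge_mem_nhds (by norm_num : (0 : ℝ) < 1 / 2))] with α hα a1 a2 a3 a4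
  obtain ⟨A, hA⟩ := hκ.exists_identification_of_le hC hk₀ h0 hω₀ hω hc rfl hα a1 a2 a3 a4 hp.le h1
  refine ⟨a1, a2, A, fun H hH H' hH' lam hlam lam' hlam' s s' ε hε => ?_⟩
  rcases le_total H' H with h | h
  · exact hA H hH H' hH' h lam hlam lam' hlam' s s' ε hε
  · rw [abs_sub_comm H, abs_sub_comm lam, abs_sub_comm s]
    exact hA H' hH' H hH h lam' hlam' lam hlam s' s ε fun n h1 h2 => by
      rw [abs_sub_comm]; exact hε n h1 h2

end IsRegularRemainder

end


/-! ### Lipschitz inversion of the variogram and of the filtered variances -/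

section

theorem abs_log_sub_log_le {x y d : ℝ} (hd : 0 < d) (hx : d ≤ x) (hy : d ≤ y) :
    |Real.log x - Real.log y| ≤ |x - y| / d := by
  have key : ∀ {x y : ℝ}, d ≤ x → d ≤ y → Real.log x - Real.log y ≤ |x - y| / d := by
    intro x y hx hy
    have hy0 := hd.trans_le hy
    rw [← Real.log_div (hd.trans_le hx).ne' hy0.ne']
    refine (Real.log_le_sub_one_of_pos (div_pos (hd.trans_le hx) hy0)).trans ?_
    rw [div_sub_one hy0.ne']
    calc (x - y) / y ≤ |x - y| / y := by gcongr; exact le_abs_self _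
      _ ≤ |x - y| / d := by gcongr
  rw [abs_sub_le_iff]
  refine ⟨key hx hy, ?_⟩
  rw [abs_sub_comm]
  exact key hy hx

theorem abs_sub_le_mul_abs_log_sub_log {x y m : ℝ} (hx : 0 < x) (hy : 0 < y) (hxm : x ≤ m)
    (hym : y ≤ m) : |x - y| ≤ m * |Real.log x - Real.log y| := by
  have key : ∀ {x y : ℝ}, 0 < x → 0 < y → x ≤ m → x - y ≤ m * |Real.log x - Real.log y| := by
    intro x y hx hy hxm
    have h := Real.log_le_sub_one_of_pos (div_pos hy hx)
    rw [Real.log_div hy.ne' hx.ne', div_sub_one hx.ne', le_div_iff₀ hx] at h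
    have h2 := le_abs_self (Real.log x - Real.log y)
    nlinarith [abs_nonneg (Real.log x - Real.log y)]
  rw [abs_sub_le_iff]
  refine ⟨key hx hy hxm, ?_⟩
  rw [abs_sub_comm]
  exact key hy hx hym

theorem norm_le_sum_abs_fin_three (v : EuclideanSpace ℝ (Fin 3)) :
    ‖v‖ ≤ |v 0| + |v 1| + |v 2| := by
  rw [EuclideanSpace.norm_eq, Fin.sum_univ_three, Real.norm_eq_abs, Real.norm_eq_abs,
    Real.norm_eq_abs]
  refine Real.sqrt_le_iff.2 ⟨by positivity, ?_⟩
  nlinarith [mul_nonneg (abs_nonneg (v 0)) (abs_nonneg (v 1)),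
    mul_nonneg (abs_nonneg (v 0)) (abs_nonneg (v 2)),
    mul_nonneg (abs_nonneg (v 1)) (abs_nonneg (v 2))]

variable {lo hi : EuclideanSpace ℝ (Fin 3)}

/-- For small steps, the parameters depend in a Lipschitz way on the variogram at three lags. -/
theorem eventually_norm_sub_le_of_variogram (hH_pos : 0 < lo 0) (hH_lt : hi 0 < 1)
    (hlam_pos : 0 < lo 1) (hsigma : 0 < lo 2 ∨ hi 2 < 0) :
    ∀ᶠ α in 𝓝[>] (0 : ℝ), ∃ A, ∀ θ ∈ rectangle lo hi, ∀ θ' ∈ rectangle lo hi, ∀ ε : ℝ,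
      (∀ n : ℕ, 1 ≤ n → n ≤ 3 →
        |(rho θ 0 - rho θ (α * n)) - (rho θ' 0 - rho θ' (α * n))| ≤ ε) → ‖θ - θ'‖ ≤ A * ε := by
  rcases (rectangle lo hi).eq_empty_or_nonempty with hemp | ⟨θ₁, hθ₁⟩
  · simp [hemp]
  obtain ⟨k, C, k₀, p, hC, hk₀, hp, hκ⟩ := exists_isRegularRemainder hH_pos hH_lt
    ((hθ₁ 0).1.trans (hθ₁ 0).2) hlam_pos ((hθ₁ 1).1.trans (hθ₁ 1).2)
  -- The variogram only determines σ². The known sign gives |σ + σ'| ≥ 2m, which turns a bound on σ²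
  -- - σ'² into one on σ - σ'. Only M² is used, so M may be negative.
  obtain ⟨m, M, hm, hσ⟩ : ∃ m M : ℝ, 0 < m ∧ ∀ θ ∈ rectangle lo hi, ∀ θ' ∈ rectangle lo hi,
      m ^ 2 ≤ θ 2 ^ 2 ∧ θ 2 ^ 2 ≤ M ^ 2 ∧ 2 * m ≤ |θ 2 + θ' 2| := by
    rcases hsigma with h | h
    · refine ⟨lo 2, hi 2, h, fun θ hθ θ' hθ' => ?_⟩
      have := hθ 2
      have := hθ' 2
      refine ⟨by nlinarith, by nlinarith, ?_⟩
      rw [abs_of_nonneg (by linarith)]; linarith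
    · refine ⟨-hi 2, lo 2, by linarith, fun θ hθ θ' hθ' => ?_⟩
      have := hθ 2
      have := hθ' 2
      refine ⟨by nlinarith, by nlinarith, ?_⟩
      rw [abs_of_nonpos (by linarith)]; linarith
  filter_upwards [self_mem_nhdsWithin,
    hκ.exists_identification hC hk₀ hp hH_pos hH_lt ((hθ₁ 0).1.trans (hθ₁ 0).2)]
    with α hα h
  obtain ⟨h3α, hCα, A, hA⟩ := h
  have hα0 : (0 : ℝ) < α := hα
  -- A common lower bound for the variogram at the three lags, needed to take logarithms: σ²/2 ≥
  -- m²/2, (nα)^(2H) ≥ α², and the correction factor is at least 1/2.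
  set d := m ^ 2 / 2 * α ^ 2 * (1 / 2) with hd
  have hd0 : 0 < d := by positivity
  have hD : ∀ θ ∈ rectangle lo hi, ∀ n : ℕ, 1 ≤ n → n ≤ 3 →
      d ≤ rho θ 0 - rho θ (α * n) ∧ Real.log (rho θ 0 - rho θ (α * n)) =
        Real.log (θ 2 ^ 2 / 2) + 2 * θ 0 * Real.log (n * α) +
          Real.log (1 - (n * α) ^ (2 - 2 * θ 0) * varioRemainder (n * α) (θ 0) (θ 1)) := by
    intro θ hθ n hn1 hn3
    have hn1' : (1 : ℝ) ≤ n := by exact_mod_cast hn1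
    have hn3' : (n : ℝ) ≤ 3 := by exact_mod_cast hn3
    have ht : 0 < (n : ℝ) * α := by positivity
    have ht3 : (n : ℝ) * α ≤ 3 * α := mul_le_mul_of_nonneg_right hn3' hα0.le
    have ht1 : (n : ℝ) * α ≤ 1 := ht3.trans h3α
    have h0 : 0 < θ 0 := hH_pos.trans_le (hθ 0).1
    have h1 : θ 0 < 1 := (hθ 0).2.trans_lt hH_lt
    have hR : (n * α) ^ (2 - 2 * θ 0) * varioRemainder (n * α) (θ 0) (θ 1) ≤ 1 / 2 := by
      refine (hκ.mul_mem ht ht1 (hθ 0) (hθ 1)).2.trans (le_trans ?_ hCα)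
      refine mul_le_mul_of_nonneg_left ?_ hC.le
      calc ((n : ℝ) * α) ^ (2 - 2 * θ 0) ≤ ((n : ℝ) * α) ^ (2 - 2 * hi 0) :=
            Real.rpow_le_rpow_of_exponent_ge ht ht1 (by linarith [(hθ 0).2])
        _ ≤ _ := Real.rpow_le_rpow ht.le ht3 (by linarith)
    have hσ1 := (hσ θ hθ θ hθ).1
    have hσ0 : 0 < θ 2 ^ 2 := lt_of_lt_of_le (by positivity) hσ1
    have hpow : α ^ 2 ≤ ((n : ℝ) * α) ^ (2 * θ 0) := by
      calc α ^ 2 ≤ ((n : ℝ) * α) ^ 2 := pow_le_pow_left₀ hα0.le (by nlinarith) 2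
        _ = ((n : ℝ) * α) ^ (2 : ℝ) := (Real.rpow_two _).symm
        _ ≤ _ := Real.rpow_le_rpow_of_exponent_ge ht ht1 (by linarith)
    rw [mul_comm α, rho_zero_sub_rho h0 h1 (hlam_pos.trans_le (hθ 1).1) ht]
    refine ⟨mul_le_mul (mul_le_mul (by linarith) hpow (by positivity) (by positivity))
      (by linarith) (by norm_num) (by positivity), ?_⟩
    rw [Real.log_mul (by positivity) (by linarith), Real.log_mul (by positivity) (by positivity),
      Real.log_rpow ht]
  refine ⟨(A + A + M ^ 2 / 2 * A / m) / d, fun θ hθ θ' hθ' ε hε => ?_⟩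
  have hlog : ∀ n : ℕ, 1 ≤ n → n ≤ 3 → |Real.log (rho θ 0 - rho θ (α * n)) -
      Real.log (rho θ' 0 - rho θ' (α * n))| ≤ ε / d := fun n h1 h2 =>
    (abs_log_sub_log_le hd0 (hD θ hθ n h1 h2).1 (hD θ' hθ' n h1 h2).1).trans
      (div_le_div_of_nonneg_right (hε n h1 h2) hd0.le)
  obtain ⟨b0, b1, b2⟩ := hA (θ 0) (hθ 0) (θ' 0) (hθ' 0) (θ 1) (hθ 1) (θ' 1) (hθ' 1)
    (Real.log (θ 2 ^ 2 / 2)) (Real.log (θ' 2 ^ 2 / 2)) (ε / d) fun n h1 h2 => by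
      have := hlog n h1 h2
      rwa [(hD θ hθ n h1 h2).2, (hD θ' hθ' n h1 h2).2] at this
  have hm2 : 0 < m ^ 2 := by positivity
  have s1 := hσ θ hθ θ' hθ'
  have s2 := hσ θ' hθ' θ hθ
  have b3 := abs_sub_le_mul_abs_log_sub_log (x := θ 2 ^ 2 / 2) (y := θ' 2 ^ 2 / 2)
    (m := M ^ 2 / 2) (by linarith) (by linarith) (by linarith) (by linarith)
  have e1 : |θ 2 ^ 2 / 2 - θ' 2 ^ 2 / 2| = |θ 2 - θ' 2| * |θ 2 + θ' 2| / 2 := by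
    rw [← abs_mul, ← abs_two (α := ℝ), ← abs_div, abs_two]
    congr 1; ring
  have b4 : |θ 2 - θ' 2| ≤ M ^ 2 / 2 * A / m * (ε / d) := by
    rw [div_mul_eq_mul_div, le_div_iff₀ hm]
    have h5 := mul_le_mul_of_nonneg_left s1.2.2 (abs_nonneg (θ 2 - θ' 2))
    have h6 : M ^ 2 / 2 * |Real.log (θ 2 ^ 2 / 2) - Real.log (θ' 2 ^ 2 / 2)| ≤
      M ^ 2 / 2 * (A * (ε / d)) := mul_le_mul_of_nonneg_left b2 (by positivity)
    rw [e1] at b3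
    linarith
  refine (norm_le_sum_abs_fin_three _).trans ?_
  calc |(θ - θ') 0| + |(θ - θ') 1| + |(θ - θ') 2|
      ≤ A * (ε / d) + A * (ε / d) + M ^ 2 / 2 * A / m * (ε / d) :=
        add_le_add (add_le_add b0 b1) b4
    _ = _ := by ring

/-! ### Identification from the variances of the filtered process -/

theorem bMatrix_mulVec {L : ℕ} (a : Fin L → Fin (L + 1) → ℝ) (w : Fin (L + 1) → ℝ) (ℓ : Fin L) :
    (bMatrix a).mulVec w ℓ = ∑ k, bVec (a ℓ) k * w k := rfl

/-- Full rank L on L + 1 columns leaves a one-dimensional kernel, which must be spanned by the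
constant vector. Vectors with vanishing first entry meet it only in 0, and an injective linear map
in finite dimension is bounded below. -/
theorem exists_norm_le_of_bMatrix {L : ℕ} {a : Fin L → Fin (L + 1) → ℝ}
    (ha : ∀ ℓ, ∑ q, a ℓ q = 0) (hrank : (bMatrix a).rank = L) :
    ∃ K : ℝ, ∀ w : Fin (L + 1) → ℝ, w 0 = 0 → ‖w‖ ≤ K * ‖(bMatrix a).mulVec w‖ := by
  set T : (Fin (L + 1) → ℝ) →ₗ[ℝ] ℝ × (Fin L → ℝ) :=
    (LinearMap.proj 0).prod (bMatrix a).mulVecLin with hT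
  have hone : (1 : Fin (L + 1) → ℝ) ∈ LinearMap.ker (bMatrix a).mulVecLin := by
    rw [LinearMap.mem_ker]
    ext ℓ
    rw [Matrix.mulVecLin_apply, bMatrix_mulVec]
    simpa using sum_bVec_eq_zero (ha ℓ)
  have hdim : Module.finrank ℝ (LinearMap.ker (bMatrix a).mulVecLin) = 1 := by
    have := LinearMap.finrank_range_add_finrank_ker (bMatrix a).mulVecLin
    rw [Module.finrank_fin_fun] at this
    rw [Matrix.rank] at hrank
    omega
  have hker : LinearMap.ker T = ⊥ := by
    rw [LinearMap.ker_eq_bot']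
    intro w hw
    have hw0 : w 0 = 0 := congrArg Prod.fst hw
    have hw1 : w ∈ LinearMap.ker (bMatrix a).mulVecLin := congrArg Prod.snd hw
    obtain ⟨c, hc⟩ := (finrank_eq_one_iff_of_nonzero' (⟨1, hone⟩ : LinearMap.ker
      (bMatrix a).mulVecLin) (fun h => one_ne_zero (congrArg Subtype.val h))).1 hdim ⟨w, hw1⟩
    have hc' : c • (1 : Fin (L + 1) → ℝ) = w := congrArg Subtype.val hc
    have hc0 : c = 0 := by rw [← hw0, ← hc']; simp
    rw [← hc', hc0, zero_smul]
  obtain ⟨K, _, hK⟩ := LinearMap.exists_antilipschitzWith T hker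
  refine ⟨K, fun w hw => ?_⟩
  have := hK.le_mul_norm_sub w 0
  rw [map_zero, add_zero, add_zero, norm_neg, norm_neg] at this
  refine this.trans (mul_le_mul_of_nonneg_left ?_ K.2)
  have e : T w = (0, (bMatrix a).mulVec w) := Prod.ext hw rfl
  rw [e, Prod.norm_mk, norm_zero, max_eq_right (norm_nonneg _)]

theorem V_sub_V {L : ℕ} {a : Fin (L + 1) → ℝ} (ha : ∑ q, a q = 0) (α : ℝ)
    (θ θ' : EuclideanSpace ℝ (Fin 3)) :
    V a α θ - V a α θ' = -∑ k : Fin (L + 1), bVec a k *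
      ((rho θ 0 - rho θ (α * (k : ℕ))) - (rho θ' 0 - rho θ' (α * (k : ℕ)))) := by
  have h := sum_bVec_eq_zero ha
  have e : ∑ k : Fin (L + 1), bVec a k *
      ((rho θ 0 - rho θ (α * (k : ℕ))) - (rho θ' 0 - rho θ' (α * (k : ℕ)))) =
      (∑ k, bVec a k) * (rho θ 0 - rho θ' 0) - (V a α θ - V a α θ') := by
    unfold V
    rw [Finset.sum_mul, ← Finset.sum_sub_distrib, ← Finset.sum_sub_distrib]
    exact Finset.sum_congr rfl fun k _ => by ring
  rw [e, h]; ring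

/-- For small steps, the parameters depend in a Lipschitz way on the variances of the filtered
process. -/
theorem exists_identifying_step (hH_pos : 0 < lo 0) (hH_lt : hi 0 < 1)
    (hlam_pos : 0 < lo 1) (hsigma : 0 < lo 2 ∨ hi 2 < 0) :
    ∃ α₀ : ℝ, 0 < α₀ ∧ ∀ α : ℝ, 0 < α → α < α₀ → ∀ L : ℕ, 3 ≤ L →
      ∀ a : Fin L → Fin (L + 1) → ℝ, (∀ ℓ, ∑ q, a ℓ q = 0) → (bMatrix a).rank = L →
      ∃ K : ℝ, ∀ θ ∈ rectangle lo hi, ∀ θ' ∈ rectangle lo hi,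
        ‖θ - θ'‖ ≤ K * ‖fun ℓ => V (a ℓ) α θ - V (a ℓ) α θ'‖ := by
  -- The threshold comes from the variogram alone, before L and the filters are chosen; they only
  -- affect the constant K.
  obtain ⟨α₀, hα₀, h⟩ := mem_nhdsGT_iff_exists_Ioo_subset.1
    (eventually_norm_sub_le_of_variogram hH_pos hH_lt hlam_pos hsigma)
  refine ⟨α₀, hα₀, fun α hα hαα L hL a ha hrank => ?_⟩
  obtain ⟨A, hA⟩ := h ⟨hα, hαα⟩
  obtain ⟨K, hK⟩ := exists_norm_le_of_bMatrix ha hrank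
  refine ⟨A * K, fun θ hθ θ' hθ' => ?_⟩
  set w : Fin (L + 1) → ℝ := fun k =>
    (rho θ 0 - rho θ (α * (k : ℕ))) - (rho θ' 0 - rho θ' (α * (k : ℕ))) with hw
  have hw0 : w 0 = 0 := by simp [hw]
  have e : (fun ℓ => V (a ℓ) α θ - V (a ℓ) α θ') = -(bMatrix a).mulVec w := by
    ext ℓ
    rw [V_sub_V (ha ℓ), Pi.neg_apply, bMatrix_mulVec]
  rw [e, norm_neg, mul_assoc]
  refine hA θ hθ θ' hθ' _ fun n hn1 hn3 => ?_
  refine le_trans ?_ (hK w hw0)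
  -- L ≥ 3 guarantees that the three lags used for identification are among the entries of `w`.
  exact norm_le_pi_norm w ⟨n, by omega⟩

end


section

/-! ### Minimum distance estimation -/

/-- A factorization A = B'B turns the GMM criterion into a squared Euclidean norm, so that
orthogonality arguments apply. -/
theorem exists_isometry_of_posDef {L : ℕ} {A : Matrix (Fin L) (Fin L) ℝ} (hA : A.PosDef) :
    ∃ S : (Fin L → ℝ) →L[ℝ] EuclideanSpace ℝ (Fin L),
      (∀ x y, inner ℝ (S x) (S y) = x ⬝ᵥ A.mulVec y) ∧ ∃ c > 0, ∀ x, ‖x‖ ≤ c * ‖S x‖ := by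
  open scoped MatrixOrder in
  obtain ⟨B, hB⟩ := CStarAlgebra.nonneg_iff_eq_star_mul_self.mp hA.posSemidef.nonneg
  have hBA : B.transpose * B = A := by
    rw [hB, Matrix.star_eq_conjTranspose, Matrix.conjTranspose_eq_transpose_of_trivial]
  set S : (Fin L → ℝ) →ₗ[ℝ] EuclideanSpace ℝ (Fin L) :=
    (WithLp.linearEquiv 2 ℝ (Fin L → ℝ)).symm.toLinearMap ∘ₗ B.mulVecLin with hS
  have hSx : ∀ x, S x = WithLp.toLp 2 (B.mulVec x) := fun x => rfl
  have hinner : ∀ x y, inner ℝ (S x) (S y) = x ⬝ᵥ A.mulVec y := by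
    intro x y
    rw [hSx, hSx, EuclideanSpace.inner_toLp_toLp, star_trivial, ← hBA, ← Matrix.mulVec_mulVec,
      Matrix.dotProduct_mulVec x, Matrix.vecMul_transpose, dotProduct_comm]
  have hker : LinearMap.ker S = ⊥ := by
    rw [LinearMap.ker_eq_bot']
    intro x hx
    by_contra h
    have h1 := hA.dotProduct_mulVec_pos h
    rw [star_trivial, ← hinner, hx, inner_zero_left] at h1
    exact lt_irrefl _ h1
  obtain ⟨c, hc, hc'⟩ := LinearMap.exists_antilipschitzWith S hker
  refine ⟨LinearMap.toContinuousLinearMap S, hinner, c, hc, fun x => ?_⟩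
  have := hc'.le_mul_norm_sub x 0
  simpa using this

section LeastSquares

variable {E F : Type*} [NormedAddCommGroup E] [NormedSpace ℝ E] [NormedAddCommGroup F]

/-- Apply the lower bound at θ₀ + tv, divide by t and let t → 0: the inverse Lipschitz estimate
passes to the derivative. -/
theorem norm_le_mul_norm_fderiv [NormedSpace ℝ F] {f : E → F} {T : E →L[ℝ] F} {θ₀ : E}
    {Θ : Set E} {K : ℝ} (hf : HasFDerivAt f T θ₀) (hf0 : f θ₀ = 0) (hΘ : Θ ∈ 𝓝 θ₀)
    (hK0 : 0 < K) (hK : ∀ θ ∈ Θ, ‖θ - θ₀‖ ≤ K * ‖f θ‖) (v : E) : ‖v‖ ≤ K * ‖T v‖ := by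
  refine le_of_forall_pos_le_add fun ε hε => ?_
  set η := ε / (K * (‖v‖ + 1)) with hη
  have hη0 : 0 < η := by positivity
  have h1 : ∀ᶠ θ in 𝓝 θ₀, θ ∈ Θ ∧ ‖f θ - f θ₀ - T (θ - θ₀)‖ ≤ η * ‖θ - θ₀‖ :=
    (eventually_mem_set.2 hΘ).and (hf.isLittleO.def hη0)
  have h2 : Tendsto (fun t : ℝ => θ₀ + t • v) (𝓝[>] 0) (𝓝 θ₀) := by
    have : Continuous fun t : ℝ => θ₀ + t • v := by fun_prop
    have h := (this.tendsto 0).mono_left (nhdsWithin_le_nhds (s := Set.Ioi 0))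
    simpa using h
  obtain ⟨t, ⟨htΘ, ht⟩, ht0⟩ := ((h2.eventually h1).and self_mem_nhdsWithin).exists
  have ht0 : (0 : ℝ) < t := ht0
  have h3 := hK _ htΘ
  rw [hf0, sub_zero, add_sub_cancel_left, map_smul, norm_smul, Real.norm_of_nonneg ht0.le] at ht
  rw [add_sub_cancel_left, norm_smul, Real.norm_of_nonneg ht0.le] at h3
  have h4 : ‖f (θ₀ + t • v)‖ ≤ η * (t * ‖v‖) + t * ‖T v‖ := by
    have := norm_add_le (f (θ₀ + t • v) - t • T v) (t • T v)
    rw [sub_add_cancel, norm_smul t (T v), Real.norm_of_nonneg ht0.le] at this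
    linarith
  have h5 : t * ‖v‖ ≤ t * (K * ‖T v‖ + K * η * ‖v‖) := by
    nlinarith [mul_le_mul_of_nonneg_left h4 hK0.le]
  have h6 := le_of_mul_le_mul_left h5 ht0
  have h7 : K * η * ‖v‖ ≤ ε := by
    rw [hη]
    have : K * (ε / (K * (‖v‖ + 1))) * ‖v‖ = ε * (‖v‖ / (‖v‖ + 1)) := by field_simp
    rw [this]
    exact mul_le_of_le_one_right hε.le (div_le_one_of_le₀ (by linarith) (by positivity))
  linarith

/-- The minimizer of a least squares problem agrees to first order with the solution of the
linearized problem. -/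
theorem exists_norm_leastSquares_sub_le [InnerProductSpace ℝ F] {f : E → F} {T : E →L[ℝ] F}
    {θ₀ : E} {Θ : Set E} {K p ε : ℝ} (hf : HasFDerivAt f T θ₀) (hf0 : f θ₀ = 0)
    (hΘ : Θ ∈ 𝓝 θ₀) (hK0 : 0 < K) (hK : ∀ θ ∈ Θ, ‖θ - θ₀‖ ≤ K * ‖f θ‖) (hp : 0 < p)
    (hε : 0 < ε) :
    ∃ δ > 0, ∀ (y : F) (h : E), ‖y‖ ≤ δ → ‖h‖ ≤ p * ‖y‖ → (∀ v, inner ℝ (T v) (y - T h) = 0) →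
      ∀ θ ∈ Θ, (∀ θ' ∈ Θ, ‖y - f θ‖ ≤ ‖y - f θ'‖) → ‖θ - θ₀ - h‖ ≤ ε * ‖y‖ := by
  have hTK := norm_le_mul_norm_fderiv hf hf0 hΘ hK0 hK
  -- κ‖y‖ bounds the combined size of θ - θ₀ and h, so linearization costs ηκ‖y‖; D is then chosen
  -- so that the resulting excess in squared distance is at most ηD‖y‖².
  set κ := 2 * K + p with hκ
  set D := 2 * (1 + ‖T‖ * p) * κ + κ ^ 2 with hD
  set η := min 1 (ε ^ 2 / (K ^ 2 * D + 1)) with hη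
  have hκ0 : 0 < κ := by positivity
  have hD0 : 0 < D := by positivity
  have hη0 : 0 < η := by positivity
  have hη1 : η ≤ 1 := min_le_left _ _
  have hηε : K ^ 2 * (η * D) ≤ ε ^ 2 := by
    have h1 : η ≤ ε ^ 2 / (K ^ 2 * D + 1) := min_le_right _ _
    rw [le_div_iff₀ (by positivity)] at h1
    nlinarith
  have h1 : ∀ᶠ θ in 𝓝 θ₀, θ ∈ Θ ∧ ‖f θ - f θ₀ - T (θ - θ₀)‖ ≤ η * ‖θ - θ₀‖ :=
    (eventually_mem_set.2 hΘ).and (hf.isLittleO.def hη0)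
  obtain ⟨r, hr, hball⟩ := Metric.eventually_nhds_iff.1 h1
  refine ⟨r / (2 * κ), by positivity, fun y h hy hh horth θ hθ hmin => ?_⟩
  have hsmall : κ * ‖y‖ < r := by
    have := mul_le_mul_of_nonneg_left hy hκ0.le
    have e : κ * (r / (2 * κ)) = r / 2 := by field_simp
    rw [e] at this
    linarith
  have hy0 := norm_nonneg y
  have hfy : ‖f θ‖ ≤ 2 * ‖y‖ := by
    have h2 := hmin θ₀ (mem_of_mem_nhds hΘ)
    rw [hf0, sub_zero] at h2
    have := norm_sub_norm_le (f θ) y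
    rw [norm_sub_rev] at this
    linarith
  have hθy : ‖θ - θ₀‖ ≤ 2 * K * ‖y‖ := by nlinarith [hK θ hθ]
  have hb1 := (hball (y := θ) (by rw [dist_eq_norm]; nlinarith)).2
  -- The competitor is the linearized solution itself, which lies in Θ once y is small.
  have hb2 := hball (y := θ₀ + h) (by rw [dist_eq_norm, add_sub_cancel_left]; nlinarith)
  rw [hf0, sub_zero] at hb1
  rw [hf0, sub_zero, add_sub_cancel_left] at hb2
  have hm := hmin _ hb2.1
  set u := ‖y - T h‖ with hu
  have hu_le : u ≤ (1 + ‖T‖ * p) * ‖y‖ := by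
    refine (norm_sub_le _ _).trans ?_
    have := (T.le_opNorm h).trans (mul_le_mul_of_nonneg_left hh (norm_nonneg T))
    linarith
  have hupper : ‖y - T (θ - θ₀)‖ ≤ u + η * κ * ‖y‖ := by
    have t1 : ‖y - T (θ - θ₀)‖ ≤ ‖y - f θ‖ + ‖f θ - T (θ - θ₀)‖ := by
      rw [← sub_add_sub_cancel y (f θ)]; exact norm_add_le _ _
    have t2 : ‖y - f (θ₀ + h)‖ ≤ u + ‖f (θ₀ + h) - T h‖ := by
      rw [← norm_neg (f (θ₀ + h) - T h), neg_sub, ← sub_add_sub_cancel y (T h)]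
      exact norm_add_le _ _
    have t3 := mul_le_mul_of_nonneg_left hθy hη0.le
    have t4 := mul_le_mul_of_nonneg_left hh hη0.le
    rw [hκ]
    linarith [hb2.2]
  -- The residual y - T h is orthogonal to the range of T, so any excess over the optimal linear
  -- distance is exactly the squared deviation from h as seen by T.
  have hpyth : ‖y - T (θ - θ₀)‖ ^ 2 = u ^ 2 + ‖T (θ - θ₀ - h)‖ ^ 2 := by
    have e : y - T (θ - θ₀) = (y - T h) - T (θ - θ₀ - h) := by
      rw [map_sub T (θ - θ₀) h]; abel
    rw [e, norm_sub_sq_real, real_inner_comm, horth]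
    ring
  have hz : ‖T (θ - θ₀ - h)‖ ^ 2 ≤ η * D * ‖y‖ ^ 2 := by
    have s1 := pow_le_pow_left₀ (norm_nonneg _) hupper 2
    have s2 : u * (η * κ * ‖y‖) ≤ (1 + ‖T‖ * p) * ‖y‖ * (η * κ * ‖y‖) :=
      mul_le_mul_of_nonneg_right hu_le (by positivity)
    have s3 : η ^ 2 * (κ ^ 2 * ‖y‖ ^ 2) ≤ η * (κ ^ 2 * ‖y‖ ^ 2) :=
      mul_le_mul_of_nonneg_right (by nlinarith) (by positivity)
    rw [hpyth] at s1
    rw [hD]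
    linarith
  refine abs_le_of_sq_le_sq' ?_ (by positivity) |>.2
  calc ‖θ - θ₀ - h‖ ^ 2 ≤ (K * ‖T (θ - θ₀ - h)‖) ^ 2 :=
        pow_le_pow_left₀ (norm_nonneg _) (hTK _) 2
    _ = K ^ 2 * ‖T (θ - θ₀ - h)‖ ^ 2 := by ring
    _ ≤ K ^ 2 * (η * D * ‖y‖ ^ 2) := mul_le_mul_of_nonneg_left hz (by positivity)
    _ = K ^ 2 * (η * D) * ‖y‖ ^ 2 := by ring
    _ ≤ ε ^ 2 * ‖y‖ ^ 2 := mul_le_mul_of_nonneg_right hηε (by positivity)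
    _ = _ := by ring

end LeastSquares

/-! ### The deterministic part of the analysis of the estimator -/

variable {L : ℕ} {a : Fin L → Fin (L + 1) → ℝ} {α K : ℝ} {θ₀ : EuclideanSpace ℝ (Fin 3)}
  {Θ : Set (EuclideanSpace ℝ (Fin 3))} {A : Matrix (Fin L) (Fin L) ℝ}

theorem pi_fderiv_V_apply (a : Fin L → Fin (L + 1) → ℝ) (α : ℝ) (θ₀ v : EuclideanSpace ℝ (Fin 3)) :
    ContinuousLinearMap.pi (fun ℓ => fderiv ℝ (V (a ℓ) α) θ₀) v = -(G a α θ₀).mulVec v := by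
  ext ℓ
  have hv : v = ∑ j, v j • EuclideanSpace.single j (1 : ℝ) := by
    ext i
    simp [Fin.sum_univ_three]
    fin_cases i <;> simp
  rw [ContinuousLinearMap.pi_apply, Pi.neg_apply]
  conv_lhs => rw [hv]
  simp only [map_sum, map_smul, smul_eq_mul, Matrix.mulVec, dotProduct, G, Matrix.of_apply]
  rw [← Finset.sum_neg_distrib]
  exact Finset.sum_congr rfl fun j _ => by ring

theorem hasFDerivAt_pi_V (hV : ∀ ℓ, DifferentiableAt ℝ (V (a ℓ) α) θ₀) :
    HasFDerivAt (fun θ ℓ => V (a ℓ) α θ - V (a ℓ) α θ₀)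
      (ContinuousLinearMap.pi fun ℓ => fderiv ℝ (V (a ℓ) α) θ₀) θ₀ :=
  hasFDerivAt_pi.2 fun ℓ => (hV ℓ).hasFDerivAt.sub_const _

/-- The bound below for the derivative of the moment map says that G has full column rank:
identification yields the rank condition. -/
theorem mulVec_G_injective (hV : ∀ ℓ, DifferentiableAt ℝ (V (a ℓ) α) θ₀) (hΘ : Θ ∈ 𝓝 θ₀)
    (hK0 : 0 < K) (hK : ∀ θ ∈ Θ, ‖θ - θ₀‖ ≤ K * ‖fun ℓ => V (a ℓ) α θ - V (a ℓ) α θ₀‖) :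
    Function.Injective (G a α θ₀).mulVec := by
  have h := norm_le_mul_norm_fderiv (hasFDerivAt_pi_V hV) (by ext; simp) hΘ hK0 hK
  refine (injective_iff_map_eq_zero (G a α θ₀).mulVecLin).2 fun v hv => ?_
  have h1 := h (WithLp.toLp 2 v)
  rw [pi_fderiv_V_apply, show (G a α θ₀).mulVec (WithLp.toLp 2 v).ofLp = 0 from hv, neg_zero,
    norm_zero, mul_zero] at h1
  have h2 := norm_le_zero_iff.1 h1
  exact congrArg WithLp.ofLp h2

theorem posDef_transpose_G_mul_mul (hA : A.PosDef) (hG : Function.Injective (G a α θ₀).mulVec) :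
    ((G a α θ₀).transpose * A * G a α θ₀).PosDef := by
  rw [← Matrix.conjTranspose_eq_transpose_of_trivial]
  exact hA.conjTranspose_mul_mul_same hG

/-- These are the normal equations of the weighted linear regression of m on the columns of G, with
C m as its solution. -/
theorem transpose_G_mulVec_C (hu : IsUnit ((G a α θ₀).transpose * A * G a α θ₀)) (m : Fin L → ℝ) :
    ((G a α θ₀).transpose * A).mulVec (m - (G a α θ₀).mulVec ((C a α A θ₀).mulVec m)) = 0 := by
  have hdet := (Matrix.isUnit_iff_isUnit_det _).1 hu
  rw [Matrix.mulVec_sub, Matrix.mulVec_mulVec, Matrix.mulVec_mulVec, C, ← Matrix.mul_assoc,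
    ← Matrix.mul_assoc, Matrix.mul_nonsing_inv _ hdet, Matrix.one_mul, sub_self]

/-- With m the sample moment at θ₀, the criterion at θ is the squared A-norm of m - Δ(θ). The
derivative of Δ is -G, so the linearized minimizer is h = -C m, which explains the plus sign in the
conclusion. Both parts are deterministic and uniform in m. -/
theorem exists_norm_minimizer_sub_le (hV : ∀ ℓ, DifferentiableAt ℝ (V (a ℓ) α) θ₀)
    (hΘ : Θ ∈ 𝓝 θ₀) (hK0 : 0 < K)
    (hK : ∀ θ ∈ Θ, ‖θ - θ₀‖ ≤ K * ‖fun ℓ => V (a ℓ) α θ - V (a ℓ) α θ₀‖) (hA : A.PosDef)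
    {Δ : EuclideanSpace ℝ (Fin 3) → Fin L → ℝ} (hΔ : Δ = fun θ ℓ => V (a ℓ) α θ - V (a ℓ) α θ₀) :
    (∃ K', ∀ (m : Fin L → ℝ), ∀ θ ∈ Θ, (∀ θ' ∈ Θ, (m - Δ θ) ⬝ᵥ A.mulVec (m - Δ θ) ≤
        (m - Δ θ') ⬝ᵥ A.mulVec (m - Δ θ')) → ‖θ - θ₀‖ ≤ K' * ‖m‖) ∧
    ∀ ε > 0, ∃ δ > 0, ∀ (m : Fin L → ℝ), ‖m‖ ≤ δ → ∀ θ ∈ Θ,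
      (∀ θ' ∈ Θ, (m - Δ θ) ⬝ᵥ A.mulVec (m - Δ θ) ≤ (m - Δ θ') ⬝ᵥ A.mulVec (m - Δ θ')) →
      ‖θ - θ₀ + WithLp.toLp 2 ((C a α A θ₀).mulVec m)‖ ≤ ε * ‖m‖ := by
  obtain ⟨S, hS, c, hc, hSc⟩ := exists_isometry_of_posDef hA
  set J := ContinuousLinearMap.pi fun ℓ => fderiv ℝ (V (a ℓ) α) θ₀ with hJ
  have hJ' : HasFDerivAt Δ J θ₀ := hΔ ▸ hasFDerivAt_pi_V hV
  have hu := (posDef_transpose_G_mul_mul hA (mulVec_G_injective hV hΘ hK0 hK)).isUnit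
  have hf : HasFDerivAt (fun θ => S (Δ θ)) (S ∘L J) θ₀ := S.hasFDerivAt.comp θ₀ hJ'
  have hf0 : S (Δ θ₀) = 0 := by
    have : Δ θ₀ = 0 := by rw [hΔ]; ext; simp
    rw [this, map_zero]
  have hKS : ∀ θ ∈ Θ, ‖θ - θ₀‖ ≤ K * c * ‖S (Δ θ)‖ := fun θ hθ => by
    refine (hK θ hθ).trans ?_
    rw [mul_assoc]
    have := hSc (Δ θ)
    rw [hΔ] at this ⊢
    exact mul_le_mul_of_nonneg_left this hK0.le
  have hmin : ∀ {m : Fin L → ℝ} {θ : EuclideanSpace ℝ (Fin 3)},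
      (∀ θ' ∈ Θ, (m - Δ θ) ⬝ᵥ A.mulVec (m - Δ θ) ≤ (m - Δ θ') ⬝ᵥ A.mulVec (m - Δ θ')) →
      ∀ θ' ∈ Θ, ‖S m - S (Δ θ)‖ ≤ ‖S m - S (Δ θ')‖ := by
    intro m θ h θ' hθ'
    have := h θ' hθ'
    rw [← hS, ← hS, real_inner_self_eq_norm_sq, real_inner_self_eq_norm_sq, map_sub, map_sub]
      at this
    exact le_of_sq_le_sq this (norm_nonneg _)
  set P : (Fin L → ℝ) →L[ℝ] EuclideanSpace ℝ (Fin 3) := LinearMap.toContinuousLinearMap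
    ((WithLp.linearEquiv 2 ℝ (Fin 3 → ℝ)).symm.toLinearMap ∘ₗ (C a α A θ₀).mulVecLin) with hP
  have hPm : ∀ m, P m = WithLp.toLp 2 ((C a α A θ₀).mulVec m) := fun m => rfl
  have hSm : ∀ m, ‖S m‖ ≤ (‖S‖ + 1) * ‖m‖ := fun m =>
    (S.le_opNorm m).trans (mul_le_mul_of_nonneg_right (by linarith) (norm_nonneg _))
  refine ⟨⟨K * c * (2 * (‖S‖ + 1)), fun m θ hθ h => ?_⟩, fun ε hε => ?_⟩
  · refine (hKS θ hθ).trans ?_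
    rw [mul_assoc (K * c)]
    refine mul_le_mul_of_nonneg_left ?_ (by positivity)
    have h2 := hmin h θ₀ (mem_of_mem_nhds hΘ)
    rw [hf0, sub_zero] at h2
    have := norm_sub_norm_le (S (Δ θ)) (S m)
    rw [norm_sub_rev] at this
    linarith [hSm m]
  · obtain ⟨δ, hδ, h⟩ := exists_norm_leastSquares_sub_le (p := (‖P‖ + 1) * c)
      (ε := ε / (‖S‖ + 1)) hf hf0 hΘ (mul_pos hK0 hc) hKS (by positivity) (by positivity)
    refine ⟨δ / (‖S‖ + 1), by positivity, fun m hm θ hθ hθmin => ?_⟩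
    have h1 := h (S m) (-P m) ?_ ?_ ?_ θ hθ (hmin hθmin)
    · rw [sub_neg_eq_add, hPm] at h1
      refine h1.trans ?_
      calc ε / (‖S‖ + 1) * ‖S m‖ ≤ ε / (‖S‖ + 1) * ((‖S‖ + 1) * ‖m‖) :=
            mul_le_mul_of_nonneg_left (hSm m) (by positivity)
        _ = ε * ‖m‖ := by field_simp
    · refine (hSm m).trans ?_
      rw [le_div_iff₀ (by positivity)] at hm
      linarith
    · rw [norm_neg]
      calc ‖P m‖ ≤ (‖P‖ + 1) * ‖m‖ :=
            (P.le_opNorm m).trans (mul_le_mul_of_nonneg_right (by linarith) (norm_nonneg _))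
        _ ≤ (‖P‖ + 1) * (c * ‖S m‖) := mul_le_mul_of_nonneg_left (hSc m) (by positivity)
        _ = _ := by ring
    · intro v
      have e : S m - (S ∘L J) (-P m) = S (m - (G a α θ₀).mulVec ((C a α A θ₀).mulVec m)) := by
        rw [ContinuousLinearMap.comp_apply, ← map_sub, hJ, pi_fderiv_V_apply, hPm]
        congr 2
        rw [← Matrix.mulVec_neg]
        congr 1
        simp
      rw [e, ContinuousLinearMap.comp_apply, hS, hJ, pi_fderiv_V_apply, neg_dotProduct,
        ← Matrix.vecMul_transpose, ← Matrix.dotProduct_mulVec, Matrix.mulVec_mulVec,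
        transpose_G_mulVec_C hu, dotProduct_zero, neg_zero]

end


section

/-! ### The sample moments -/

variable {Ω : Type*} [MeasurableSpace Ω] {μ : Measure Ω} {L : ℕ} {a : Fin L → Fin (L + 1) → ℝ}
  {α : ℝ} {θ : EuclideanSpace ℝ (Fin 3)} {X : ℝ → Ω → ℝ}

theorem gHat_apply (a : Fin L → Fin (L + 1) → ℝ) (α : ℝ) (x : ℝ → ℝ) {N : ℕ} (hN : L ≤ N)
    (θ : EuclideanSpace ℝ (Fin 3)) (ℓ : Fin L) :
    gHat a α x N θ ℓ = (∑ i ∈ Finset.range (N + 1 - L),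
      (filtered (a ℓ) α x ((L + i : ℕ) * α) ^ 2 - V (a ℓ) α θ)) / ((N + 1 - L : ℕ) : ℝ) := by
  rw [gHat, Pi.smul_apply, Finset.sum_apply, smul_eq_mul, inv_mul_eq_div]
  have e : Finset.Icc L N = Finset.Ico L (N + 1) := by ext; simp
  rw [e, Finset.sum_Ico_eq_sum_range, Nat.cast_sub (by omega)]
  push_cast
  rw [show (N : ℝ) - L + 1 = N + 1 - L by ring]
  rfl

theorem gHat_eq_sub (a : Fin L → Fin (L + 1) → ℝ) (α : ℝ) (x : ℝ → ℝ) {N : ℕ} (hN : L ≤ N)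
    (θ θ₀ : EuclideanSpace ℝ (Fin 3)) :
    gHat a α x N θ = gHat a α x N θ₀ - fun ℓ => V (a ℓ) α θ - V (a ℓ) α θ₀ := by
  ext ℓ
  have hn : ((N + 1 - L : ℕ) : ℝ) ≠ 0 := by
    have : N + 1 - L ≠ 0 := by omega
    exact_mod_cast this
  rw [Pi.sub_apply, gHat_apply _ _ _ hN, gHat_apply _ _ _ hN, Finset.sum_sub_distrib,
    Finset.sum_sub_distrib, Finset.sum_const, Finset.sum_const, Finset.card_range, nsmul_eq_mul,
    nsmul_eq_mul, sub_div, sub_div, mul_div_cancel_left₀ _ hn, mul_div_cancel_left₀ _ hn]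
  ring

theorem IsCenteredGaussian.aemeasurable_gHat {R : ℝ → ℝ → ℝ} (hX : IsCenteredGaussian X R μ)
    (a : Fin L → Fin (L + 1) → ℝ) (α : ℝ) (N : ℕ) (θ : EuclideanSpace ℝ (Fin 3)) :
    AEMeasurable (fun ω => gHat a α (fun t => X t ω) N θ) μ := by
  refine aemeasurable_pi_iff.2 fun ℓ => ?_
  have hf : ∀ t, AEMeasurable (fun ω => FOU.filtered (a ℓ) α (fun t => X t ω) t) μ := fun t =>
    Finset.aemeasurable_fun_sum _ fun q _ => (hX.aemeasurable _).const_mul (a ℓ q)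
  have h : AEMeasurable (fun ω => ((N : ℝ) - (L : ℝ) + 1)⁻¹ * ∑ i ∈ Finset.Icc L N,
      (FOU.filtered (a ℓ) α (fun t => X t ω) ((i : ℝ) * α) ^ 2 - V (a ℓ) α θ)) μ :=
    (Finset.aemeasurable_fun_sum _ fun i _ => ((hf _).pow_const 2).sub_const _).const_mul _
  refine h.congr (ae_of_all _ fun ω => ?_)
  simp only [gHat, Pi.smul_apply, Finset.sum_apply, g, smul_eq_mul]

theorem tendsto_add_one_sub_atTop (L : ℕ) : Tendsto (fun N : ℕ => N + 1 - L) atTop atTop :=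
  tendsto_atTop_mono (fun N => by omega) (tendsto_sub_atTop_nat L)

/-- The normalization of the sums of `n` terms that corresponds to `√N` times the mean, where
`n = N - L + 1`. -/
def sampleScale (L n : ℕ) : ℝ := √((n : ℝ) + L - 1) / n

theorem sampleScale_nonneg (L n : ℕ) : 0 ≤ sampleScale L n := by
  unfold sampleScale; positivity

theorem sampleScale_sq_mul (hL : 1 ≤ L) {n : ℕ} (hn : 0 < n) :
    sampleScale L n ^ 2 * n = 1 + ((L : ℝ) - 1) / n := by
  have hL' : (1 : ℝ) ≤ L := by exact_mod_cast hL
  have hn' : (0 : ℝ) < n := by exact_mod_cast hn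
  unfold sampleScale
  rw [div_pow, Real.sq_sqrt (by linarith)]
  field_simp
  ring

theorem tendsto_sampleScale_sq_mul (hL : 1 ≤ L) :
    Tendsto (fun n : ℕ => sampleScale L n ^ 2 * n) atTop (𝓝 1) := by
  have h : Tendsto (fun n : ℕ => 1 + ((L : ℝ) - 1) / n) atTop (𝓝 (1 + 0)) :=
    tendsto_const_nhds.add (tendsto_const_div_atTop_nhds_zero_nat _)
  rw [add_zero] at h
  refine h.congr' ?_
  filter_upwards [eventually_gt_atTop 0] with n hn
  exact (sampleScale_sq_mul hL hn).symm

theorem sqrt_mul_gHat (a : Fin L → Fin (L + 1) → ℝ) (α : ℝ) (x : ℝ → ℝ) {N : ℕ} (hN : L ≤ N)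
    (θ : EuclideanSpace ℝ (Fin 3)) (ℓ : Fin L) :
    √(N : ℝ) * gHat a α x N θ ℓ = sampleScale L (N + 1 - L) *
      ∑ i ∈ Finset.range (N + 1 - L),
        (filtered (a ℓ) α x ((L + i : ℕ) * α) ^ 2 - V (a ℓ) α θ) := by
  rw [gHat_apply _ _ _ hN, sampleScale, Nat.cast_sub (by omega)]
  push_cast
  rw [show (N : ℝ) + 1 - L + L - 1 = N by ring]
  ring

/-- The limit exp(-c'Ωc/2) of characteristic functions has modulus at most 1, so c'Ωc ≥ 0. -/
theorem posSemidef_OmegaMatrix [IsProbabilityMeasure μ]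
    (hX : IsCenteredGaussian X (fun s t => rho θ (s - t)) μ)
    (hs : ∀ i j, Summable fun k : ℤ => crossCov a α θ i j k ^ 2) :
    (OmegaMatrix a α θ).PosSemidef := by
  refine Matrix.PosSemidef.of_dotProduct_mulVec_nonneg ?_ fun c => ?_
  · refine Matrix.IsHermitian.ext fun i j => ?_
    simp only [OmegaMatrix, Matrix.of_apply, star_trivial]
    congr 1
    -- Symmetry of Ω is the substitution k ↦ -k in the series.
    rw [← (Equiv.neg ℤ).tsum_eq fun k => crossCov a α θ j i k ^ 2]
    exact tsum_congr fun k => by rw [Equiv.neg_apply, crossCov_neg]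
  · have hscale : Tendsto (fun n : ℕ => (1 / √(n : ℝ)) ^ 2 * n) atTop (𝓝 1) := by
      refine tendsto_const_nhds.congr' ?_
      filter_upwards [eventually_gt_atTop 0] with n hn
      have : (0 : ℝ) < n := by exact_mod_cast hn
      rw [div_pow, Real.sq_sqrt this.le]
      field_simp
    have h := (tendsto_integral_cexp_sum_filtered_sq hX hs 0 c (s := fun n => 1 / √(n : ℝ))
      (fun n => by positivity) hscale).norm
    have h1 := le_of_tendsto (b := 1) h (Eventually.of_forall fun n =>
      (norm_integral_le_of_norm_le_const (C := 1) (ae_of_all _ fun ω => by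
        rw [Complex.norm_exp_ofReal_mul_I])).trans_eq (by simp))
    rw [← Complex.ofReal_neg, ← Complex.ofReal_exp, Complex.norm_real,
      Real.norm_of_nonneg (Real.exp_pos _).le, Real.exp_le_one_iff, neg_nonpos] at h1
    have e : star c ⬝ᵥ (OmegaMatrix a α θ).mulVec c =
        2 * ∑ i, ∑ j, c i * c j * ∑' k : ℤ, crossCov a α θ i j k ^ 2 := by
      simp only [dotProduct, Matrix.mulVec, OmegaMatrix, Matrix.of_apply, star_trivial,
        Finset.mul_sum]
      exact Finset.sum_congr rfl fun i _ => Finset.sum_congr rfl fun j _ => by ring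
    rw [e]
    positivity

variable [IsProbabilityMeasure μ]

theorem ae_tendsto_gHat (hX : IsCenteredGaussian X (fun s t => rho θ (s - t)) μ)
    (hs : ∀ i j, Summable fun k : ℤ => crossCov a α θ i j k ^ 2) :
    ∀ᵐ ω ∂μ, Tendsto (fun N => gHat a α (fun t => X t ω) N θ) atTop (𝓝 0) := by
  filter_upwards [ae_all_iff.2 fun ℓ => ae_tendsto_mean_filtered_sq hX (hs ℓ ℓ) L] with ω hω
  refine tendsto_pi_nhds.2 fun ℓ => ?_
  have h1 := ((hω ℓ).comp (tendsto_add_one_sub_atTop L)).sub_const (V (a ℓ) α θ)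
  rw [sub_self] at h1
  refine h1.congr' ?_
  filter_upwards [eventually_ge_atTop L] with N hN
  have hn : ((N + 1 - L : ℕ) : ℝ) ≠ 0 := by
    have : N + 1 - L ≠ 0 := by omega
    exact_mod_cast this
  rw [gHat_apply _ _ _ hN, Finset.sum_sub_distrib, Finset.sum_const, Finset.card_range,
    nsmul_eq_mul, Function.comp_apply, sub_div, mul_div_cancel_left₀ _ hn]

/-- Chebyshev's inequality: the second moments of √N ĝ_N are bounded uniformly in N, so this
sequence is tight. -/
theorem exists_integral_norm_sq_gHat_le (hL : 1 ≤ L)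
    (hX : IsCenteredGaussian X (fun s t => rho θ (s - t)) μ)
    (hs : ∀ i j, Summable fun k : ℤ => crossCov a α θ i j k ^ 2) :
    ∃ M, ∀ N, L ≤ N → ∀ c > 0,
      μ.real {ω | c ≤ ‖√(N : ℝ) • gHat a α (fun t => X t ω) N θ‖} ≤ M / c ^ 2 := by
  set T : Fin L → ℝ := fun ℓ => 2 * ∑' k : ℤ, crossCov a α θ ℓ ℓ k ^ 2 with hT
  have hT0 : ∀ ℓ, 0 ≤ T ℓ := fun ℓ => mul_nonneg zero_le_two (tsum_nonneg fun k => sq_nonneg _)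
  refine ⟨∑ ℓ, L * T ℓ, fun N hN c hc => ?_⟩
  set n := N + 1 - L with hn
  have hn0 : 0 < n := by omega
  have hn1 : (1 : ℝ) ≤ n := by exact_mod_cast hn0
  have hL' : (1 : ℝ) ≤ L := by exact_mod_cast hL
  set S : Fin L → Ω → ℝ := fun ℓ ω => ∑ i ∈ Finset.range n,
    (filtered (a ℓ) α (fun t => X t ω) ((L + i : ℕ) * α) ^ 2 - V (a ℓ) α θ) with hS
  have hint : ∀ ℓ, Integrable (fun ω => sampleScale L n ^ 2 * S ℓ ω ^ 2) μ := fun ℓ =>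
    (integral_sum_filtered_sq_sub hX (hs ℓ ℓ) L n).1.const_mul _
  have hsum : ∫ ω, ∑ ℓ, sampleScale L n ^ 2 * S ℓ ω ^ 2 ∂μ ≤ ∑ ℓ, L * T ℓ := by
    rw [integral_finsetSum _ fun ℓ _ => hint ℓ]
    refine Finset.sum_le_sum fun ℓ _ => ?_
    rw [integral_const_mul]
    have h1 := mul_le_mul_of_nonneg_left (integral_sum_filtered_sq_sub hX (hs ℓ ℓ) L n).2
      (sq_nonneg (sampleScale L n))
    refine h1.trans ?_
    -- The left side is 1 + (L-1)/n, largest at n = 1.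
    have h2 : sampleScale L n ^ 2 * n ≤ L := by
      rw [sampleScale_sq_mul hL hn0]
      have : ((L : ℝ) - 1) / n ≤ L - 1 := div_le_self (by linarith) hn1
      linarith
    calc sampleScale L n ^ 2 * (2 * (∑' k : ℤ, crossCov a α θ ℓ ℓ k ^ 2) * n)
        = sampleScale L n ^ 2 * n * T ℓ := by rw [hT]; ring
      _ ≤ L * T ℓ := mul_le_mul_of_nonneg_right h2 (hT0 ℓ)
  have hsub : {ω | c ≤ ‖√(N : ℝ) • gHat a α (fun t => X t ω) N θ‖} ⊆
      {ω | c ^ 2 ≤ ∑ ℓ, sampleScale L n ^ 2 * S ℓ ω ^ 2} := by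
    intro ω hω
    have hω : c ≤ ‖√(N : ℝ) • gHat a α (fun t => X t ω) N θ‖ := hω
    have hterm : ∀ ℓ, (√(N : ℝ) * gHat a α (fun t => X t ω) N θ ℓ) ^ 2 =
        sampleScale L n ^ 2 * S ℓ ω ^ 2 := fun ℓ => by
      rw [sqrt_mul_gHat _ _ _ hN, mul_pow]
    have hnn : 0 ≤ ∑ ℓ, sampleScale L n ^ 2 * S ℓ ω ^ 2 :=
      Finset.sum_nonneg fun ℓ _ => by positivity
    have hle : ‖√(N : ℝ) • gHat a α (fun t => X t ω) N θ‖ ≤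
        √(∑ ℓ, sampleScale L n ^ 2 * S ℓ ω ^ 2) := by
      refine (pi_norm_le_iff_of_nonneg (Real.sqrt_nonneg _)).2 fun ℓ => ?_
      rw [Pi.smul_apply, smul_eq_mul, Real.norm_eq_abs]
      refine Real.abs_le_sqrt ?_
      rw [hterm ℓ]
      exact Finset.single_le_sum (f := fun ℓ => sampleScale L n ^ 2 * S ℓ ω ^ 2)
        (fun ℓ _ => by positivity) (Finset.mem_univ ℓ)
    exact (Real.le_sqrt hc.le hnn).1 (hω.trans hle)
  have hmark := mul_meas_ge_le_integral_of_nonneg (μ := μ)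
    (f := fun ω => ∑ ℓ, sampleScale L n ^ 2 * S ℓ ω ^ 2)
    (ae_of_all _ fun ω => Finset.sum_nonneg fun ℓ _ => by positivity)
    (integrable_finsetSum _ fun ℓ _ => hint ℓ) (c ^ 2)
  rw [le_div_iff₀ (by positivity), mul_comm]
  exact (mul_le_mul_of_nonneg_left (measureReal_mono hsub) (by positivity)).trans
    (hmark.trans hsum)

/-- The central limit theorem for linear functions of the sample moments. -/
theorem tendstoInDistribution_mulVec_gHat (hL : 1 ≤ L)
    (hX : IsCenteredGaussian X (fun s t => rho θ (s - t)) μ)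
    (hs : ∀ i j, Summable fun k : ℤ => crossCov a α θ i j k ^ 2) (M : Matrix (Fin 3) (Fin L) ℝ) :
    TendstoInDistribution (fun (N : ℕ) ω => WithLp.toLp 2
        (-M.mulVec (√(N : ℝ) • gHat a α (fun t => X t ω) N θ))) atTop id (fun _ => μ)
      (multivariateGaussian 0 (M * OmegaMatrix a α θ * M.transpose)) := by
  have hΩ := posSemidef_OmegaMatrix hX hs
  have hS : (M * OmegaMatrix a α θ * M.transpose).PosSemidef := by
    rw [← Matrix.conjTranspose_eq_transpose_of_trivial]
    exact hΩ.mul_mul_conjTranspose_same M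
  have hmeas : ∀ N : ℕ, AEMeasurable (fun ω => (WithLp.toLp 2
      (-M.mulVec (√(N : ℝ) • gHat a α (fun t => X t ω) N θ)) : EuclideanSpace ℝ (Fin 3))) μ := by
    intro N
    have hc : Continuous fun m : Fin L → ℝ =>
        (WithLp.toLp 2 (-M.mulVec (√(N : ℝ) • m)) : EuclideanSpace ℝ (Fin 3)) := by
      refine (PiLp.continuous_toLp 2 _).comp (Continuous.neg ?_)
      exact continuous_const.matrix_mulVec (continuous_const_smul _)
    exact hc.measurable.comp_aemeasurable (hX.aemeasurable_gHat a α N θ)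
  refine ⟨hmeas, aemeasurable_id, ProbabilityMeasure.tendsto_of_tendsto_charFun fun t => ?_⟩
  simp only [ProbabilityMeasure.coe_mk, Measure.map_id]
  rw [charFun_multivariateGaussian hS, inner_zero_right, Complex.ofReal_zero, zero_mul, zero_sub]
  -- The inner product of t with -M m is c · m, so the scalar limit theorem gives the characteristic
  -- function at t.
  set c : Fin L → ℝ := -Matrix.vecMul t.ofLp M with hc
  have h := (tendsto_integral_cexp_sum_filtered_sq hX hs L c (sampleScale_nonneg L)
    (tendsto_sampleScale_sq_mul hL)).comp (tendsto_add_one_sub_atTop L)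
  -- The factor 2 in Ω cancels the 1/2 in the Gaussian exponent.
  have e : t.ofLp ⬝ᵥ (M * OmegaMatrix a α θ * M.transpose).mulVec t.ofLp / 2 =
      ∑ i, ∑ j, c i * c j * ∑' k : ℤ, crossCov a α θ i j k ^ 2 := by
    rw [← Matrix.mulVec_mulVec, ← Matrix.mulVec_mulVec, Matrix.dotProduct_mulVec,
      Matrix.mulVec_transpose]
    simp only [hc, dotProduct, Matrix.mulVec, OmegaMatrix, Matrix.of_apply, Pi.neg_apply,
      Finset.mul_sum, Finset.sum_div]
    exact Finset.sum_congr rfl fun i _ => Finset.sum_congr rfl fun j _ => by ring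
  have e2 : -(((t.ofLp ⬝ᵥ (M * OmegaMatrix a α θ * M.transpose).mulVec t.ofLp : ℝ) : ℂ) / 2) =
      -((∑ i, ∑ j, c i * c j * ∑' k : ℤ, crossCov a α θ i j k ^ 2 : ℝ) : ℂ) := by
    rw [← e]; push_cast; ring
  rw [e2]
  refine h.congr' ?_
  filter_upwards [eventually_ge_atTop L] with N hN
  rw [charFun_apply, integral_map (hmeas N) (by fun_prop)]
  refine integral_congr_ae (ae_of_all _ fun ω => ?_)
  simp only
  congr 3
  rw [EuclideanSpace.inner_eq_star_dotProduct, star_trivial]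
  simp only [dotProduct_neg, Matrix.dotProduct_mulVec]
  rw [← neg_dotProduct]
  simp only [dotProduct, Pi.smul_apply, smul_eq_mul]
  exact Finset.sum_congr rfl fun ℓ _ => by rw [sqrt_mul_gHat _ _ _ hN]

end


section

/-! ### Asymptotics of the estimator -/

variable {Ω : Type*} [MeasurableSpace Ω] {μ : Measure Ω} {L : ℕ} {a : Fin L → Fin (L + 1) → ℝ}
  {α K : ℝ} {θ₀ : EuclideanSpace ℝ (Fin 3)} {X : ℝ → Ω → ℝ} {A : Matrix (Fin L) (Fin L) ℝ}
  {Θ : Set (EuclideanSpace ℝ (Fin 3))} {θHat : ℕ → Ω → EuclideanSpace ℝ (Fin 3)}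

theorem IsGMMEstimator.ae_minimizes (hθ : IsGMMEstimator a α A Θ X μ θHat)
    {Δ : EuclideanSpace ℝ (Fin 3) → Fin L → ℝ} (hΔ : Δ = fun θ ℓ => V (a ℓ) α θ - V (a ℓ) α θ₀) :
    ∀ᵐ ω ∂μ, ∀ N, L ≤ N → θHat N ω ∈ Θ ∧ ∀ θ' ∈ Θ,
      (gHat a α (fun t => X t ω) N θ₀ - Δ (θHat N ω)) ⬝ᵥ
        A.mulVec (gHat a α (fun t => X t ω) N θ₀ - Δ (θHat N ω)) ≤
      (gHat a α (fun t => X t ω) N θ₀ - Δ θ') ⬝ᵥ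
        A.mulVec (gHat a α (fun t => X t ω) N θ₀ - Δ θ') := by
  filter_upwards [hθ.isMinOn] with ω hω N hN
  refine ⟨(hω N hN).1, fun θ' hθ' => ?_⟩
  have h := (hω N hN).2 hθ'
  simp only [Set.mem_ofPred_eq, QHat] at h
  rw [gHat_eq_sub a α _ hN (θHat N ω) θ₀, gHat_eq_sub a α _ hN θ' θ₀] at h
  rw [hΔ]
  exact h

variable [IsProbabilityMeasure μ]

/-- The global Lipschitz inversion bounds ‖θ̂_N - θ₀‖ by a multiple of ‖ĝ_N(θ₀)‖, which tends to 0
almost surely. -/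
theorem IsGMMEstimator.ae_tendsto (hθ : IsGMMEstimator a α A Θ X μ θHat)
    (hX : IsCenteredGaussian X (fun s t => rho θ₀ (s - t)) μ)
    (hs : ∀ i j, Summable fun k : ℤ => crossCov a α θ₀ i j k ^ 2)
    (hV : ∀ ℓ, DifferentiableAt ℝ (V (a ℓ) α) θ₀) (hΘ : Θ ∈ 𝓝 θ₀) (hK0 : 0 < K)
    (hK : ∀ θ ∈ Θ, ‖θ - θ₀‖ ≤ K * ‖fun ℓ => V (a ℓ) α θ - V (a ℓ) α θ₀‖) (hA : A.PosDef) :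
    ∀ᵐ ω ∂μ, Tendsto (fun N => θHat N ω) atTop (𝓝 θ₀) := by
  obtain ⟨K', hK'⟩ := (exists_norm_minimizer_sub_le hV hΘ hK0 hK hA rfl).1
  filter_upwards [hθ.ae_minimizes rfl (θ₀ := θ₀), ae_tendsto_gHat hX hs] with ω h1 h2
  rw [tendsto_iff_norm_sub_tendsto_zero]
  have h3 := h2.norm.const_mul K'
  rw [norm_zero, mul_zero] at h3
  refine squeeze_zero' (Eventually.of_forall fun N => norm_nonneg _) ?_ h3
  filter_upwards [eventually_ge_atTop L] with N hN
  exact hK' _ _ (h1 N hN).1 (h1 N hN).2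

/-- When m = ĝ_N(θ₀) is within δ of 0, the linearization error is at most η‖√N m‖, and √N m is
tight. Both ‖m‖ > δ and a large ‖√N m‖ have small probability by the same Chebyshev bound. -/
theorem IsGMMEstimator.tendstoInMeasure_sub (hL : 1 ≤ L) (hθ : IsGMMEstimator a α A Θ X μ θHat)
    (hX : IsCenteredGaussian X (fun s t => rho θ₀ (s - t)) μ)
    (hs : ∀ i j, Summable fun k : ℤ => crossCov a α θ₀ i j k ^ 2)
    (hV : ∀ ℓ, DifferentiableAt ℝ (V (a ℓ) α) θ₀) (hΘ : Θ ∈ 𝓝 θ₀) (hK0 : 0 < K)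
    (hK : ∀ θ ∈ Θ, ‖θ - θ₀‖ ≤ K * ‖fun ℓ => V (a ℓ) α θ - V (a ℓ) α θ₀‖) (hA : A.PosDef) :
    TendstoInMeasure μ ((fun (N : ℕ) ω => √(N : ℝ) • (θHat N ω - θ₀)) -
      fun (N : ℕ) ω => WithLp.toLp 2
        (-(C a α A θ₀).mulVec (√(N : ℝ) • gHat a α (fun t => X t ω) N θ₀))) atTop 0 := by
  obtain ⟨M, hM⟩ := exists_integral_norm_sq_gHat_le hL hX hs
  have hM0 : 0 ≤ M := by
    have := measureReal_nonneg.trans (hM L le_rfl 1 one_pos)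
    simpa using this
  rw [tendstoInMeasure_iff_measureReal_norm]
  intro ε hε
  rw [Metric.tendsto_atTop]
  intro ε' hε'
  -- the size of the relative error
  set η := ε * √(ε' / (2 * (M + 1))) with hη
  have hη0 : 0 < η := by positivity
  -- By the choice of η the Chebyshev bound at level ε/η is (ε'/2) M/(M+1).
  have hη2 : M / (ε / η) ^ 2 < ε' / 2 := by
    have e : (ε / η) ^ 2 = 2 * (M + 1) / ε' := by
      rw [hη, div_mul_eq_div_div, div_self hε.ne', div_pow, one_pow,
        Real.sq_sqrt (by positivity), one_div_div]
    rw [e, div_div_eq_mul_div, div_lt_iff₀ (by positivity)]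
    nlinarith
  obtain ⟨δ, hδ, h⟩ := (exists_norm_minimizer_sub_le hV hΘ hK0 hK hA rfl).2 η hη0
  obtain ⟨N₀, hN₀⟩ := exists_nat_gt (M / (δ ^ 2 * (ε' / 2)))
  refine ⟨max (max L N₀) 1, fun N hN => ?_⟩
  have hNL : L ≤ N := (le_max_left _ _).trans ((le_max_left _ _).trans hN)
  have hNN : N₀ ≤ N := (le_max_right _ _).trans ((le_max_left _ _).trans hN)
  have hN1 : 1 ≤ N := (le_max_right _ _).trans hN
  have hNpos : (0 : ℝ) < N := by exact_mod_cast hN1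
  have hsq : 0 < √(N : ℝ) := Real.sqrt_pos.2 hNpos
  rw [Real.dist_eq, sub_zero, abs_of_nonneg measureReal_nonneg]
  have hsub : μ.real {ω | ε ≤ ‖((fun (N : ℕ) ω => √(N : ℝ) • (θHat N ω - θ₀)) -
      fun (N : ℕ) ω => WithLp.toLp 2
        (-(C a α A θ₀).mulVec (√(N : ℝ) • gHat a α (fun t => X t ω) N θ₀))) N ω -
        (0 : Ω → EuclideanSpace ℝ (Fin 3)) ω‖} ≤
      μ.real ({ω | √(N : ℝ) * δ ≤ ‖√(N : ℝ) • gHat a α (fun t => X t ω) N θ₀‖} ∪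
        {ω | ε / η ≤ ‖√(N : ℝ) • gHat a α (fun t => X t ω) N θ₀‖}) := by
    refine ENNReal.toReal_mono (measure_ne_top _ _) (measure_mono_ae ?_)
    filter_upwards [hθ.ae_minimizes rfl (θ₀ := θ₀)] with ω hω hmem
    have hmem : ε ≤ ‖√(N : ℝ) • (θHat N ω - θ₀) - WithLp.toLp 2
        (-(C a α A θ₀).mulVec (√(N : ℝ) • gHat a α (fun t => X t ω) N θ₀)) -
        (0 : EuclideanSpace ℝ (Fin 3))‖ := hmem
    set m := gHat a α (fun t => X t ω) N θ₀ with hm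
    by_cases hmδ : ‖m‖ ≤ δ
    · refine Or.inr ?_
      have h1 := h m hmδ _ (hω N hNL).1 (hω N hNL).2
      have e : √(N : ℝ) • (θHat N ω - θ₀) -
          WithLp.toLp 2 (-(C a α A θ₀).mulVec (√(N : ℝ) • m)) - (0 : EuclideanSpace ℝ (Fin 3)) =
          √(N : ℝ) • (θHat N ω - θ₀ + WithLp.toLp 2 ((C a α A θ₀).mulVec m)) := by
        rw [Matrix.mulVec_smul, WithLp.toLp_neg, WithLp.toLp_smul, sub_zero, sub_neg_eq_add,
          smul_add]
      rw [e, norm_smul, Real.norm_of_nonneg hsq.le] at hmem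
      change ε / η ≤ ‖√(N : ℝ) • m‖
      rw [norm_smul, Real.norm_of_nonneg hsq.le, div_le_iff₀ hη0]
      have := mul_le_mul_of_nonneg_left h1 hsq.le
      linarith
    · refine Or.inl ?_
      change √(N : ℝ) * δ ≤ ‖√(N : ℝ) • m‖
      rw [norm_smul, Real.norm_of_nonneg hsq.le]
      exact mul_le_mul_of_nonneg_left (not_le.1 hmδ).le hsq.le
  refine hsub.trans_lt ((measureReal_union_le _ _).trans_lt ?_)
  have b1 := hM N hNL (√(N : ℝ) * δ) (by positivity)
  have b2 := hM N hNL (ε / η) (by positivity)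
  have b3 : M / (√(N : ℝ) * δ) ^ 2 < ε' / 2 := by
    rw [mul_pow, Real.sq_sqrt hNpos.le, div_lt_iff₀ (by positivity)]
    have : M / (δ ^ 2 * (ε' / 2)) < N := hN₀.trans_le (by exact_mod_cast hNN)
    rw [div_lt_iff₀ (by positivity)] at this
    linarith
  linarith

/-- Slutsky's lemma: the rescaled error and its linearization have the same limit law. -/
theorem IsGMMEstimator.tendstoInDistribution (hL : 1 ≤ L) (hθ : IsGMMEstimator a α A Θ X μ θHat)
    (hX : IsCenteredGaussian X (fun s t => rho θ₀ (s - t)) μ)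
    (hs : ∀ i j, Summable fun k : ℤ => crossCov a α θ₀ i j k ^ 2)
    (hV : ∀ ℓ, DifferentiableAt ℝ (V (a ℓ) α) θ₀) (hΘ : Θ ∈ 𝓝 θ₀) (hK0 : 0 < K)
    (hK : ∀ θ ∈ Θ, ‖θ - θ₀‖ ≤ K * ‖fun ℓ => V (a ℓ) α θ - V (a ℓ) α θ₀‖) (hA : A.PosDef) :
    TendstoInDistribution (fun (N : ℕ) ω => √(N : ℝ) • (θHat N ω - θ₀)) atTop id (fun _ => μ)
      (multivariateGaussian 0 (C a α A θ₀ * OmegaMatrix a α θ₀ * (C a α A θ₀).transpose)) :=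
  tendstoInDistribution_of_tendstoInMeasure_sub _ _
    (tendstoInDistribution_mulVec_gHat hL hX hs (C a α A θ₀))
    (hθ.tendstoInMeasure_sub hL hX hs hV hΘ hK0 hK hA)
    fun N => AEMeasurable.fun_const_smul ((hθ.aemeasurable N).sub_const _) _

end

end FOU

end

theorem proposition3p2 (lo hi : EuclideanSpace ℝ (Fin 3))
    (hH_pos : 0 < lo 0) (hH_lt : hi 0 < 1)
    (hlam_pos : 0 < lo 1) (hlam_lt : hi 1 < Real.exp (FOU.digamma 3))
    (hsigma : 0 < lo 2 ∨ hi 2 < 0) :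
    ∃ α₀ : ℝ, 0 < α₀ ∧ ∀ α : ℝ, 0 < α → α < α₀ →
      ∀ (L : ℕ), 3 ≤ L →
      ∀ (a : Fin L → Fin (L + 1) → ℝ) (l : Fin L → ℕ),
        (∀ i, FOU.IsFilter (a i) (l i)) → (∀ i, 1 ≤ l i) → (FOU.bMatrix a).rank = L →
      ∀ A : Matrix (Fin L) (Fin L) ℝ, A.PosDef →
      ∀ θ₀ ∈ interior (FOU.rectangle lo hi),
      ∀ {Ω : Type*} [MeasurableSpace Ω] (μ : Measure Ω) [IsProbabilityMeasure μ]
        (X : ℝ → Ω → ℝ) (θHat : ℕ → Ω → EuclideanSpace ℝ (Fin 3)),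
        FOU.IsStationaryFOU θ₀ X μ →
        FOU.IsGMMEstimator a α A (FOU.rectangle lo hi) X μ θHat →
        -- strong consistency
        (∀ᵐ ω ∂μ, Tendsto (fun N => θHat N ω) atTop (𝓝 θ₀)) ∧
        -- the matrices `G(θ₀)`, `C(θ₀)` and `Ω` are well defined
        (∀ ℓ, DifferentiableAt ℝ (FOU.V (a ℓ) α) θ₀) ∧
        IsUnit ((FOU.G a α θ₀).transpose * A * FOU.G a α θ₀) ∧
        (∀ i j, Summable fun k : ℤ => FOU.crossCov a α θ₀ i j k ^ 2) ∧
        (FOU.OmegaMatrix a α θ₀).PosSemidef ∧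
        -- asymptotic normality
        TendstoInDistribution (fun (N : ℕ) ω => √(N : ℝ) • (θHat N ω - θ₀)) atTop id
          (fun _ => μ)
          (multivariateGaussian 0
            (FOU.C a α A θ₀ * FOU.OmegaMatrix a α θ₀ * (FOU.C a α A θ₀).transpose)) := by
  obtain ⟨α₀, hα₀, h⟩ := FOU.exists_identifying_step hH_pos hH_lt hlam_pos hsigma
  refine ⟨α₀, hα₀, fun α hα hαα L hL a l ha hl hrank A hA θ₀ hθ₀ Ω _ μ _ X θHat hFOU hθ => ?_⟩
  have ha0 : ∀ i, ∑ q, a i q = 0 := fun i => (ha i).sum_eq_zero (hl i)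
  obtain ⟨K, hK⟩ := h α hα hαα L hL a ha0 hrank
  have hmem : θ₀ ∈ FOU.rectangle lo hi := interior_subset hθ₀
  have hΘ : FOU.rectangle lo hi ∈ 𝓝 θ₀ := mem_interior_iff_mem_nhds.1 hθ₀
  have h0 : 0 < θ₀ 0 := hH_pos.trans_le (hmem 0).1
  have h1 : θ₀ 0 < 1 := (hmem 0).2.trans_lt hH_lt
  have hlam : 0 < θ₀ 1 := hlam_pos.trans_le (hmem 1).1
  have hX := hFOU.isCenteredGaussian h0 h1 hlam
  have hs : ∀ i j, Summable fun k : ℤ => FOU.crossCov a α θ₀ i j k ^ 2 := fun i j =>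
    FOU.summable_crossCov_sq hα h0 h1 hlam (ha0 i)
  have hV : ∀ ℓ, DifferentiableAt ℝ (FOU.V (a ℓ) α) θ₀ := fun ℓ =>
    FOU.differentiableAt_V (a ℓ) α h0 h1 hlam
  -- The inversion constant comes without a sign; enlarging it makes it positive.
  have hK0 : 0 < |K| + 1 := by positivity
  have hK' : ∀ θ ∈ FOU.rectangle lo hi, ‖θ - θ₀‖ ≤
      (|K| + 1) * ‖fun ℓ => FOU.V (a ℓ) α θ - FOU.V (a ℓ) α θ₀‖ := fun θ hθ =>
    (hK θ hθ θ₀ hmem).trans (mul_le_mul_of_nonneg_right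
      ((le_abs_self K).trans (by linarith)) (norm_nonneg _))
  exact ⟨hθ.ae_tendsto hX hs hV hΘ hK0 hK' hA, hV,
    (FOU.posDef_transpose_G_mul_mul hA (FOU.mulVec_G_injective hV hΘ hK0 hK')).isUnit, hs,
    FOU.posSemidef_OmegaMatrix hX hs,
    hθ.tendstoInDistribution (by omega) hX hs hV hΘ hK0 hK' hA⟩
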